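/- Let $\Bbbk$ be a field of characteristic zero and fix two independent signs $\pm$ and $\mp$, forming the pair $(\pm;\mp)\in\{+,-\}^2$. **Categories.** Write $\mathbf n=\{1,\dots,n\}$ and let $\mathsf{FB}$ be the category of finite sets and bijections. For a category $\mathcal C$, $\Bbbk\mathcal C$ denotes its $\Bbbk$-linearization. For a $\Bbbk$-linear category $\mathscr A$, an $\mathscr A$-module is a $\Bbbk$-linear functor from $\mathscr A$ to $\Bbbk$-vector spaces. For $\Bbbk$-linear categories $\mathscr A,\mathscr B$, the category $\mathscr A\otimes\mathscr B$ has as objects the pairs of objects and as morphisms $\mathscr A(-,-)\otimes_\Bbbk\mathscr B(-,-)$. * $(\Bbbk\mathsf{ub})_{(\pm;\mp)}$ is the $\Bbbk$-linear category whose objects are the finite sets, with $$(\Bbbk\mathsf{ub})_{(\pm;\mp)}(A,B)=\Bbbk\,\mathsf{FB}(A\amalg(\mathbf 2\times\mathbf t),B)\otimes_{\Bbbk(\mathfrak S_2\wr\mathfrak S_t)}(\Bbbk^\pm;\Bbbk^\mp)$$ if $|B|-|A|=2t$ with $t\in\mathbb N$, and $0$ otherwise. Here $(\Bbbk^\pm;\Bbbk^\mp)$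 is the one-dimensional representation of $\mathfrak S_2\wr\mathfrak S_t=\mathfrak S_2^{\times t}\rtimes\mathfrak S_t$ on which each factor $\mathfrak S_2$ acts trivially or by the signature, according to $\pm$, and $\mathfrak S_t$ acts trivially or by the signature, according to $\mp$. * $(\Bbbk\mathsf{uwb})_{\mp}$ is the $\Bbbk$-linear category whose objects are the pairs of finite sets, with $$(\Bbbk\mathsf{uwb})_\mp((X,Y),(U,V))=\Bbbk(\mathsf{FB}\times\mathsf{FB})((X\amalg\mathbf n,Y\amalg\mathbf n),(U,V))\otimes_{\Bbbk\mathfrak S_n}\Bbbk^\mp$$ if $|U|-|X|=|V|-|Y|=n\in\mathbb N$, and $0$ otherwise. Here $\mathfrak S_n$ acts diagonally, and $\Bbbk^+$ (resp. $\Bbbk^-$) is its trivial (resp. signature) representation. In both cases composition is induced by composing bijections, after extending the first one by the identity of the second family of pairs; the pairs of the first morphism are numbered first, followed by those of the second. The morphisms of degree $0$ ($t=0$, resp. $n=0$) form the subcategories $\Bbbk\mathsf{FB}$ and $\Bbbk(\mathsf{FB}\times\mathsf{FB})$. The $\Bbbk$-linear functor $\upsilon_{(\pm;\mp)}:(\Bbbk\mathsf{uwb})_\mp\to(\Bbbk\mathsf{ub})_{(\pm;\mp)}$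 is $(X,Y)\mapsto X\amalg Y$ on objects. On morphisms it sends the class of $(f,g)$ to the class of $f\amalg g$, where the two copies of $\mathbf n$ are identified with $\{1\}\times\mathbf n$ and $\{2\}\times\mathbf n$, in this order. **Modules.** Let $\upsilon^*_{(\pm;\mp)}(\Bbbk\mathsf{ub})_{(\pm;\mp)}$ be the $\Bbbk\mathsf{FB}^{\mathrm{op}}\otimes(\Bbbk\mathsf{uwb})_\mp$-module $$(U,(X,Y))\longmapsto(\Bbbk\mathsf{ub})_{(\pm;\mp)}(U,X\amalg Y)$$ obtained from the canonical bimodule $(\Bbbk\mathsf{ub})_{(\pm;\mp)}$ by restriction along $\upsilon_{(\pm;\mp)}$ in the covariant variable and to $\Bbbk\mathsf{FB}$ in the contravariant variable. Let $\amalg_*^{\mathrm{op}}\big((\Bbbk\mathsf{ub})_{(\pm;\mp)}^{\otimes2}\big)$ be the $\Bbbk\mathsf{FB}^{\mathrm{op}}\otimes\Bbbk(\mathsf{FB}\times\mathsf{FB})$-module $$(U,(S,T))\longmapsto\bigoplus_{U=U_1\amalg U_2}(\Bbbk\mathsf{ub})_{(\pm;\mp)}(U_1,S)\otimes_\Bbbk(\Bbbk\mathsf{ub})_{(\pm;\mp)}(U_2,T),$$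 where the sum is over the ordered decompositions of $U$ into two subsets and a bijection $U'\to U$ acts by restriction to the corresponding decompositions. **Theorem.** There is an isomorphism of $\Bbbk\mathsf{FB}^{\mathrm{op}}\otimes(\Bbbk\mathsf{uwb})_\mp$-modules $$\upsilon^*_{(\pm;\mp)}(\Bbbk\mathsf{ub})_{(\pm;\mp)}\;\cong\;(\Bbbk\mathsf{uwb})_\mp\otimes_{\Bbbk(\mathsf{FB}\times\mathsf{FB})}\amalg_*^{\mathrm{op}}\big((\Bbbk\mathsf{ub})_{(\pm;\mp)}^{\otimes2}\big).$$ Here $\otimes_{\Bbbk(\mathsf{FB}\times\mathsf{FB})}$ is formed with respect to the restricted $\Bbbk(\mathsf{FB}\times\mathsf{FB})^{\mathrm{op}}$-module structure of $(\Bbbk\mathsf{uwb})_\mp$ and the $\Bbbk(\mathsf{FB}\times\mathsf{FB})$-module structure of $\amalg_*^{\mathrm{op}}\big((\Bbbk\mathsf{ub})_{(\pm;\mp)}^{\otimes2}\big)$, and the module structure on the right-hand side is the residual one. -/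

import Mathlib

open CategoryTheory Opposite
open scoped TensorProduct DirectSum

universe u

noncomputable section

namespace TwistedBrauer

/-! ### Generalities on `k`-linear categories and their modules -/

section Generalities

variable (k : Type u) [CommRing k]

/-- The opposite of a `k`-linear category is `k`-linear. -/
instance opLinear (𝒜 : Type*) [Category 𝒜] [Preadditive 𝒜] [Linear k 𝒜] : Linear k 𝒜ᵒᵖ where
  homModule X Y :=
    { smul := fun c f => (c • f.unop).op
      one_smul := fun f => by
        change (_ • f.unop).op = _; rw [one_smul]; rfl
      mul_smul := fun a b f => by
        change (_ • f.unop).op = (a • (b • f.unop)).op; rw [mul_smul]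
      smul_zero := fun a => by
        change (a • (0 : Y.unop ⟶ X.unop)).op = _; rw [smul_zero]; rfl
      smul_add := fun a f g => by
        change (a • (f.unop + g.unop)).op = (a • f.unop + a • g.unop).op; rw [smul_add]
      add_smul := fun a b f => by
        change (_ • f.unop).op = (a • f.unop + b • f.unop).op; rw [add_smul]
      zero_smul := fun f => by
        change (_ • f.unop).op = _; rw [zero_smul]; rfl }
  smul_comp X Y Z c f g := Quiver.Hom.unop_inj (Linear.comp_smul _ _ _ g.unop c f.unop)
  comp_smul X Y Z f c g := Quiver.Hom.unop_inj (Linear.smul_comp _ _ _ c g.unop f.unop)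

/-- The category `𝒜-mod` of (left) modules over a `k`-linear category `𝒜`: the `k`-linear functors
from `𝒜` to `k`-modules, and all natural transformations between them. -/
abbrev LMod (𝒜 : Type*) [Category 𝒜] [Preadditive 𝒜] [Linear k 𝒜] :=
  ObjectProperty.FullSubcategory
    (fun F : 𝒜 ⥤ ModuleCat.{u} k => F.Additive ∧ F.Linear k)

/-- A `k`-linear functor between `k`-linear categories. -/
structure LFunctor (𝒜 ℬ : Type*) [Category 𝒜] [Preadditive 𝒜] [Linear k 𝒜]
    [Category ℬ] [Preadditive ℬ] [Linear k ℬ] where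
  func : 𝒜 ⥤ ℬ
  add : func.Additive
  lin : func.Linear k

section

variable {k}
variable {𝒜 ℬ 𝒞 𝒟 : Type*} [Category 𝒜] [Preadditive 𝒜] [Linear k 𝒜]
  [Category ℬ] [Preadditive ℬ] [Linear k ℬ] [Category 𝒞] [Preadditive 𝒞] [Linear k 𝒞]
  [Category 𝒟] [Preadditive 𝒟] [Linear k 𝒟]

/-- The action of a `k`-linear functor on morphisms, as a `k`-linear map. -/
def LFunctor.mapₗ (F : LFunctor k 𝒜 ℬ) (X Y : 𝒜) :
    (X ⟶ Y) →ₗ[k] (F.func.obj X ⟶ F.func.obj Y) where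
  toFun f := F.func.map f
  map_add' f g := by have := F.add; exact F.func.map_add
  map_smul' c f := by have := F.lin; exact F.func.map_smul c f

/-- The opposite of a `k`-linear functor. -/
def LFunctor.op (F : LFunctor k 𝒜 ℬ) : LFunctor k 𝒜ᵒᵖ ℬᵒᵖ where
  func := F.func.op
  add := ⟨fun {X Y f g} =>
    Quiver.Hom.unop_inj ((F.mapₗ Y.unop X.unop).map_add f.unop g.unop)⟩
  lin := ⟨fun {X Y} f c =>
    Quiver.Hom.unop_inj ((F.mapₗ Y.unop X.unop).map_smul c f.unop)⟩

/-- The identity functor. -/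
def LFunctor.id : LFunctor k 𝒜 𝒜 where
  func := 𝟭 𝒜
  add := inferInstance
  lin := inferInstance

/-- Composition of `k`-linear functors. -/
def LFunctor.comp (F : LFunctor k 𝒜 ℬ) (G : LFunctor k ℬ 𝒞) : LFunctor k 𝒜 𝒞 where
  func := F.func ⋙ G.func
  add := by have := F.add; have := G.add; infer_instance
  lin := by have := F.lin; have := G.lin; infer_instance

/-- Restriction `F^* M` of a module `M` along a `k`-linear functor `F`. -/
def LMod.restrict (F : LFunctor k 𝒜 ℬ) (M : LMod k ℬ) : LMod k 𝒜 where
  obj := F.func ⋙ M.obj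
  property := by
    have := F.add; have := F.lin; have := M.property.1; have := M.property.2
    exact ⟨inferInstance, inferInstance⟩

/-- The action of morphisms on a module, as a `k`-linear map. -/
def LMod.act (M : LMod k 𝒜) (X Y : 𝒜) : (X ⟶ Y) →ₗ[k] (M.obj.obj X →ₗ[k] M.obj.obj Y) where
  toFun f := (M.obj.map f).hom
  map_add' f g := by
    have := M.property.1; rw [M.obj.map_add]; rfl
  map_smul' c f := by
    have := M.property.2; rw [M.obj.map_smul]; rfl

lemma LMod.act_id (M : LMod k 𝒜) (X : 𝒜) : M.act X X (𝟙 X) = LinearMap.id := by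
  change (M.obj.map (𝟙 X)).hom = _
  rw [M.obj.map_id]; rfl

lemma LMod.act_comp (M : LMod k 𝒜) {X Y Z : 𝒜} (f : X ⟶ Y) (g : Y ⟶ Z) :
    M.act X Z (f ≫ g) = M.act Y Z g ∘ₗ M.act X Y f := by
  change (M.obj.map (f ≫ g)).hom = _
  rw [M.obj.map_comp]; rfl

/-- A module from a linear family of actions. -/
def LMod.ofAct (V : 𝒜 → ModuleCat.{u} k)
    (a : ∀ X Y : 𝒜, (X ⟶ Y) →ₗ[k] (V X →ₗ[k] V Y))
    (a_id : ∀ X, a X X (𝟙 X) = LinearMap.id)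
    (a_comp : ∀ {X Y Z : 𝒜} (f : X ⟶ Y) (g : Y ⟶ Z), a X Z (f ≫ g) = a Y Z g ∘ₗ a X Y f) :
    LMod k 𝒜 where
  obj :=
    { obj := V
      map := fun f => ModuleCat.ofHom (a _ _ f)
      map_id := fun X => by rw [a_id]; rfl
      map_comp := fun f g => by rw [a_comp]; rfl }
  property :=
    ⟨⟨fun {X Y f g} => by
        change ModuleCat.ofHom (a X Y (f + g)) = _; rw [map_add]; rfl⟩,
     ⟨fun {X Y} f c => by
        change ModuleCat.ofHom (a X Y (c • f)) = _; rw [map_smul]; rfl⟩⟩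

end

/-- The tensor product `𝒜 ⊗ ℬ` of two `k`-linear categories: objects are pairs of objects and
morphisms are `𝒜(-,-) ⊗ ℬ(-,-)`. -/
structure TensorCat (k : Type u) (𝒜 ℬ : Type*) where
  fst : 𝒜
  snd : ℬ

namespace TensorCat

variable {k}
variable {𝒜 ℬ 𝒞 𝒟 : Type*} [Category.{u} 𝒜] [Preadditive 𝒜] [Linear k 𝒜]
  [Category.{u} ℬ] [Preadditive ℬ] [Linear k ℬ] [Category.{u} 𝒞] [Preadditive 𝒞] [Linear k 𝒞]
  [Category.{u} 𝒟] [Preadditive 𝒟] [Linear k 𝒟]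

instance category : Category.{u} (TensorCat k 𝒜 ℬ) where
  Hom P Q := (P.fst ⟶ Q.fst) ⊗[k] (P.snd ⟶ Q.snd)
  id P := 𝟙 P.fst ⊗ₜ[k] 𝟙 P.snd
  comp {P Q R} x y := TensorProduct.map₂ (Linear.comp P.fst Q.fst R.fst)
    (Linear.comp P.snd Q.snd R.snd) x y
  id_comp {P Q} x := by
    induction x using TensorProduct.induction_on with
    | zero => simp
    | tmul f g => simp
    | add x y hx hy => rw [map_add, hx, hy]
  comp_id {P Q} x := by
    induction x using TensorProduct.induction_on with
    | zero => simp
    | tmul f g => simp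
    | add x y hx hy => rw [map_add, LinearMap.add_apply, hx, hy]
  assoc {P Q R S} x y z := by
    induction x using TensorProduct.induction_on with
    | zero => simp
    | add x x' hx hx' => simp only [map_add, LinearMap.add_apply, hx, hx']
    | tmul f g =>
      induction y using TensorProduct.induction_on with
      | zero => simp
      | add y y' hy hy' => simp only [map_add, LinearMap.add_apply, hy, hy']
      | tmul f' g' =>
        induction z using TensorProduct.induction_on with
        | zero => simp
        | add z z' hz hz' => simp only [map_add, hz, hz']
        | tmul f'' g'' => simp

instance preadditive : Preadditive (TensorCat k 𝒜 ℬ) where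
  homGroup P Q := inferInstanceAs (AddCommGroup ((P.fst ⟶ Q.fst) ⊗[k] (P.snd ⟶ Q.snd)))
  add_comp P Q R x x' y := by
    exact LinearMap.congr_fun (LinearMap.map_add (TensorProduct.map₂
      (Linear.comp (S := k) P.fst Q.fst R.fst) (Linear.comp P.snd Q.snd R.snd)) x x') y
  comp_add P Q R x y y' := LinearMap.map_add (TensorProduct.map₂
    (Linear.comp (S := k) P.fst Q.fst R.fst) (Linear.comp P.snd Q.snd R.snd) x) y y'

instance linear : Linear k (TensorCat k 𝒜 ℬ) where
  homModule P Q := inferInstanceAs (Module k ((P.fst ⟶ Q.fst) ⊗[k] (P.snd ⟶ Q.snd)))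
  smul_comp P Q R c x y := by
    exact LinearMap.congr_fun (LinearMap.map_smul (TensorProduct.map₂
      (Linear.comp (S := k) P.fst Q.fst R.fst) (Linear.comp P.snd Q.snd R.snd)) c x) y
  comp_smul P Q R x c y := LinearMap.map_smul (TensorProduct.map₂
    (Linear.comp (S := k) P.fst Q.fst R.fst) (Linear.comp P.snd Q.snd R.snd) x) c y

/-- The morphism `f ⊗ g` of `𝒜 ⊗ ℬ`. -/
def tmul {A A' : 𝒜} {B B' : ℬ} (f : A ⟶ A') (g : B ⟶ B') :
    (⟨A, B⟩ : TensorCat k 𝒜 ℬ) ⟶ ⟨A', B'⟩ :=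
  f ⊗ₜ[k] g

lemma tmul_comp {A A' A'' : 𝒜} {B B' B'' : ℬ} (f : A ⟶ A') (g : B ⟶ B')
    (f' : A' ⟶ A'') (g' : B' ⟶ B'') :
    (tmul f g : (⟨A, B⟩ : TensorCat k 𝒜 ℬ) ⟶ _) ≫ tmul f' g' = tmul (f ≫ f') (g ≫ g') :=
  rfl

/-- The tensor product `F ⊗ G` of two `k`-linear functors. -/
def map (F : LFunctor k 𝒜 𝒞) (G : LFunctor k ℬ 𝒟) :
    LFunctor k (TensorCat k 𝒜 ℬ) (TensorCat k 𝒞 𝒟) where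
  func :=
    { obj := fun P => ⟨F.func.obj P.fst, G.func.obj P.snd⟩
      map := fun {P Q} x => TensorProduct.map (F.mapₗ P.fst Q.fst) (G.mapₗ P.snd Q.snd) x
      map_id := fun P => by
        change F.func.map (𝟙 _) ⊗ₜ[k] G.func.map (𝟙 _) = _
        rw [F.func.map_id, G.func.map_id]; rfl
      map_comp := fun {P Q R} x y => by
        change TensorProduct.map _ _ (TensorProduct.map₂ _ _ x y) =
          TensorProduct.map₂ _ _ (TensorProduct.map _ _ x) (TensorProduct.map _ _ y)
        induction x using TensorProduct.induction_on with
        | zero => simp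
        | add x x' hx hx' => simp only [map_add, LinearMap.add_apply, hx, hx']
        | tmul f g =>
          induction y using TensorProduct.induction_on with
          | zero => simp
          | add y y' hy hy' => simp only [map_add, hy, hy']
          | tmul f' g' =>
            change F.func.map (f ≫ f') ⊗ₜ[k] G.func.map (g ≫ g') =
              (F.func.map f ≫ F.func.map f') ⊗ₜ[k] (G.func.map g ≫ G.func.map g')
            rw [F.func.map_comp, G.func.map_comp] }
  add := ⟨fun {P Q x y} => map_add (TensorProduct.map (F.mapₗ P.fst Q.fst) (G.mapₗ P.snd Q.snd)) x y⟩
  lin := ⟨fun {P Q} x c =>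
    map_smul (TensorProduct.map (F.mapₗ P.fst Q.fst) (G.mapₗ P.snd Q.snd)) c x⟩

/-- A module over `𝒜 ⊗ ℬ` from two commuting `k`-linear actions: `l` of `𝒜` and `r` of `ℬ`; the
morphism `f ⊗ g` acts by `l f ∘ r g`. -/
def moduleOfActs (V : 𝒜 → ℬ → ModuleCat.{u} k)
    (l : ∀ A A' B, (A ⟶ A') →ₗ[k] (V A B →ₗ[k] V A' B))
    (r : ∀ A B B', (B ⟶ B') →ₗ[k] (V A B →ₗ[k] V A B'))
    (l_id : ∀ A B, l A A B (𝟙 A) = LinearMap.id)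
    (l_comp : ∀ {A A' A'' : 𝒜} (B) (f : A ⟶ A') (f' : A' ⟶ A''),
      l A A'' B (f ≫ f') = l A' A'' B f' ∘ₗ l A A' B f)
    (r_id : ∀ A B, r A B B (𝟙 B) = LinearMap.id)
    (r_comp : ∀ (A) {B B' B'' : ℬ} (g : B ⟶ B') (g' : B' ⟶ B''),
      r A B B'' (g ≫ g') = r A B' B'' g' ∘ₗ r A B B' g)
    (comm : ∀ {A A' : 𝒜} {B B' : ℬ} (f : A ⟶ A') (g : B ⟶ B'),
      r A' B B' g ∘ₗ l A A' B f = l A A' B' f ∘ₗ r A B B' g) :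
    LMod k (TensorCat k 𝒜 ℬ) :=
  LMod.ofAct (fun P => V P.fst P.snd)
    (fun P Q => TensorProduct.lift
      (((LinearMap.llcomp k (V P.fst P.snd) (V P.fst Q.snd) (V Q.fst Q.snd)).comp
        (l P.fst Q.fst Q.snd)).compl₂ (r P.fst P.snd Q.snd)))
    (fun P => by
      change l _ _ _ (𝟙 _) ∘ₗ r _ _ _ (𝟙 _) = _
      rw [l_id, r_id]; rfl)
    (fun {P Q R} x y => by
      change TensorProduct.lift _ (TensorProduct.map₂ _ _ x y) = _
      induction x using TensorProduct.induction_on with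
      | zero => simp
      | add x x' hx hx' => simp only [map_add, LinearMap.add_apply, LinearMap.comp_add, hx, hx']
      | tmul f g =>
        induction y using TensorProduct.induction_on with
        | zero => simp
        | add y y' hy hy' => simp only [map_add, LinearMap.add_comp, hy, hy']
        | tmul f' g' =>
          change l _ _ _ (f ≫ f') ∘ₗ r _ _ _ (g ≫ g') =
            (l _ _ _ f' ∘ₗ r _ _ _ g') ∘ₗ (l _ _ _ f ∘ₗ r _ _ _ g)
          rw [l_comp, r_comp]
          calc _ = l _ _ _ f' ∘ₗ (l _ _ _ f ∘ₗ r _ _ _ g') ∘ₗ r _ _ _ g := rfl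
            _ = _ := by rw [← comm]; rfl)

/-- `A ↦ (A, B)`, `f ↦ f ⊗ 𝟙`. -/
def inl (B : ℬ) : LFunctor k 𝒜 (TensorCat k 𝒜 ℬ) where
  func :=
    { obj := fun A => ⟨A, B⟩
      map := fun f => tmul f (𝟙 B)
      map_id := fun _ => rfl
      map_comp := fun f g => by rw [tmul_comp, Category.id_comp] }
  add := ⟨fun {_ _ f g} => TensorProduct.add_tmul f g _⟩
  lin := ⟨fun f c => (TensorProduct.smul_tmul' c f (𝟙 B)).symm⟩

/-- `B ↦ (A, B)`, `g ↦ 𝟙 ⊗ g`. -/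
def inr (A : 𝒜) : LFunctor k ℬ (TensorCat k 𝒜 ℬ) where
  func :=
    { obj := fun B => ⟨A, B⟩
      map := fun g => tmul (𝟙 A) g
      map_id := fun _ => rfl
      map_comp := fun f g => by rw [tmul_comp, Category.id_comp] }
  add := ⟨fun {_ _ f g} => TensorProduct.tmul_add _ f g⟩
  lin := ⟨fun g c => TensorProduct.tmul_smul c (𝟙 A) g⟩

end TensorCat

section Bimodules

variable {k}
variable {𝒜 ℬ 𝒞 : Type*} [Category.{u} 𝒜] [Preadditive 𝒜] [Linear k 𝒜]
  [Category.{u} ℬ] [Preadditive ℬ] [Linear k ℬ] [Category.{u} 𝒞] [Preadditive 𝒞] [Linear k 𝒞]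

/-- In a module over `𝒜 ⊗ ℬ`, the action of `f ⊗ 𝟙`. -/
def actL (M : LMod k (TensorCat k 𝒜 ℬ)) (A A' : 𝒜) (B : ℬ) :
    (A ⟶ A') →ₗ[k] (M.obj.obj ⟨A, B⟩ →ₗ[k] M.obj.obj ⟨A', B⟩) :=
  (M.restrict (TensorCat.inl B)).act A A'

/-- In a module over `𝒜 ⊗ ℬ`, the action of `𝟙 ⊗ g`. -/
def actR (M : LMod k (TensorCat k 𝒜 ℬ)) (A : 𝒜) (B B' : ℬ) :
    (B ⟶ B') →ₗ[k] (M.obj.obj ⟨A, B⟩ →ₗ[k] M.obj.obj ⟨A, B'⟩) :=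
  (M.restrict (TensorCat.inr A)).act B B'

lemma actL_id (M : LMod k (TensorCat k 𝒜 ℬ)) (A : 𝒜) (B : ℬ) :
    actL M A A B (𝟙 A) = LinearMap.id := LMod.act_id _ _

lemma actL_comp (M : LMod k (TensorCat k 𝒜 ℬ)) {A A' A'' : 𝒜} (B : ℬ) (f : A ⟶ A')
    (f' : A' ⟶ A'') : actL M A A'' B (f ≫ f') = actL M A' A'' B f' ∘ₗ actL M A A' B f :=
  LMod.act_comp _ _ _

lemma actR_id (M : LMod k (TensorCat k 𝒜 ℬ)) (A : 𝒜) (B : ℬ) :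
    actR M A B B (𝟙 B) = LinearMap.id := LMod.act_id _ _

lemma actR_comp (M : LMod k (TensorCat k 𝒜 ℬ)) (A : 𝒜) {B B' B'' : ℬ} (g : B ⟶ B')
    (g' : B' ⟶ B'') : actR M A B B'' (g ≫ g') = actR M A B' B'' g' ∘ₗ actR M A B B' g :=
  LMod.act_comp _ _ _

lemma act_comm (M : LMod k (TensorCat k 𝒜 ℬ)) {A A' : 𝒜} {B B' : ℬ} (f : A ⟶ A')
    (g : B ⟶ B') : actR M A' B B' g ∘ₗ actL M A A' B f = actL M A A' B' f ∘ₗ actR M A B B' g := by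
  have h : TensorCat.tmul f (𝟙 B) ≫ TensorCat.tmul (𝟙 A') g =
      (TensorCat.tmul (𝟙 A) g ≫ TensorCat.tmul f (𝟙 B') :
        (⟨A, B⟩ : TensorCat k 𝒜 ℬ) ⟶ ⟨A', B'⟩) := by
    simp [TensorCat.tmul_comp]
  exact (M.act_comp _ _).symm.trans ((congrArg (M.act _ _) h).trans (M.act_comp _ _))

variable (k 𝒜) in
/-- The canonical `𝒜`-bimodule: the `𝒜ᵒᵖ ⊗ 𝒜`-module `(X, Y) ↦ 𝒜(X, Y)`. -/
def homBimodule : LMod k (TensorCat k 𝒜ᵒᵖ 𝒜) :=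
  TensorCat.moduleOfActs (fun X Y => ModuleCat.of k (X.unop ⟶ Y))
    (fun X X' Y =>
      { toFun := fun f => Linear.leftComp k Y f.unop
        map_add' := fun f g => by ext h; exact Preadditive.add_comp _ _ _ f.unop g.unop h
        map_smul' := fun c f => by ext h; exact Linear.smul_comp _ _ _ c f.unop h })
    (fun X Y Y' =>
      { toFun := fun g => Linear.rightComp k X.unop g
        map_add' := fun f g => by ext h; exact Preadditive.comp_add _ _ _ h f g
        map_smul' := fun c f => by ext h; exact Linear.comp_smul _ _ _ h c f })
    (fun X Y => by ext h; exact Category.id_comp h)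
    (fun {X X' X''} Y f f' => by ext h; exact Category.assoc f'.unop f.unop h)
    (fun X Y => by ext h; exact Category.comp_id h)
    (fun X {Y Y' Y''} g g' => by ext h; exact (Category.assoc h g g').symm)
    (fun {X X' Y Y'} f g => by ext h; exact Category.assoc f.unop h g)

variable (𝒜) in
/-- A family of objects of `𝒜`, indexed by a set, meeting every isomorphism class. -/
structure Representatives where
  ι : Type
  [dec : DecidableEq ι]
  obj : ι → 𝒜
  exists_iso : ∀ A : 𝒜, ∃ i, Nonempty (A ≅ obj i)

attribute [instance] Representatives.dec

/-- The relations defining `(M ⊗_𝒜 N)(C, B)`: for `f : a_i ⟶ a_j`, `x ∈ M(a_j, B)` and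
`y ∈ N(C, a_i)`, the elements `x f ⊗ y` and `x ⊗ f y` are identified. -/
def balancedRel (E : Representatives 𝒜) (M : LMod k (TensorCat k 𝒜ᵒᵖ ℬ))
    (N : LMod k (TensorCat k 𝒞 𝒜)) (C : 𝒞) (B : ℬ) : Submodule k
      (⨁ i : E.ι, (M.obj.obj ⟨op (E.obj i), B⟩ ⊗[k] N.obj.obj ⟨C, E.obj i⟩)) :=
  Submodule.span k { z | ∃ (i j : E.ι) (f : E.obj i ⟶ E.obj j)
    (x : M.obj.obj ⟨op (E.obj j), B⟩) (y : N.obj.obj ⟨C, E.obj i⟩),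
    z = DirectSum.lof k E.ι _ i (actL M _ _ B f.op x ⊗ₜ[k] y) -
      DirectSum.lof k E.ι _ j (x ⊗ₜ[k] actR N C _ _ f y) }

/-- The map induced by commuting maps on summands of a tensor product over `𝒜`. -/
def balancedMap (E : Representatives 𝒜) (M : LMod k (TensorCat k 𝒜ᵒᵖ ℬ))
    (N : LMod k (TensorCat k 𝒞 𝒜)) {C C' : 𝒞} {B B' : ℬ} (γ : C ⟶ C') (β : B ⟶ B') :
    (⨁ i : E.ι, (M.obj.obj ⟨op (E.obj i), B⟩ ⊗[k] N.obj.obj ⟨C, E.obj i⟩)) →ₗ[k]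
      ⨁ i : E.ι, (M.obj.obj ⟨op (E.obj i), B'⟩ ⊗[k] N.obj.obj ⟨C', E.obj i⟩) :=
  DirectSum.lmap fun i => TensorProduct.map (actR M (op (E.obj i)) B B' β) (actL N C C' (E.obj i) γ)

lemma balancedMap_le (E : Representatives 𝒜) (M : LMod k (TensorCat k 𝒜ᵒᵖ ℬ))
    (N : LMod k (TensorCat k 𝒞 𝒜)) {C C' : 𝒞} {B B' : ℬ} (γ : C ⟶ C') (β : B ⟶ B') :
    balancedRel E M N C B ≤ (balancedRel E M N C' B').comap (balancedMap E M N γ β) := by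
  refine Submodule.span_le.2 ?_
  rintro _ ⟨i, j, f, x, y, rfl⟩
  refine Submodule.subset_span ⟨i, j, f, actR M _ B B' β x, actL N C C' _ γ y, ?_⟩
  have h1 := LinearMap.congr_fun (act_comm M f.op β) x
  have h2 := LinearMap.congr_fun (act_comm N γ f) y
  simp only [LinearMap.comp_apply] at h1 h2
  rw [map_sub, balancedMap, DirectSum.lmap_lof, DirectSum.lmap_lof, TensorProduct.map_tmul,
    TensorProduct.map_tmul, h1, h2]

/-- The action of `γ ⊗ β` on `M ⊗_𝒜 N`. -/
def balancedQ (E : Representatives 𝒜) (M : LMod k (TensorCat k 𝒜ᵒᵖ ℬ))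
    (N : LMod k (TensorCat k 𝒞 𝒜)) {C C' : 𝒞} {B B' : ℬ} (γ : C ⟶ C') (β : B ⟶ B') :
    (_ ⧸ balancedRel E M N C B) →ₗ[k] (_ ⧸ balancedRel E M N C' B') :=
  Submodule.mapQ _ _ (balancedMap E M N γ β) (balancedMap_le E M N γ β)

/-- The class of `x ⊗ y` in `M ⊗_𝒜 N`. -/
def balancedMk (E : Representatives 𝒜) (M : LMod k (TensorCat k 𝒜ᵒᵖ ℬ))
    (N : LMod k (TensorCat k 𝒞 𝒜)) {C : 𝒞} {B : ℬ} (i : E.ι)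
    (x : M.obj.obj ⟨op (E.obj i), B⟩) (y : N.obj.obj ⟨C, E.obj i⟩) :
    _ ⧸ balancedRel E M N C B :=
  Submodule.Quotient.mk (DirectSum.lof k E.ι
    (fun i => M.obj.obj ⟨op (E.obj i), B⟩ ⊗[k] N.obj.obj ⟨C, E.obj i⟩) i (x ⊗ₜ[k] y))

lemma balancedQ_mk (E : Representatives 𝒜) (M : LMod k (TensorCat k 𝒜ᵒᵖ ℬ))
    (N : LMod k (TensorCat k 𝒞 𝒜)) {C C' : 𝒞} {B B' : ℬ} (γ : C ⟶ C') (β : B ⟶ B') (i : E.ι)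
    (x : M.obj.obj ⟨op (E.obj i), B⟩) (y : N.obj.obj ⟨C, E.obj i⟩) :
    balancedQ E M N γ β (balancedMk E M N i x y) =
      balancedMk E M N i (actR M _ _ _ β x) (actL N _ _ _ γ y) := by
  simp only [balancedQ, balancedMk, Submodule.mapQ_apply, balancedMap, DirectSum.lmap_lof,
    TensorProduct.map_tmul]

lemma balanced_ext (E : Representatives 𝒜) (M : LMod k (TensorCat k 𝒜ᵒᵖ ℬ))
    (N : LMod k (TensorCat k 𝒞 𝒜)) {C : 𝒞} {B : ℬ} {V : Type*} [AddCommGroup V] [Module k V]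
    {f g : (_ ⧸ balancedRel E M N C B) →ₗ[k] V}
    (h : ∀ i x y, f (balancedMk E M N i x y) = g (balancedMk E M N i x y)) : f = g := by
  apply Submodule.linearMap_qext
  apply DirectSum.linearMap_ext
  intro i
  apply TensorProduct.ext'
  intro x y
  exact h i x y

/-- The tensor product `M ⊗_𝒜 N` over the `k`-linear category `𝒜` of an `𝒜ᵒᵖ ⊗ ℬ`-module `M` and
a `𝒞 ⊗ 𝒜`-module `N`, a `𝒞 ⊗ ℬ`-module: the coend of `M(a, B) ⊗ N(C, a)` over `a`, computed on a
family of representatives of the isomorphism classes of objects of `𝒜`. -/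
def tensorOver (E : Representatives 𝒜) (M : LMod k (TensorCat k 𝒜ᵒᵖ ℬ))
    (N : LMod k (TensorCat k 𝒞 𝒜)) : LMod k (TensorCat k 𝒞 ℬ) :=
  TensorCat.moduleOfActs (fun C B => ModuleCat.of k (_ ⧸ balancedRel E M N C B))
    (fun C C' B =>
      { toFun := fun γ => balancedQ E M N γ (𝟙 B)
        map_add' := fun γ γ' => by
          apply balanced_ext
          intro i x y
          simp only [LinearMap.add_apply, balancedQ_mk, map_add]
          simp only [balancedMk, TensorProduct.tmul_add, map_add]; rfl
        map_smul' := fun c γ => by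
          apply balanced_ext
          intro i x y
          simp only [LinearMap.smul_apply, balancedQ_mk, map_smul, RingHom.id_apply]
          simp only [balancedMk, TensorProduct.tmul_smul, map_smul]; rfl })
    (fun C B B' =>
      { toFun := fun β => balancedQ E M N (𝟙 C) β
        map_add' := fun β β' => by
          apply balanced_ext
          intro i x y
          simp only [LinearMap.add_apply, balancedQ_mk, map_add]
          simp only [balancedMk, TensorProduct.add_tmul, map_add]; rfl
        map_smul' := fun c β => by
          apply balanced_ext
          intro i x y
          simp only [LinearMap.smul_apply, balancedQ_mk, map_smul, RingHom.id_apply]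
          simp only [balancedMk, ← TensorProduct.smul_tmul', map_smul]; rfl })
    (fun C B => balanced_ext E M N fun i x y => by
      simp [balancedQ_mk, actL_id, actR_id])
    (fun B f f' => balanced_ext E M N fun i x y => by
      simp [balancedQ_mk, actL_comp, actR_id])
    (fun C B => balanced_ext E M N fun i x y => by
      simp [balancedQ_mk, actL_id, actR_id])
    (fun C {_ _ _} g g' => balanced_ext E M N fun i x y => by
      simp [balancedQ_mk, actL_id, actR_comp])
    (fun f g => balanced_ext E M N fun i x y => by
      simp [balancedQ_mk, actL_id, actR_id])

end Bimodules

section FreeAndQuotients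

variable {k}
variable {C : Type*} [Category.{0} C] {𝒜 ℬ : Type*} [Category.{u} 𝒜] [Preadditive 𝒜] [Linear k 𝒜]
  [Category.{u} ℬ] [Preadditive ℬ] [Linear k ℬ]

variable (k) in
/-- The basis element of `k C` given by a morphism of `C`. -/
def basis {X Y : C} (f : X ⟶ Y) : Free.of k X ⟶ Free.of k Y := (Free.embedding k C).map f

lemma basis_id (X : C) : basis k (𝟙 X) = 𝟙 (Free.of k X) := (Free.embedding k C).map_id X

lemma basis_comp {X Y Z : C} (f : X ⟶ Y) (g : Y ⟶ Z) :
    basis k (f ≫ g) = basis k f ≫ basis k g := (Free.embedding k C).map_comp f g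

/-- The linear map out of a morphism space of `k C` with prescribed values on morphisms of `C`. -/
def freeLift₀ {V : Type*} [AddCommGroup V] [Module k V] (X Y : C) (φ : (X ⟶ Y) → V) :
    (Free.of k X ⟶ Free.of k Y) →ₗ[k] V :=
  Finsupp.lsum k (fun f => LinearMap.toSpanSingleton k V (φ f))

lemma freeLift₀_basis {V : Type*} [AddCommGroup V] [Module k V] (X Y : C) (φ : (X ⟶ Y) → V)
    (f : X ⟶ Y) : freeLift₀ X Y φ (basis k f) = φ f := by
  change Finsupp.lsum k (fun f => LinearMap.toSpanSingleton k V (φ f)) (Finsupp.single f 1) = _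
  simp

lemma smul_basis {X Y : C} (c : k) (f : X ⟶ Y) :
    c • basis k f = (Finsupp.single f c : (X ⟶ Y) →₀ k) :=
  Finsupp.smul_single_one (α := X ⟶ Y) f c

lemma free_induction {X Y : C} {P : (Free.of k X ⟶ Free.of k Y) → Prop} (h0 : P 0)
    (hadd : ∀ x y, P x → P y → P (x + y)) (hb : ∀ (c : k) (f : X ⟶ Y), P (c • basis k f))
    (x : Free.of k X ⟶ Free.of k Y) : P x :=
  Finsupp.induction_linear (motive := P) x h0 hadd
    fun f c => Eq.mp (congrArg P (smul_basis c f)) (hb c f)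

lemma free_ext {X Y : C} {V : Type*} [AddCommGroup V] [Module k V]
    {F G : (Free.of k X ⟶ Free.of k Y) →ₗ[k] V} (h : ∀ f : X ⟶ Y, F (basis k f) = G (basis k f)) :
    F = G := by
  ext x
  induction x using free_induction with
  | h0 => simp
  | hadd x y hx hy => simp [hx, hy]
  | hb c f => simp [h f]

/-- The `k`-linear extension to morphisms of `k C` of the action on morphisms of a functor. -/
def freeMap (F : C ⥤ 𝒜) (X Y : C) : (Free.of k X ⟶ Free.of k Y) →ₗ[k] (F.obj X ⟶ F.obj Y) :=
  freeLift₀ X Y F.map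

lemma freeMap_basis (F : C ⥤ 𝒜) {X Y : C} (f : X ⟶ Y) :
    freeMap (k := k) F X Y (basis k f) = F.map f := freeLift₀_basis X Y _ f

lemma freeMap_id (F : C ⥤ 𝒜) (X : C) :
    freeMap F X X (𝟙 (Free.of k X)) = 𝟙 (F.obj X) := by
  rw [← basis_id, freeMap_basis, F.map_id]

lemma freeMap_comp (F : C ⥤ 𝒜) (X Y Z : C) (x : Free.of k X ⟶ Free.of k Y)
    (y : Free.of k Y ⟶ Free.of k Z) : freeMap F X Z (x ≫ y) =
      freeMap F X Y x ≫ freeMap F Y Z y := by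
  have : (Linear.comp (Free.of k X) (Free.of k Y) (Free.of k Z)).compr₂
      (freeMap (k := k) F X Z) =
    (Linear.comp (F.obj X) (F.obj Y) (F.obj Z)).compl₁₂
      (freeMap (k := k) F X Y) (freeMap (k := k) F Y Z) := by
    refine free_ext fun f => free_ext fun g => ?_
    change freeMap F X Z (basis k f ≫ basis k g) =
      freeMap F X Y (basis k f) ≫ freeMap F Y Z (basis k g)
    rw [← basis_comp, freeMap_basis, freeMap_basis, freeMap_basis, F.map_comp]
  exact LinearMap.congr_fun (LinearMap.congr_fun this x) y

/-- The `k`-linear functor `k C → 𝒜` extending a functor `C → 𝒜`. -/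
def freeLift (F : C ⥤ 𝒜) : LFunctor k (Free k C) 𝒜 where
  func :=
    { obj := fun X => F.obj X
      map := fun {X Y} x => freeMap (C := C) F X Y x
      map_id := fun X => freeMap_id F X
      map_comp := fun {X Y Z} x y => freeMap_comp F X Y Z x y }
  add := ⟨fun {X Y f g} => LinearMap.map_add (freeMap (C := C) F X Y) f g⟩
  lin := ⟨fun {X Y} f c => LinearMap.map_smul (freeMap (C := C) F X Y) c f⟩

variable (k 𝒜) in
/-- A two-sided ideal of a `k`-linear category. -/
structure LinIdeal where
  rel : ∀ X Y : 𝒜, Submodule k (X ⟶ Y)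
  comp_left : ∀ {X Y Z : 𝒜} (f : X ⟶ Y) {g : Y ⟶ Z}, g ∈ rel Y Z → f ≫ g ∈ rel X Z
  comp_right : ∀ {X Y Z : 𝒜} {f : X ⟶ Y} (g : Y ⟶ Z), f ∈ rel X Y → f ≫ g ∈ rel X Z

/-- The quotient `𝒜 / I` of a `k`-linear category by a two-sided ideal: it has the same objects,
and morphisms `𝒜(X, Y) / I(X, Y)`, with the induced composition. -/
structure LinQuot (I : LinIdeal k 𝒜) where
  as : 𝒜

lemma span_comp_left (S : ∀ X Y : C, Set (Free.of k X ⟶ Free.of k Y))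
    (hl : ∀ {X Y Z : C} (f : X ⟶ Y), ∀ x ∈ S Y Z, basis k f ≫ x ∈ S X Z) {X Y Z : C}
    (f : Free.of k X ⟶ Free.of k Y) {g : Free.of k Y ⟶ Free.of k Z}
    (hg : g ∈ Submodule.span k (S Y Z)) : f ≫ g ∈ Submodule.span k (S X Z) := by
  refine free_induction (P := fun f => f ≫ g ∈ Submodule.span k (S X Z)) ?_ ?_ ?_ f
  · rw [Limits.zero_comp]; exact Submodule.zero_mem _
  · intro x y hx hy
    rw [Preadditive.add_comp]; exact Submodule.add_mem _ hx hy
  · intro c f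
    rw [Linear.smul_comp]
    refine Submodule.smul_mem _ c ?_
    have : Submodule.span k (S Y Z) ≤ (Submodule.span k (S X Z)).comap
        (Linear.leftComp k (Free.of k Z) (basis k f)) :=
      Submodule.span_le.2 fun x hx => Submodule.subset_span (hl f x hx)
    exact this hg

lemma span_comp_right (S : ∀ X Y : C, Set (Free.of k X ⟶ Free.of k Y))
    (hr : ∀ {X Y Z : C} (g : Y ⟶ Z), ∀ x ∈ S X Y, x ≫ basis k g ∈ S X Z) {X Y Z : C}
    {f : Free.of k X ⟶ Free.of k Y} (g : Free.of k Y ⟶ Free.of k Z)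
    (hf : f ∈ Submodule.span k (S X Y)) : f ≫ g ∈ Submodule.span k (S X Z) := by
  refine free_induction (P := fun g => f ≫ g ∈ Submodule.span k (S X Z)) ?_ ?_ ?_ g
  · rw [Limits.comp_zero]; exact Submodule.zero_mem _
  · intro x y hx hy
    rw [Preadditive.comp_add]; exact Submodule.add_mem _ hx hy
  · intro c g
    rw [Linear.comp_smul]
    refine Submodule.smul_mem _ c ?_
    have : Submodule.span k (S X Y) ≤ (Submodule.span k (S X Z)).comap
        (Linear.rightComp k (Free.of k X) (basis k g)) :=
      Submodule.span_le.2 fun x hx => Submodule.subset_span (hr g x hx)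
    exact this hf

/-- The ideal of `k C` spanned by sets of morphisms which are stable under composition with the
morphisms of `C`. -/
def LinIdeal.ofSpan (S : ∀ X Y : C, Set (Free.of k X ⟶ Free.of k Y))
    (hl : ∀ {X Y Z : C} (f : X ⟶ Y), ∀ x ∈ S Y Z, basis k f ≫ x ∈ S X Z)
    (hr : ∀ {X Y Z : C} (g : Y ⟶ Z), ∀ x ∈ S X Y, x ≫ basis k g ∈ S X Z) :
    LinIdeal k (Free k C) where
  rel X Y := Submodule.span k (S X Y)
  comp_left f _ hg := span_comp_left S hl f hg
  comp_right g hf := span_comp_right S hr g hf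

namespace LinQuot

variable (I : LinIdeal k 𝒜)

/-- The composition of `𝒜 / I`. -/
def compₗ (X Y Z : 𝒜) : ((X ⟶ Y) ⧸ I.rel X Y) →ₗ[k] ((Y ⟶ Z) ⧸ I.rel Y Z) →ₗ[k]
    ((X ⟶ Z) ⧸ I.rel X Z) :=
  Submodule.liftQ _
    { toFun := fun f => Submodule.mapQ _ _ (Linear.leftComp k Z f) fun _ hg => I.comp_left f hg
      map_add' := fun f f' => by
        apply Submodule.linearMap_qext
        ext g
        exact congrArg Submodule.Quotient.mk (Preadditive.add_comp _ _ _ f f' g)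
      map_smul' := fun c f => by
        apply Submodule.linearMap_qext
        ext g
        exact congrArg Submodule.Quotient.mk (Linear.smul_comp _ _ _ c f g) }
    fun f hf => by
      rw [LinearMap.mem_ker]
      apply Submodule.linearMap_qext
      ext g
      exact (Submodule.Quotient.mk_eq_zero _).2 (I.comp_right g hf)

instance category : Category.{u} (LinQuot I) where
  Hom X Y := (X.as ⟶ Y.as) ⧸ I.rel X.as Y.as
  id X := Submodule.Quotient.mk (𝟙 X.as)
  comp {X Y Z} f g := compₗ I X.as Y.as Z.as f g
  id_comp {X Y} f := by
    obtain ⟨f, rfl⟩ := Submodule.Quotient.mk_surjective _ f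
    exact congrArg Submodule.Quotient.mk (Category.id_comp f)
  comp_id {X Y} f := by
    obtain ⟨f, rfl⟩ := Submodule.Quotient.mk_surjective _ f
    exact congrArg Submodule.Quotient.mk (Category.comp_id f)
  assoc {X Y Z W} f g h := by
    obtain ⟨f, rfl⟩ := Submodule.Quotient.mk_surjective _ f
    obtain ⟨g, rfl⟩ := Submodule.Quotient.mk_surjective _ g
    obtain ⟨h, rfl⟩ := Submodule.Quotient.mk_surjective _ h
    exact congrArg Submodule.Quotient.mk (Category.assoc f g h)

instance preadditive : Preadditive (LinQuot I) where
  homGroup X Y := inferInstanceAs (AddCommGroup ((X.as ⟶ Y.as) ⧸ I.rel X.as Y.as))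
  add_comp X Y Z f f' g :=
    LinearMap.congr_fun (LinearMap.map_add (compₗ I X.as Y.as Z.as) f f') g
  comp_add X Y Z f g g' := LinearMap.map_add (compₗ I X.as Y.as Z.as f) g g'

instance linear : Linear k (LinQuot I) where
  homModule X Y := inferInstanceAs (Module k ((X.as ⟶ Y.as) ⧸ I.rel X.as Y.as))
  smul_comp X Y Z c f g :=
    LinearMap.congr_fun (LinearMap.map_smul (compₗ I X.as Y.as Z.as) c f) g
  comp_smul X Y Z f c g := LinearMap.map_smul (compₗ I X.as Y.as Z.as f) c g

/-- The projection `𝒜 → 𝒜 / I`. -/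
def proj : LFunctor k 𝒜 (LinQuot I) where
  func :=
    { obj := fun X => ⟨X⟩
      map := fun f => Submodule.Quotient.mk f
      map_id := fun _ => rfl
      map_comp := fun _ _ => rfl }
  add := ⟨rfl⟩
  lin := ⟨fun _ _ => rfl⟩

/-- A `k`-linear functor which kills `I` factors over `𝒜 / I`. -/
def lift (F : LFunctor k 𝒜 ℬ) (h : ∀ X Y : 𝒜, ∀ f ∈ I.rel X Y, F.func.map f = 0) :
    LFunctor k (LinQuot I) ℬ where
  func :=
    { obj := fun X => F.func.obj X.as
      map := fun {X Y} => Submodule.liftQ (I.rel X.as Y.as) (F.mapₗ X.as Y.as)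
        fun f hf => h _ _ f hf
      map_id := fun X => F.func.map_id X.as
      map_comp := fun {X Y Z} f g => by
        obtain ⟨f, rfl⟩ := Submodule.Quotient.mk_surjective _ f
        obtain ⟨g, rfl⟩ := Submodule.Quotient.mk_surjective _ g
        exact F.func.map_comp f g }
  add := ⟨fun {X Y f g} => LinearMap.map_add (Submodule.liftQ (I.rel X.as Y.as) _ _) f g⟩
  lin := ⟨fun {X Y} f c => LinearMap.map_smul (Submodule.liftQ (I.rel X.as Y.as) _ _) c f⟩

end LinQuot

end FreeAndQuotients

end Generalities

/-! ### The ordered Brauer categories -/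

/-- The groupoid of finite sets and bijections. -/
structure FB : Type 1 where
  carrier : Type
  [finite : Finite carrier]

attribute [instance] FB.finite

instance : CoeSort FB Type := ⟨FB.carrier⟩

instance FB.category : Category.{0} FB where
  Hom X Y := X ≃ Y
  id X := Equiv.refl X
  comp f g := f.trans g

/-- The disjoint union of two finite sets. -/
def FB.sum (X Y : FB) : FB := ⟨X ⊕ Y⟩

/-- The permutation of `{1, …, s + t} = {1, …, s} ⊔ {1, …, t}` given by two permutations. -/
def blockPerm {s t : ℕ} (π : Equiv.Perm (Fin s)) (ρ : Equiv.Perm (Fin t)) :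
    Equiv.Perm (Fin (s + t)) :=
  finSumFinEquiv.permCongr (π.sumCongr ρ)

lemma blockPerm_castAdd {s t : ℕ} (π : Equiv.Perm (Fin s)) (ρ : Equiv.Perm (Fin t)) (i : Fin s) :
    blockPerm π ρ (Fin.castAdd t i) = Fin.castAdd t (π i) := by
  simp [blockPerm, Equiv.permCongr_apply]

lemma blockPerm_natAdd {s t : ℕ} (π : Equiv.Perm (Fin s)) (ρ : Equiv.Perm (Fin t)) (i : Fin t) :
    blockPerm π ρ (Fin.natAdd s i) = Fin.natAdd s (ρ i) := by
  simp [blockPerm, Equiv.permCongr_apply]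

/-- The character of a symmetric group attached to a sign `s`: the trivial one if `s = 1`, the
signature if `s = -1`. -/
def signChar (s : ℤˣ) {n : ℕ} (π : Equiv.Perm (Fin n)) : ℤˣ :=
  if s = 1 then 1 else Equiv.Perm.sign π

lemma signChar_one (s : ℤˣ) (n : ℕ) : signChar s (1 : Equiv.Perm (Fin n)) = 1 := by
  simp [signChar]

lemma signChar_blockPerm (s : ℤˣ) {m n : ℕ} (π : Equiv.Perm (Fin m)) (ρ : Equiv.Perm (Fin n)) :
    signChar s (blockPerm π ρ) = signChar s π * signChar s ρ := by
  unfold signChar blockPerm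
  split_ifs
  · simp
  · rw [Equiv.Perm.sign_permCongr, Equiv.Perm.sign_sumCongr]

/-! #### The ordered directed upward Brauer category -/

/-- The objects of the ordered directed upward Brauer category: finite sets. -/
structure DubOrd : Type 1 where
  set : FB

namespace DubOrd

/-- A morphism from `A` to `B` of degree `t` is a bijection `A ⊔ ({1,2} × {1,…,t}) ≃ B`. -/
structure Hom (A B : DubOrd) : Type where
  deg : ℕ
  bij : A.set ⊕ (Fin 2 × Fin deg) ≃ B.set

lemma Hom.ext' {A B : DubOrd} {f g : Hom A B} (h : f.deg = g.deg)
    (h1 : ∀ a, f.bij (.inl a) = g.bij (.inl a))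
    (h2 : ∀ e i, f.bij (.inr (e, i)) = g.bij (.inr (e, Fin.cast h i))) : f = g := by
  obtain ⟨s, f⟩ := f
  obtain ⟨t, g⟩ := g
  obtain rfl : s = t := h
  congr 1
  ext (a | ⟨e, i⟩)
  · exact h1 a
  · exact h2 e i

/-- The identity, of degree `0`. -/
def Hom.id (A : DubOrd) : Hom A A := ⟨0, Equiv.sumEmpty _ _⟩

/-- The bijection `X ⊔ {1,2} × {1,…,s+t} ≃ Z` given by `X ⊔ {1,2} × {1,…,s} ≃ Y` and
`Y ⊔ {1,2} × {1,…,t} ≃ Z`. -/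
def glue {X Y Z : Type} {s t : ℕ} (f : X ⊕ (Fin 2 × Fin s) ≃ Y) (g : Y ⊕ (Fin 2 × Fin t) ≃ Z) :
    X ⊕ (Fin 2 × Fin (s + t)) ≃ Z :=
  ((Equiv.refl _).sumCongr
      (((Equiv.refl _).prodCongr finSumFinEquiv.symm).trans (Equiv.prodSumDistrib _ _ _))).trans
    ((Equiv.sumAssoc _ _ _).symm.trans ((f.sumCongr (Equiv.refl _)).trans g))

section

variable {X Y Z W : Type} {s t r : ℕ} (f : X ⊕ (Fin 2 × Fin s) ≃ Y) (g : Y ⊕ (Fin 2 × Fin t) ≃ Z)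
  (h : Z ⊕ (Fin 2 × Fin r) ≃ W) (e : Fin 2)

lemma glue_inl (x : X) : glue f g (.inl x) = g (.inl (f (.inl x))) := rfl

lemma glue_castAdd (i : Fin s) :
    glue f g (.inr (e, Fin.castAdd t i)) = g (.inl (f (.inr (e, i)))) := by
  simp [glue]

lemma glue_natAdd (i : Fin t) : glue f g (.inr (e, Fin.natAdd s i)) = g (.inr (e, i)) := by
  simp [glue]

lemma glue_assoc (i : Fin (s + t + r)) : glue (glue f g) h (.inr (e, i)) =
    glue f (glue g h) (.inr (e, Fin.cast (Nat.add_assoc s t r) i)) := by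
  refine Fin.addCases (fun i => ?_) (fun i => ?_) i
  · rw [glue_castAdd]
    revert i
    refine fun i => Fin.addCases (fun i => ?_) (fun i => ?_) i
    · rw [glue_castAdd]
      exact (glue_castAdd f (glue g h) e i).symm
    · rw [glue_natAdd]
      refine ((glue_natAdd f (glue g h) e (Fin.castAdd _ i)).trans ?_).symm
      exact glue_castAdd g h e i
  · have : Fin.cast (Nat.add_assoc s t r) (Fin.natAdd (s + t) i) =
        Fin.natAdd s (Fin.natAdd t i) := by
      ext; simp [Nat.add_assoc]
    rw [this, glue_natAdd, glue_natAdd, glue_natAdd]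

lemma zero_glue (i : Fin (0 + t)) : glue (Equiv.sumEmpty Y (Fin 2 × Fin 0)) g (.inr (e, i)) =
    g (.inr (e, Fin.cast (Nat.zero_add t) i)) := by
  refine Fin.addCases (fun i => i.elim0) (fun i => ?_) i
  rw [glue_natAdd]
  congr 3
  ext
  simp

lemma glue_zero (i : Fin (s + 0)) : glue f (Equiv.sumEmpty Y (Fin 2 × Fin 0)) (.inr (e, i)) =
    f (.inr (e, Fin.cast (Nat.add_zero s) i)) := by
  refine Fin.addCases (fun i => ?_) (fun i => i.elim0) i
  rw [glue_castAdd]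
  rfl

end

/-- Composition: the pairs of `f` come first, then those of `g`. -/
def Hom.comp {A B C : DubOrd} (f : Hom A B) (g : Hom B C) : Hom A C :=
  ⟨f.deg + g.deg, glue f.bij g.bij⟩

instance category : Category.{0} DubOrd where
  Hom := Hom
  id := Hom.id
  comp := Hom.comp
  id_comp f := Hom.ext' (Nat.zero_add _) (fun _ => rfl) fun e i => zero_glue f.bij e i
  comp_id f := Hom.ext' (Nat.add_zero _) (fun _ => rfl) fun e i => glue_zero f.bij e i
  assoc f g h := Hom.ext' (Nat.add_assoc _ _ _) (fun _ => rfl) fun e i =>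
    glue_assoc f.bij g.bij h.bij e i

/-- The element `((ε_i)_i; π)` of the wreath product `𝔖₂ ≀ 𝔖_t` acting on `{1,2} × {1,…,t}`. -/
def wreath {t : ℕ} (ε : Fin t → Equiv.Perm (Fin 2)) (π : Equiv.Perm (Fin t)) :
    Equiv.Perm (Fin 2 × Fin t) where
  toFun p := (ε p.2 p.1, π p.2)
  invFun p := ((ε (π.symm p.2)).symm p.1, π.symm p.2)
  left_inv p := by simp
  right_inv p := by simp

/-- The character `(k^±; k^∓)` of `𝔖₂ ≀ 𝔖_t`: on each copy of `𝔖₂` it is the trivial or the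
signature character according to the sign `pm`, and on `𝔖_t` according to the sign `mp`. -/
def wreathChar (pm mp : ℤˣ) {t : ℕ} (ε : Fin t → Equiv.Perm (Fin 2)) (π : Equiv.Perm (Fin t)) :
    ℤˣ :=
  (∏ i, signChar pm (ε i)) * signChar mp π

/-- The right action of `𝔖₂ ≀ 𝔖_t` on morphisms of degree `t`. -/
def Hom.act {A B : DubOrd} (f : A ⟶ B) (ε : Fin (Hom.deg f) → Equiv.Perm (Fin 2))
    (π : Equiv.Perm (Fin (Hom.deg f))) : A ⟶ B :=
  Hom.mk (Hom.deg f) (((Equiv.refl _).sumCongr (wreath ε π)).trans (Hom.bij f))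

lemma Hom.act_one {A B : DubOrd} (f : A ⟶ B) : Hom.act f 1 1 = f :=
  Hom.ext' rfl (fun _ => rfl) fun _ _ => rfl

lemma glue_act {X Y Z : Type} {s t : ℕ} (f : X ⊕ (Fin 2 × Fin s) ≃ Y)
    (g : Y ⊕ (Fin 2 × Fin t) ≃ Z) (ε : Fin s → Equiv.Perm (Fin 2)) (π : Equiv.Perm (Fin s))
    (η : Fin t → Equiv.Perm (Fin 2)) (ρ : Equiv.Perm (Fin t)) (e : Fin 2) (i : Fin (s + t)) :
    glue (((Equiv.refl _).sumCongr (wreath ε π)).trans f)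
      (((Equiv.refl _).sumCongr (wreath η ρ)).trans g) (.inr (e, i)) =
      glue f g (.inr (Fin.append ε η i e, blockPerm π ρ i)) := by
  refine Fin.addCases (fun i => ?_) (fun i => ?_) i
  · rw [blockPerm_castAdd, Fin.append_left, glue_castAdd, glue_castAdd]; rfl
  · rw [blockPerm_natAdd, Fin.append_right, glue_natAdd, glue_natAdd]; rfl

lemma Hom.act_comp_act {A B C : DubOrd} (f : A ⟶ B) (g : B ⟶ C)
    (ε : Fin (Hom.deg f) → Equiv.Perm (Fin 2)) (π : Equiv.Perm (Fin (Hom.deg f)))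
    (η : Fin (Hom.deg g) → Equiv.Perm (Fin 2)) (ρ : Equiv.Perm (Fin (Hom.deg g))) :
    Hom.act f ε π ≫ Hom.act g η ρ = Hom.act (f ≫ g) (Fin.append ε η) (blockPerm π ρ) :=
  Hom.ext' rfl (fun _ => rfl) fun e i => glue_act _ _ _ _ _ _ e i

lemma wreathChar_one (pm mp : ℤˣ) (t : ℕ) :
    wreathChar pm mp (1 : Fin t → Equiv.Perm (Fin 2)) 1 = 1 := by
  simp [wreathChar, signChar_one]

lemma wreathChar_append (pm mp : ℤˣ) {s t : ℕ} (ε : Fin s → Equiv.Perm (Fin 2))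
    (η : Fin t → Equiv.Perm (Fin 2)) (π : Equiv.Perm (Fin s)) (ρ : Equiv.Perm (Fin t)) :
    wreathChar pm mp (Fin.append ε η) (blockPerm π ρ) =
      wreathChar pm mp ε π * wreathChar pm mp η ρ := by
  simp only [wreathChar, Fin.prod_univ_add, Fin.append_left, Fin.append_right, signChar_blockPerm]
  exact mul_mul_mul_comm _ _ _ _

/-- The inclusion of finite sets and bijections as the morphisms of degree `0`. -/
def ofFB : FB ⥤ DubOrd where
  obj X := ⟨X⟩
  map f := Hom.mk 0 ((Equiv.sumEmpty _ _).trans f)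
  map_id _ := rfl
  map_comp _ _ := Hom.ext' rfl (fun _ => rfl) fun _ i => i.elim0

end DubOrd

/-! #### The ordered upward walled Brauer category -/

/-- The objects of the ordered upward walled Brauer category: pairs of finite sets. -/
structure UwbOrd : Type 1 where
  fst : FB
  snd : FB

namespace UwbOrd

/-- A morphism from `(X, Y)` to `(U, V)` of degree `n` is a pair of bijections
`X ⊔ {1,…,n} ≃ U` and `Y ⊔ {1,…,n} ≃ V`. -/
structure Hom (P Q : UwbOrd) : Type where
  deg : ℕ
  left : P.fst ⊕ Fin deg ≃ Q.fst
  right : P.snd ⊕ Fin deg ≃ Q.snd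

lemma Hom.ext' {P Q : UwbOrd} {f g : Hom P Q} (h : f.deg = g.deg)
    (h1 : ∀ a, f.left (.inl a) = g.left (.inl a))
    (h2 : ∀ i, f.left (.inr i) = g.left (.inr (Fin.cast h i)))
    (h3 : ∀ a, f.right (.inl a) = g.right (.inl a))
    (h4 : ∀ i, f.right (.inr i) = g.right (.inr (Fin.cast h i))) : f = g := by
  obtain ⟨s, f, f'⟩ := f
  obtain ⟨t, g, g'⟩ := g
  obtain rfl : s = t := h
  congr 1
  · ext (a | i)
    · exact h1 a
    · exact h2 i
  · ext (a | i)
    · exact h3 a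
    · exact h4 i

/-- The bijection `X ⊔ {1,…,s+t} ≃ Z` given by `X ⊔ {1,…,s} ≃ Y` and `Y ⊔ {1,…,t} ≃ Z`. -/
def glue {X Y Z : Type} {s t : ℕ} (f : X ⊕ Fin s ≃ Y) (g : Y ⊕ Fin t ≃ Z) :
    X ⊕ Fin (s + t) ≃ Z :=
  ((Equiv.refl _).sumCongr finSumFinEquiv.symm).trans
    ((Equiv.sumAssoc _ _ _).symm.trans ((f.sumCongr (Equiv.refl _)).trans g))

section

variable {X Y Z W : Type} {s t r : ℕ} (f : X ⊕ Fin s ≃ Y) (g : Y ⊕ Fin t ≃ Z) (h : Z ⊕ Fin r ≃ W)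

lemma glue_inl (x : X) : glue f g (.inl x) = g (.inl (f (.inl x))) := rfl

lemma glue_castAdd (i : Fin s) : glue f g (.inr (Fin.castAdd t i)) = g (.inl (f (.inr i))) := by
  simp [glue]

lemma glue_natAdd (i : Fin t) : glue f g (.inr (Fin.natAdd s i)) = g (.inr i) := by
  simp [glue]

lemma glue_assoc (i : Fin (s + t + r)) : glue (glue f g) h (.inr i) =
    glue f (glue g h) (.inr (Fin.cast (Nat.add_assoc s t r) i)) := by
  refine Fin.addCases (fun i => ?_) (fun i => ?_) i
  · rw [glue_castAdd]
    revert i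
    refine fun i => Fin.addCases (fun i => ?_) (fun i => ?_) i
    · rw [glue_castAdd]
      exact (glue_castAdd f (glue g h) i).symm
    · rw [glue_natAdd]
      refine ((glue_natAdd f (glue g h) (Fin.castAdd _ i)).trans ?_).symm
      exact glue_castAdd g h i
  · have : Fin.cast (Nat.add_assoc s t r) (Fin.natAdd (s + t) i) =
        Fin.natAdd s (Fin.natAdd t i) := by
      ext; simp [Nat.add_assoc]
    rw [this, glue_natAdd, glue_natAdd, glue_natAdd]

lemma glue_act (π : Equiv.Perm (Fin s)) (ρ : Equiv.Perm (Fin t)) (i : Fin (s + t)) :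
    glue (((Equiv.refl _).sumCongr π).trans f) (((Equiv.refl _).sumCongr ρ).trans g) (.inr i) =
      glue f g (.inr (blockPerm π ρ i)) := by
  refine Fin.addCases (fun i => ?_) (fun i => ?_) i
  · rw [blockPerm_castAdd, glue_castAdd, glue_castAdd]; rfl
  · rw [blockPerm_natAdd, glue_natAdd, glue_natAdd]; rfl

end

/-- The identity, of degree `0`. -/
def Hom.id (P : UwbOrd) : Hom P P := ⟨0, Equiv.sumEmpty _ _, Equiv.sumEmpty _ _⟩

/-- Composition: the walled pairs of `f` come first, then those of `g`. -/
def Hom.comp {P Q R : UwbOrd} (f : Hom P Q) (g : Hom Q R) : Hom P R :=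
  ⟨f.deg + g.deg, glue f.left g.left, glue f.right g.right⟩

lemma zero_glue {X Y : Type} {t : ℕ} (g : X ⊕ Fin t ≃ Y) (i : Fin (0 + t)) :
    glue (Equiv.sumEmpty X (Fin 0)) g (.inr i) = g (.inr (Fin.cast (Nat.zero_add t) i)) := by
  refine Fin.addCases (fun i => i.elim0) (fun i => ?_) i
  rw [glue_natAdd]
  congr 2
  ext
  simp

lemma glue_zero {X Y : Type} {t : ℕ} (g : X ⊕ Fin t ≃ Y) (i : Fin (t + 0)) :
    glue g (Equiv.sumEmpty Y (Fin 0)) (.inr i) = g (.inr (Fin.cast (Nat.add_zero t) i)) := by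
  refine Fin.addCases (fun i => ?_) (fun i => i.elim0) i
  rw [glue_castAdd]
  rfl

instance category : Category.{0} UwbOrd where
  Hom := Hom
  id := Hom.id
  comp := Hom.comp
  id_comp f := Hom.ext' (Nat.zero_add _) (fun _ => rfl) (fun i => zero_glue f.left i)
    (fun _ => rfl) (fun i => zero_glue f.right i)
  comp_id f := Hom.ext' (Nat.add_zero _) (fun _ => rfl) (fun i => glue_zero f.left i)
    (fun _ => rfl) (fun i => glue_zero f.right i)
  assoc _ _ _ := Hom.ext' (Nat.add_assoc _ _ _) (fun _ => rfl) (fun i => glue_assoc _ _ _ i)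
    (fun _ => rfl) (fun i => glue_assoc _ _ _ i)

/-- The diagonal right action of `𝔖_n` on morphisms of degree `n`. -/
def Hom.act {P Q : UwbOrd} (f : P ⟶ Q) (π : Equiv.Perm (Fin (Hom.deg f))) : P ⟶ Q :=
  Hom.mk (Hom.deg f) (((Equiv.refl _).sumCongr π).trans (Hom.left f))
    (((Equiv.refl _).sumCongr π).trans (Hom.right f))

lemma Hom.act_one {P Q : UwbOrd} (f : P ⟶ Q) : Hom.act f 1 = f :=
  Hom.ext' rfl (fun _ => rfl) (fun _ => rfl) (fun _ => rfl) (fun _ => rfl)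

lemma Hom.act_comp_act {P Q R : UwbOrd} (f : P ⟶ Q) (g : Q ⟶ R)
    (π : Equiv.Perm (Fin (Hom.deg f))) (ρ : Equiv.Perm (Fin (Hom.deg g))) :
    Hom.act f π ≫ Hom.act g ρ = Hom.act (f ≫ g) (blockPerm π ρ) :=
  Hom.ext' rfl (fun _ => rfl) (fun i => glue_act _ _ _ _ i) (fun _ => rfl)
    (fun i => glue_act _ _ _ _ i)

/-- The inclusion of pairs of finite sets and bijections as the morphisms of degree `0`. -/
def ofFB : FB × FB ⥤ UwbOrd where
  obj X := ⟨X.1, X.2⟩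
  map f := Hom.mk 0 ((Equiv.sumEmpty _ _).trans f.1) ((Equiv.sumEmpty _ _).trans f.2)
  map_id _ := rfl
  map_comp _ _ := Hom.ext' rfl (fun _ => rfl) (fun i => i.elim0) (fun _ => rfl) (fun i => i.elim0)

end UwbOrd

/-! #### Unwalling -/

/-- The bijection `(X ⊔ Y) ⊔ ({1,2} × {1,…,n}) ≃ (X ⊔ {1,…,n}) ⊔ (Y ⊔ {1,…,n})`, under which
`{1} × {1,…,n}` is the first and `{2} × {1,…,n}` the second copy of `{1,…,n}`. -/
def shuffle (X Y : Type) (n : ℕ) :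
    (X ⊕ Y) ⊕ (Fin 2 × Fin n) ≃ (X ⊕ Fin n) ⊕ (Y ⊕ Fin n) :=
  ((Equiv.refl _).sumCongr
    ((finTwoEquiv.prodCongr (Equiv.refl _)).trans (Equiv.boolProdEquivSum _))).trans
    (Equiv.sumSumSumComm X Y (Fin n) (Fin n))

/-- The unwalling functor, `(X, Y) ↦ X ⊔ Y`: a walled pair becomes a directed pair, from the left
hand side of the wall to the right hand side. -/
def unW : UwbOrd ⥤ DubOrd where
  obj P := ⟨P.fst.sum P.snd⟩
  map {P Q} f := DubOrd.Hom.mk (UwbOrd.Hom.deg f) ((shuffle P.fst P.snd (UwbOrd.Hom.deg f)).trans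
    ((UwbOrd.Hom.left f).sumCongr (UwbOrd.Hom.right f)))
  map_id P := DubOrd.Hom.ext' rfl (by rintro (a | a) <;> rfl) fun _ i => i.elim0
  map_comp {P Q R} f g := by
    refine DubOrd.Hom.ext' rfl (by rintro (a | a) <;> rfl) fun e i => ?_
    refine Fin.addCases (fun i => ?_) (fun i => ?_) i
    · refine Eq.trans ?_ (DubOrd.glue_castAdd (DubOrd.Hom.bij (DubOrd.Hom.mk _ _))
        (DubOrd.Hom.bij (DubOrd.Hom.mk _ _)) e i).symm
      fin_cases e
      · exact congrArg Sum.inl (UwbOrd.glue_castAdd (UwbOrd.Hom.left f) (UwbOrd.Hom.left g) i)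
      · exact congrArg Sum.inr (UwbOrd.glue_castAdd (UwbOrd.Hom.right f) (UwbOrd.Hom.right g) i)
    · refine Eq.trans ?_ (DubOrd.glue_natAdd (DubOrd.Hom.bij (DubOrd.Hom.mk _ _))
        (DubOrd.Hom.bij (DubOrd.Hom.mk _ _)) e i).symm
      fin_cases e
      · exact congrArg Sum.inl (UwbOrd.glue_natAdd (UwbOrd.Hom.left f) (UwbOrd.Hom.left g) i)
      · exact congrArg Sum.inr (UwbOrd.glue_natAdd (UwbOrd.Hom.right f) (UwbOrd.Hom.right g) i)

lemma unW_act {P Q : UwbOrd} (f : P ⟶ Q) (π : Equiv.Perm (Fin (UwbOrd.Hom.deg f))) :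
    unW.map (UwbOrd.Hom.act f π) = DubOrd.Hom.act (unW.map f) 1 π := by
  refine DubOrd.Hom.ext' rfl (by rintro (a | a) <;> rfl) fun e i => ?_
  fin_cases e <;> rfl

/-! ### The twisted `k`-linear Brauer categories -/

section Twisted

variable (k : Type u) [CommRing k]

/-- The sign `c`, as an element of `k`. -/
def signIn (c : ℤˣ) : k := ((c : ℤ) : k)

lemma signIn_one : signIn k 1 = 1 := by simp [signIn]

/-- The relations `[f · w] = χ(w) [f]`, for `f` a morphism of the ordered directed upward Brauer
category and `w` in the wreath product `𝔖₂ ≀ 𝔖_t`. -/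
def ubGen (pm mp : ℤˣ) (A B : DubOrd) : Set (Free.of k A ⟶ Free.of k B) :=
  { x | ∃ (f : A ⟶ B) (ε : Fin (DubOrd.Hom.deg f) → Equiv.Perm (Fin 2))
      (π : Equiv.Perm (Fin (DubOrd.Hom.deg f))),
      x = basis k (DubOrd.Hom.act f ε π) -
        signIn k (DubOrd.wreathChar pm mp ε π) • basis k f }

/-- The ideal spanned by the relations `[f · w] = χ(w) [f]`. -/
def ubIdeal (pm mp : ℤˣ) : LinIdeal k (Free k DubOrd) :=
  LinIdeal.ofSpan (ubGen k pm mp)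
    (by
      rintro A B C h _ ⟨f, ε, π, rfl⟩
      refine ⟨h ≫ f, Fin.append 1 ε, blockPerm 1 π, ?_⟩
      have e1 := DubOrd.Hom.act_comp_act h f 1 1 ε π
      have e2 := DubOrd.wreathChar_append pm mp (1 : Fin (DubOrd.Hom.deg h) → _) ε 1 π
      rw [DubOrd.Hom.act_one] at e1
      rw [DubOrd.wreathChar_one, one_mul] at e2
      rw [Preadditive.comp_sub, Linear.comp_smul, ← basis_comp, ← basis_comp]
      exact congrArg₂ (fun a c => basis k a - signIn k c • basis k (h ≫ f)) e1 e2.symm)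
    (by
      rintro A B C h _ ⟨f, ε, π, rfl⟩
      refine ⟨f ≫ h, Fin.append ε 1, blockPerm π 1, ?_⟩
      have e1 := DubOrd.Hom.act_comp_act f h ε π 1 1
      have e2 := DubOrd.wreathChar_append pm mp ε (1 : Fin (DubOrd.Hom.deg h) → _) π 1
      rw [DubOrd.Hom.act_one] at e1
      rw [DubOrd.wreathChar_one, mul_one] at e2
      rw [Preadditive.sub_comp, Linear.smul_comp, ← basis_comp, ← basis_comp]
      exact congrArg₂ (fun a c => basis k a - signIn k c • basis k (f ≫ h)) e1 e2.symm)

/-- The twisted upward Brauer category `(k ub)_(±;∓)`: its objects are the finite sets and its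
morphisms from `A` to `B` are `k FB(A ⊔ ({1,2} × {1,…,t}), B) ⊗_{k(𝔖₂ ≀ 𝔖_t)} (k^±; k^∓)`, where
`|B| - |A| = 2 t`. -/
abbrev Ub (pm mp : ℤˣ) := LinQuot (ubIdeal k pm mp)

/-- The relations `[f · π] = χ(π) [f]`, for `f` a morphism of the ordered upward walled Brauer
category and `π` in `𝔖_n`. -/
def uwbGen (mp : ℤˣ) (P Q : UwbOrd) : Set (Free.of k P ⟶ Free.of k Q) :=
  { x | ∃ (f : P ⟶ Q) (π : Equiv.Perm (Fin (UwbOrd.Hom.deg f))),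
      x = basis k (UwbOrd.Hom.act f π) - signIn k (signChar mp π) • basis k f }

/-- The ideal spanned by the relations `[f · π] = χ(π) [f]`. -/
def uwbIdeal (mp : ℤˣ) : LinIdeal k (Free k UwbOrd) :=
  LinIdeal.ofSpan (uwbGen k mp)
    (by
      rintro A B C h _ ⟨f, π, rfl⟩
      refine ⟨h ≫ f, blockPerm 1 π, ?_⟩
      have e1 := UwbOrd.Hom.act_comp_act h f 1 π
      have e2 := signChar_blockPerm mp (1 : Equiv.Perm (Fin (UwbOrd.Hom.deg h))) π
      rw [UwbOrd.Hom.act_one] at e1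
      rw [signChar_one, one_mul] at e2
      rw [Preadditive.comp_sub, Linear.comp_smul, ← basis_comp, ← basis_comp]
      exact congrArg₂ (fun a c => basis k a - signIn k c • basis k (h ≫ f)) e1 e2.symm)
    (by
      rintro A B C h _ ⟨f, π, rfl⟩
      refine ⟨f ≫ h, blockPerm π 1, ?_⟩
      have e1 := UwbOrd.Hom.act_comp_act f h π 1
      have e2 := signChar_blockPerm mp π (1 : Equiv.Perm (Fin (UwbOrd.Hom.deg h)))
      rw [UwbOrd.Hom.act_one] at e1
      rw [signChar_one, mul_one] at e2
      rw [Preadditive.sub_comp, Linear.smul_comp, ← basis_comp, ← basis_comp]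
      exact congrArg₂ (fun a c => basis k a - signIn k c • basis k (f ≫ h)) e1 e2.symm)

/-- The twisted upward walled Brauer category `(k uwb)_∓`: its objects are the pairs of finite
sets and its morphisms from `(X, Y)` to `(U, V)` are
`k (FB × FB)((X ⊔ {1,…,n}, Y ⊔ {1,…,n}), (U, V)) ⊗_{k 𝔖_n} k^∓`, where
`|U| - |X| = n = |V| - |Y|`. -/
abbrev Uwb (mp : ℤˣ) := LinQuot (uwbIdeal k mp)

/-- The inclusion of `k FB` in `(k ub)_(±;∓)` as the morphisms of degree zero. -/
def inclUb (pm mp : ℤˣ) : LFunctor k (Free k FB) (Ub k pm mp) :=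
  (freeLift (DubOrd.ofFB ⋙ Free.embedding k DubOrd)).comp (LinQuot.proj _)

/-- The inclusion of `k (FB × FB)` in `(k uwb)_∓` as the morphisms of degree zero. -/
def inclUwb (mp : ℤˣ) : LFunctor k (Free k (FB × FB)) (Uwb k mp) :=
  (freeLift (UwbOrd.ofFB ⋙ Free.embedding k UwbOrd)).comp (LinQuot.proj _)

lemma unW_gen (pm mp : ℤˣ) {P Q : UwbOrd} (x : Free.of k P ⟶ Free.of k Q)
    (hx : x ∈ (uwbIdeal k mp).rel P Q) :
    freeMap (unW ⋙ Free.embedding k DubOrd) P Q x ∈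
      (ubIdeal k pm mp).rel (unW.obj P) (unW.obj Q) := by
  have : Submodule.span k (uwbGen k mp P Q) ≤
      (Submodule.span k (ubGen k pm mp (unW.obj P) (unW.obj Q))).comap
        (freeMap (unW ⋙ Free.embedding k DubOrd) P Q) := by
    refine Submodule.span_le.2 ?_
    rintro _ ⟨f, π, rfl⟩
    refine Submodule.subset_span ⟨unW.map f, 1, π, ?_⟩
    rw [map_sub, map_smul, freeMap_basis, freeMap_basis, Functor.comp_map, unW_act]
    have : DubOrd.wreathChar pm mp (1 : Fin (DubOrd.Hom.deg (unW.map f)) → _) π =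
        signChar mp π := by
      simp only [DubOrd.wreathChar, Pi.one_apply, signChar_one, Finset.prod_const_one, one_mul]
      rfl
    rw [this]
    rfl
  exact this hx

/-- The functor `υ_(±;∓) : (k uwb)_∓ → (k ub)_(±;∓)` induced by the unwalling functor; on objects
it is `(X, Y) ↦ X ⊔ Y`. -/
def upsilon (pm mp : ℤˣ) : LFunctor k (Uwb k mp) (Ub k pm mp) :=
  LinQuot.lift _ ((freeLift (unW ⋙ Free.embedding k DubOrd)).comp (LinQuot.proj _))
    fun P Q x hx => (Submodule.Quotient.mk_eq_zero _).2 (unW_gen k pm mp (P := P) (Q := Q) x hx)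

/-- The functor `FB × FB → (k ub)_(±;∓) ⊗ (k ub)_(±;∓)`, `(f, g) ↦ [f] ⊗ [g]`. -/
def inclUb₂ (pm mp : ℤˣ) : FB × FB ⥤ TensorCat k (Ub k pm mp) (Ub k pm mp) where
  obj X := ⟨(inclUb k pm mp).func.obj X.1, (inclUb k pm mp).func.obj X.2⟩
  map f := TensorCat.tmul ((inclUb k pm mp).func.map (basis k f.1))
    ((inclUb k pm mp).func.map (basis k f.2))
  map_id X := by
    change TensorCat.tmul ((inclUb k pm mp).func.map (basis k (𝟙 X.1)))
      ((inclUb k pm mp).func.map (basis k (𝟙 X.2))) = _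
    rw [basis_id, basis_id, (inclUb k pm mp).func.map_id, (inclUb k pm mp).func.map_id]
    rfl
  map_comp f g := by
    change TensorCat.tmul ((inclUb k pm mp).func.map (basis k (f.1 ≫ g.1)))
      ((inclUb k pm mp).func.map (basis k (f.2 ≫ g.2))) = _
    rw [basis_comp, basis_comp, (inclUb k pm mp).func.map_comp, (inclUb k pm mp).func.map_comp]
    rfl

/-- The `k (FB × FB)`-bimodule `(k ub)_(±;∓)^{⊗ 2}`:
`((A, B), (X, Y)) ↦ (k ub)_(±;∓)(A, X) ⊗ (k ub)_(±;∓)(B, Y)`. -/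
def kubTensorSq (pm mp : ℤˣ) :
    LMod k (TensorCat k (Free k (FB × FB))ᵒᵖ (Free k (FB × FB))) :=
  (homBimodule k (TensorCat k (Ub k pm mp) (Ub k pm mp))).restrict
    (TensorCat.map (freeLift (inclUb₂ k pm mp)).op (freeLift (inclUb₂ k pm mp)))

/-! ### The functor `⨿_*^op` -/

/-- The part `U_i` of the decomposition `U = U_0 ⊔ U_1` encoded by `d : U → {0, 1}`. -/
def part (U : FB) (d : U → Fin 2) (i : Fin 2) : FB := ⟨{u : U // d u = i}⟩

/-- The pair of parts of a decomposition, as an object of `k (FB × FB)`. -/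
def parts (U : FB) (d : U → Fin 2) : Free k (FB × FB) := Free.of k (part U d 0, part U d 1)

/-- A morphism of finite sets and bijections, as a bijection. -/
def FB.equiv {U' U : FB} (g : U' ⟶ U) : U' ≃ U := g

/-- The restriction of a bijection `g : U' ≃ U` to the parts of the decomposition of `U'` that
corresponds under `g` to a given decomposition of `U`. -/
def partMap {U' U : FB} (g : U' ⟶ U) (d : U → Fin 2) (i : Fin 2) :
    part U' (d ∘ FB.equiv g) i ⟶ part U d i :=
  (FB.equiv g).subtypeEquiv fun _ => Iff.rfl

/-- The restriction of a bijection to both parts. -/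
def partsMap {U' U : FB} (g : U' ⟶ U) (d : U → Fin 2) :
    parts k U' (d ∘ FB.equiv g) ⟶ parts k U d :=
  basis k (X := (part U' (d ∘ FB.equiv g) 0, part U' (d ∘ FB.equiv g) 1))
    (Y := (part U d 0, part U d 1)) (partMap g d 0, partMap g d 1)

lemma partsMap_id (U : FB) (d : U → Fin 2) : partsMap k (𝟙 U) d = 𝟙 (parts k U d) :=
  basis_id (k := k) (C := FB × FB) _

lemma partsMap_comp {U'' U' U : FB} (g' : U'' ⟶ U') (g : U' ⟶ U) (d : U → Fin 2) :
    partsMap k (g' ≫ g) d = partsMap k g' (d ∘ FB.equiv g) ≫ partsMap k g d :=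
  basis_comp (k := k) (C := FB × FB) (X := (part U'' ((d ∘ FB.equiv g) ∘ FB.equiv g') 0,
    part U'' ((d ∘ FB.equiv g) ∘ FB.equiv g') 1))
    (Y := (part U' (d ∘ FB.equiv g) 0, part U' (d ∘ FB.equiv g) 1))
    (Z := (part U d 0, part U d 1))
    (partMap g' (d ∘ FB.equiv g) 0, partMap g' (d ∘ FB.equiv g) 1)
    (partMap g d 0, partMap g d 1)

variable {k}
variable {𝒟 : Type*} [Category.{u} 𝒟] [Preadditive 𝒟] [Linear k 𝒟]

/-- The module `⨁_{U = U_1 ⊔ U_2} M((U_1, U_2), D)`. -/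
abbrev Amalg (M : LMod k (TensorCat k (Free k (FB × FB))ᵒᵖ 𝒟)) (U : FB) (D : 𝒟) : Type u :=
  ⨁ d : (U → Fin 2), M.obj.obj ⟨op (parts k U d), D⟩

open scoped Classical in
/-- The inclusion of a summand. -/
def amalgMk (M : LMod k (TensorCat k (Free k (FB × FB))ᵒᵖ 𝒟)) (U : FB) (D : 𝒟) (d : U → Fin 2) :
    M.obj.obj ⟨op (parts k U d), D⟩ →ₗ[k] Amalg M U D :=
  DirectSum.lof k (U → Fin 2) (fun d => M.obj.obj ⟨op (parts k U d), D⟩) d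

lemma amalg_ext (M : LMod k (TensorCat k (Free k (FB × FB))ᵒᵖ 𝒟)) {U : FB} {D : 𝒟}
    {V : Type*} [AddCommGroup V] [Module k V] {f g : Amalg M U D →ₗ[k] V}
    (h : ∀ d x, f (amalgMk M U D d x) = g (amalgMk M U D d x)) : f = g := by
  classical
  refine DirectSum.linearMap_ext _ fun d => LinearMap.ext fun x => ?_
  convert h d x using 2 <;> simp [amalgMk]

open scoped Classical in
/-- The action of a bijection `g : U' ≃ U`: the summand of `U = U_1 ⊔ U_2` is mapped to that of
`U' = g⁻¹(U_1) ⊔ g⁻¹(U_2)`, by the action of the restrictions of `g`. -/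
def amalgL (M : LMod k (TensorCat k (Free k (FB × FB))ᵒᵖ 𝒟)) {U' U : FB} (g : U' ⟶ U) (D : 𝒟) :
    Amalg M U D →ₗ[k] Amalg M U' D :=
  DirectSum.toModule k (U → Fin 2) _ fun d =>
    amalgMk M U' D (d ∘ FB.equiv g) ∘ₗ actL M _ _ D (partsMap k g d).op

/-- The action of a morphism of `𝒟`, on each summand. -/
def amalgR (M : LMod k (TensorCat k (Free k (FB × FB))ᵒᵖ 𝒟)) (U : FB) {D D' : 𝒟} (δ : D ⟶ D') :
    Amalg M U D →ₗ[k] Amalg M U D' :=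
  DirectSum.lmap fun d => actR M (op (parts k U d)) D D' δ

lemma amalgL_mk (M : LMod k (TensorCat k (Free k (FB × FB))ᵒᵖ 𝒟)) {U' U : FB} (g : U' ⟶ U)
    (D : 𝒟) (d : U → Fin 2) (x : M.obj.obj ⟨op (parts k U d), D⟩) :
    amalgL M g D (amalgMk M U D d x) =
      amalgMk M U' D (d ∘ FB.equiv g) (actL M _ _ D (partsMap k g d).op x) := by
  simp [amalgL, amalgMk]

lemma amalgR_mk (M : LMod k (TensorCat k (Free k (FB × FB))ᵒᵖ 𝒟)) (U : FB) {D D' : 𝒟}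
    (δ : D ⟶ D') (d : U → Fin 2) (x : M.obj.obj ⟨op (parts k U d), D⟩) :
    amalgR M U δ (amalgMk M U D d x) = amalgMk M U D' d (actR M _ D D' δ x) := by
  simp [amalgR, amalgMk]

lemma amalgL_id (M : LMod k (TensorCat k (Free k (FB × FB))ᵒᵖ 𝒟)) (U : FB) (D : 𝒟) :
    amalgL M (𝟙 U) D = LinearMap.id := by
  refine amalg_ext M fun d x => ?_
  rw [amalgL_mk, partsMap_id]
  exact congrArg (amalgMk M U D d) (LinearMap.congr_fun (actL_id M (op (parts k U d)) D) x)

lemma amalgL_comp (M : LMod k (TensorCat k (Free k (FB × FB))ᵒᵖ 𝒟)) {U'' U' U : FB}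
    (g' : U'' ⟶ U') (g : U' ⟶ U) (D : 𝒟) :
    amalgL M (g' ≫ g) D = amalgL M g' D ∘ₗ amalgL M g D := by
  refine amalg_ext M fun d x => ?_
  rw [LinearMap.comp_apply, amalgL_mk, amalgL_mk, amalgL_mk, partsMap_comp]
  exact congrArg (amalgMk M U'' D ((d ∘ FB.equiv g) ∘ FB.equiv g'))
    (LinearMap.congr_fun (actL_comp M D (partsMap k g d).op
      (partsMap k g' (d ∘ FB.equiv g)).op) x)

/-- The action of `k FB`. -/
def amalgLₗ (M : LMod k (TensorCat k (Free k (FB × FB))ᵒᵖ 𝒟)) (U' U : FB) (D : 𝒟) :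
    (Free.of k U' ⟶ Free.of k U) →ₗ[k] (Amalg M U D →ₗ[k] Amalg M U' D) :=
  freeLift₀ U' U fun g => amalgL M g D

lemma amalgLₗ_id (M : LMod k (TensorCat k (Free k (FB × FB))ᵒᵖ 𝒟)) (U : FB) (D : 𝒟) :
    amalgLₗ M U U D (𝟙 _) = LinearMap.id := by
  rw [← basis_id, amalgLₗ, freeLift₀_basis, amalgL_id]

lemma amalgLₗ_comp (M : LMod k (TensorCat k (Free k (FB × FB))ᵒᵖ 𝒟)) (U'' U' U : FB) (D : 𝒟)
    (g' : Free.of k U'' ⟶ Free.of k U') (g : Free.of k U' ⟶ Free.of k U) :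
    amalgLₗ M U'' U D (g' ≫ g) = amalgLₗ M U'' U' D g' ∘ₗ amalgLₗ M U' U D g := by
  induction g' using free_induction with
  | h0 => simp
  | hadd x y hx hy => rw [Preadditive.add_comp, map_add, map_add, hx, hy, LinearMap.add_comp]
  | hb c g' =>
    induction g using free_induction with
    | h0 => simp
    | hadd x y hx hy => rw [Preadditive.comp_add, map_add, map_add, hx, hy, LinearMap.comp_add]
    | hb c' g =>
      rw [Linear.smul_comp, Linear.comp_smul, ← basis_comp]
      simp only [map_smul, LinearMap.smul_comp, LinearMap.comp_smul]
      rw [amalgLₗ, amalgLₗ, amalgLₗ, freeLift₀_basis, freeLift₀_basis, freeLift₀_basis,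
        amalgL_comp, smul_comm]

lemma amalg_comm (M : LMod k (TensorCat k (Free k (FB × FB))ᵒᵖ 𝒟)) (U' U : FB) {D D' : 𝒟}
    (g : Free.of k U' ⟶ Free.of k U) (δ : D ⟶ D') :
    amalgR M U' δ ∘ₗ amalgLₗ M U' U D g = amalgLₗ M U' U D' g ∘ₗ amalgR M U δ := by
  induction g using free_induction with
  | h0 => simp
  | hadd x y hx hy => rw [map_add, map_add, LinearMap.comp_add, LinearMap.add_comp, hx, hy]
  | hb c g =>
    rw [map_smul, map_smul, LinearMap.comp_smul, LinearMap.smul_comp]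
    refine congrArg (c • ·) ?_
    rw [amalgLₗ, amalgLₗ, freeLift₀_basis, freeLift₀_basis]
    refine amalg_ext M fun d x => ?_
    simp only [LinearMap.comp_apply, amalgL_mk, amalgR_mk]
    exact congrArg _ (LinearMap.congr_fun (act_comm M (partsMap k g d).op δ) x)

/-- The action of `𝒟`. -/
def amalgRₗ (M : LMod k (TensorCat k (Free k (FB × FB))ᵒᵖ 𝒟)) (U : FB) (D D' : 𝒟) :
    (D ⟶ D') →ₗ[k] (Amalg M U D →ₗ[k] Amalg M U D') where
  toFun δ := amalgR M U δ
  map_add' δ δ' := amalg_ext M fun d x => by simp [amalgR_mk]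
  map_smul' c δ := amalg_ext M fun d x => by simp [amalgR_mk]

lemma amalgR_id (M : LMod k (TensorCat k (Free k (FB × FB))ᵒᵖ 𝒟)) (U : FB) (D : 𝒟) :
    amalgR M U (𝟙 D) = LinearMap.id :=
  amalg_ext M fun d x => by simp [amalgR_mk, actR_id]

lemma amalgR_comp (M : LMod k (TensorCat k (Free k (FB × FB))ᵒᵖ 𝒟)) (U : FB) {D D' D'' : 𝒟}
    (δ : D ⟶ D') (δ' : D' ⟶ D'') : amalgR M U (δ ≫ δ') = amalgR M U δ' ∘ₗ amalgR M U δ :=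
  amalg_ext M fun d x => by simp [amalgR_mk, actR_comp]

/-- Passing from morphisms of the opposite category to morphisms, as a linear map. -/
def unopₗ {𝒜 : Type*} [Category 𝒜] [Preadditive 𝒜] [Linear k 𝒜] (X Y : 𝒜ᵒᵖ) :
    (X ⟶ Y) →ₗ[k] (Y.unop ⟶ X.unop) where
  toFun f := f.unop
  map_add' _ _ := rfl
  map_smul' _ _ := rfl

/-- The functor `⨿_*^op` from `k (FB × FB)ᵒᵖ`-modules to `k FBᵒᵖ`-modules, applied to modules with
an additional action of `𝒟`: on objects,
`(⨿_*^op M)(U, D) = ⨁_{U = U_1 ⊔ U_2} M((U_1, U_2), D)`. -/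
def amalgOp (M : LMod k (TensorCat k (Free k (FB × FB))ᵒᵖ 𝒟)) :
    LMod k (TensorCat k (Free k FB)ᵒᵖ 𝒟) :=
  TensorCat.moduleOfActs (𝒜 := (Free k FB)ᵒᵖ) (fun U D => ModuleCat.of k (Amalg M U.unop D))
    (fun U U' D => amalgLₗ M U'.unop U.unop D ∘ₗ unopₗ U U')
    (fun U D D' => amalgRₗ M U.unop D D')
    (fun U D => amalgLₗ_id M U.unop D)
    (fun {U U' U''} D f f' => amalgLₗ_comp M U''.unop U'.unop U.unop D f'.unop f.unop)
    (fun U D => amalgR_id M U.unop D)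
    (fun U {_ _ _} g g' => amalgR_comp M U.unop g g')
    (fun {U U' _ _} f g => amalg_comm M U'.unop U.unop f.unop g)

variable (k) in
/-- The objects `({1,…,s}, {1,…,t})` of `k (FB × FB)` meet every isomorphism class. -/
def fbReps : Representatives (Free k (FB × FB)) where
  ι := ℕ × ℕ
  obj p := Free.of k (⟨Fin p.1⟩, ⟨Fin p.2⟩)
  exists_iso := by
    rintro ⟨X, Y⟩
    refine ⟨(Nat.card X, Nat.card Y), ⟨(Free.embedding k (FB × FB)).mapIso (X := (X, Y))
      (Y := (⟨Fin _⟩, ⟨Fin _⟩)) (Iso.prod ?_ ?_)⟩⟩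
    · exact ⟨Finite.equivFin X, (Finite.equivFin X).symm, Equiv.self_trans_symm _,
        Equiv.symm_trans_self _⟩
    · exact ⟨Finite.equivFin Y, (Finite.equivFin Y).symm, Equiv.self_trans_symm _,
        Equiv.symm_trans_self _⟩

variable (k)

/-- `υ_(±;∓)^* (k ub)_(±;∓)`: the canonical bimodule of `(k ub)_(±;∓)`, restricted along
`υ_(±;∓)` in the covariant variable and to `k FB` in the contravariant variable; on objects
`(U, (X, Y)) ↦ (k ub)_(±;∓)(U, X ⊔ Y)`. -/
def upsilonPullback (pm mp : ℤˣ) : LMod k (TensorCat k (Free k FB)ᵒᵖ (Uwb k mp)) :=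
  (homBimodule k (Ub k pm mp)).restrict
    (TensorCat.map (inclUb k pm mp).op (upsilon k pm mp))

/-- The canonical bimodule of `(k uwb)_∓`, restricted to `k (FB × FB)` in the contravariant
variable. -/
def kuwbBimodule (mp : ℤˣ) : LMod k (TensorCat k (Free k (FB × FB))ᵒᵖ (Uwb k mp)) :=
  (homBimodule k (Uwb k mp)).restrict (TensorCat.map (inclUwb k mp).op LFunctor.id)

end Twisted
end TwistedBrauer
end

noncomputable section

namespace TwistedBrauer

/-! A morphism `U → X ⊔ Y` of the upward Brauer category sends every element of `U` either to `X` or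
to `Y`, which is a decomposition of `U`. Each of its pairs lies inside `X`, lies inside `Y`, or has
one member on each side. Splitting off the mixed pairs writes the morphism as a disjoint union of
morphisms out of the two parts of `U`, followed by the image under `υ` of a walled morphism that
adds the mixed pairs. The isomorphism is therefore `x ⊗ y ↦ y ≫ υ x`; it is balanced because
disjoint unions are natural in their targets (`sumHom_comp_ofFB`).

The work lies in the symmetries and their signs. Acting by the wreath product, one can sort the
pairs into three blocks, of `s` pairs in `X`, `t` pairs in `Y` and `n` mixed pairs, and turn every
mixed pair so that member `0` lies in `X`: this is a normal form (`exists_act_eq_normalHom`). Two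
normal forms in one orbit have the same decomposition and the same block sizes, and differ by an
element of `(𝔖₂ ≀ 𝔖_s) × (𝔖₂ ≀ 𝔖_t) × 𝔖_n`, since the orientation of the mixed pairs is rigid
(`normalHom_induction`). On this subgroup the character `(±;∓)` is the product of two characters of
the same kind and of the `∓`-character of `𝔖_n` (`wreathChar_append_one`). These are exactly the
characters that twist the three factors of the tensor product.

Hence an inverse exists: if `f · w` is a normal form, the class of `f` goes to `χ(w)` times the
element `normalElt` with the same data. Independence of the choices is `normalElt_eq_of_act`,
together with `χ(w)² = 1`. The maps are mutually inverse because every generator of the tensor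
product is itself a normal form element: the bijections underlying the two Brauer factors can be
moved through the tensor sign into the walled factor (`exists_comparisonMk_eq_normalElt`).
Compatibility with the actions is associativity, functoriality of `υ` and naturality of disjoint
unions in the source (`ofFB_comp_sumHom`).

The tensor product is computed at the objects `({1,…,s}, {1,…,t})`, whereas normal forms live at
sets built from the parts of `U`; `balancedMkObj` transports elements along chosen isomorphisms to
bridge this. -/

/-! ### Bijections between disjoint unions -/

/-- A bijection of disjoint unions which respects the two sides is a disjoint union of
bijections. -/
lemma exists_eq_sumCongr {A B X Y : Type} (e : A ⊕ B ≃ X ⊕ Y) (hl : ∀ a, (e (.inl a)).isLeft)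
    (hr : ∀ b, (e (.inr b)).isRight) : ∃ (L : A ≃ X) (R : B ≃ Y), e = L.sumCongr R := by
  simp only [Sum.isLeft_iff, Sum.isRight_iff] at hl hr
  choose L hL using hl
  choose R hR using hr
  have bL : Function.Bijective L := by
    refine ⟨fun a a' h => ?_, fun x => ?_⟩
    · have : e (.inl a) = e (.inl a') := by rw [hL, hL, h]
      simpa using this
    -- A preimage of a left element cannot come from `B`, which goes entirely to the right.
    · obtain ⟨a | b, h⟩ := e.surjective (.inl x)
      · rw [hL] at h; exact ⟨a, by simpa using h⟩
      · rw [hR] at h; simp at h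
  have bR : Function.Bijective R := by
    refine ⟨fun a a' h => ?_, fun x => ?_⟩
    · have : e (.inr a) = e (.inr a') := by rw [hR, hR, h]
      simpa using this
    · obtain ⟨a | b, h⟩ := e.surjective (.inr x)
      · rw [hL] at h; simp at h
      · rw [hR] at h; exact ⟨b, by simpa using h⟩
  refine ⟨Equiv.ofBijective L bL, Equiv.ofBijective R bR, ?_⟩
  ext (a | b)
  · exact hL a
  · exact hR b

/-- A permutation of `{1, …, s + t}` which maps the first block to itself is given by two
permutations. -/
lemma exists_eq_blockPerm {s t : ℕ} (π : Equiv.Perm (Fin (s + t)))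
    (h : ∀ i : Fin s, ∃ j : Fin s, π (Fin.castAdd t i) = Fin.castAdd t j) :
    ∃ (π₁ : Equiv.Perm (Fin s)) (π₂ : Equiv.Perm (Fin t)), π = blockPerm π₁ π₂ := by
  -- By finiteness, a block mapped into itself is mapped onto itself, so the second block is stable
  -- too.
  have := Equiv.Perm.mem_sumCongrHom_range_of_perm_mapsTo_inl
    (σ := finSumFinEquiv.symm.permCongr π) (by
      rintro _ ⟨i, rfl⟩
      obtain ⟨j, hj⟩ := h i
      exact ⟨j, by simp [Equiv.permCongr_apply, hj]⟩)
  obtain ⟨⟨π₁, π₂⟩, e⟩ := this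
  refine ⟨π₁, π₂, ?_⟩
  have e' : π₁.sumCongr π₂ = finSumFinEquiv.symm.permCongr π := e
  rw [blockPerm, e']
  ext i
  simp [Equiv.permCongr_apply]

/-- A set with a map to `{0, 1}` is the disjoint union of the two fibres. -/
def fibreSum {U : Type} (d : U → Fin 2) : U ≃ {u // d u = 0} ⊕ {u // d u = 1} :=
  (Equiv.sumCompl (fun u => d u = 0)).symm.trans
    ((Equiv.refl _).sumCongr (Equiv.subtypeEquivRight fun u => by omega))

lemma fibreSum_symm_inl {U : Type} (d : U → Fin 2) (u : {u // d u = 0}) :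
    (fibreSum d).symm (.inl u) = u := rfl

lemma fibreSum_symm_inr {U : Type} (d : U → Fin 2) (u : {u // d u = 1}) :
    (fibreSum d).symm (.inr u) = u := rfl

lemma fibreSum_zero {U : Type} (d : U → Fin 2) (u : {u // d u = 0}) :
    fibreSum d u = .inl u := by
  rw [← Equiv.eq_symm_apply, fibreSum_symm_inl]

lemma fibreSum_one {U : Type} (d : U → Fin 2) (u : {u // d u = 1}) :
    fibreSum d u = .inr u := by
  rw [← Equiv.eq_symm_apply, fibreSum_symm_inr]

/-- The cases deliver elements of the parts themselves, the form in which evaluations such as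
`sumEquiv_zero` and `sumEquiv_one` apply. -/
lemma fibre_cases {U : Type} (d : U → Fin 2) {P : U → Prop} (h0 : ∀ u : {u // d u = 0}, P u)
    (h1 : ∀ u : {u // d u = 1}, P u) (u : U) : P u := by
  by_cases h : d u = 0
  · exact h0 ⟨u, h⟩
  · exact h1 ⟨u, by omega⟩

/-! ### Disjoint unions of morphisms along a decomposition of the source -/

section SumEquiv

variable {U : Type} (d : U → Fin 2) {S T : Type} {s t : ℕ}
  (a : {u // d u = 0} ⊕ (Fin 2 × Fin s) ≃ S) (b : {u // d u = 1} ⊕ (Fin 2 × Fin t) ≃ T)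

/-- The bijection `U ⊔ {1,2} × {1,…,s+t} ≃ S ⊔ T` given by bijections on the parts of a
decomposition `U = U_0 ⊔ U_1`. -/
def sumEquiv : U ⊕ (Fin 2 × Fin (s + t)) ≃ S ⊕ T :=
  ((fibreSum d).sumCongr
    (((Equiv.refl _).prodCongr finSumFinEquiv.symm).trans (Equiv.prodSumDistrib _ _ _))).trans
    ((Equiv.sumSumSumComm _ _ _ _).trans (a.sumCongr b))

lemma sumEquiv_zero (u : {u // d u = 0}) : sumEquiv d a b (.inl u) = .inl (a (.inl u)) := by
  simp [sumEquiv, fibreSum_zero]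

lemma sumEquiv_one (u : {u // d u = 1}) : sumEquiv d a b (.inl u) = .inr (b (.inl u)) := by
  simp [sumEquiv, fibreSum_one]

lemma sumEquiv_castAdd (e : Fin 2) (i : Fin s) :
    sumEquiv d a b (.inr (e, Fin.castAdd t i)) = .inl (a (.inr (e, i))) := by
  simp [sumEquiv]

lemma sumEquiv_natAdd (e : Fin 2) (i : Fin t) :
    sumEquiv d a b (.inr (e, Fin.natAdd s i)) = .inr (b (.inr (e, i))) := by
  simp [sumEquiv]

/-- The symmetries of each factor move only its own block of pairs, so disjoint union is equivariant
along the block inclusion of `(𝔖₂ ≀ 𝔖_s) × (𝔖₂ ≀ 𝔖_t)` in `𝔖₂ ≀ 𝔖_{s+t}`. -/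
lemma sumEquiv_act (ε : Fin s → Equiv.Perm (Fin 2)) (π : Equiv.Perm (Fin s))
    (η : Fin t → Equiv.Perm (Fin 2)) (ρ : Equiv.Perm (Fin t)) :
    sumEquiv d (((Equiv.refl _).sumCongr (DubOrd.wreath ε π)).trans a)
      (((Equiv.refl _).sumCongr (DubOrd.wreath η ρ)).trans b) =
      ((Equiv.refl _).sumCongr (DubOrd.wreath (Fin.append ε η) (blockPerm π ρ))).trans
        (sumEquiv d a b) := by
  ext (u | ⟨e, i⟩)
  · revert u
    refine fibre_cases d (fun u => ?_) (fun u => ?_)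
    · exact (sumEquiv_zero d _ _ u).trans (sumEquiv_zero d a b u).symm
    · exact (sumEquiv_one d _ _ u).trans (sumEquiv_one d a b u).symm
  · change _ = sumEquiv d a b (.inr (Fin.append ε η i e, blockPerm π ρ i))
    refine Fin.addCases (fun i => ?_) (fun i => ?_) i
    · rw [blockPerm_castAdd, Fin.append_left, sumEquiv_castAdd, sumEquiv_castAdd]; rfl
    · rw [blockPerm_natAdd, Fin.append_right, sumEquiv_natAdd, sumEquiv_natAdd]; rfl

end SumEquiv

namespace DubOrd

/-- The morphism `U → S ⊔ T` given by morphisms `U_0 → S` and `U_1 → T` on the parts of a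
decomposition of `U`; the pairs of the first one come first. -/
def sumHom {U S T : FB} (d : U → Fin 2) (a : (⟨part U d 0⟩ : DubOrd) ⟶ ⟨S⟩)
    (b : (⟨part U d 1⟩ : DubOrd) ⟶ ⟨T⟩) : (⟨U⟩ : DubOrd) ⟶ ⟨S.sum T⟩ :=
  Hom.mk (Hom.deg a + Hom.deg b) (sumEquiv (U := U) (S := S) (T := T) d (Hom.bij a) (Hom.bij b))

lemma sumHom_act {U S T : FB} (d : U → Fin 2) (a : (⟨part U d 0⟩ : DubOrd) ⟶ ⟨S⟩)
    (b : (⟨part U d 1⟩ : DubOrd) ⟶ ⟨T⟩) (ε : Fin (Hom.deg a) → Equiv.Perm (Fin 2))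
    (π : Equiv.Perm (Fin (Hom.deg a))) (η : Fin (Hom.deg b) → Equiv.Perm (Fin 2))
    (ρ : Equiv.Perm (Fin (Hom.deg b))) :
    sumHom d (Hom.act a ε π) (Hom.act b η ρ) =
      Hom.act (sumHom d a b) (Fin.append ε η) (blockPerm π ρ) :=
  congrArg (Hom.mk _) (sumEquiv_act (U := U) d (Hom.bij a) (Hom.bij b) ε π η ρ)

/-- Naturality of `sumHom` in the targets. -/
lemma sumHom_comp_ofFB {U S T S' T' : FB} (d : U → Fin 2) (a : (⟨part U d 0⟩ : DubOrd) ⟶ ⟨S⟩)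
    (b : (⟨part U d 1⟩ : DubOrd) ⟶ ⟨T⟩) (f : (S, T) ⟶ (S', T')) :
    sumHom d (a ≫ ofFB.map f.1) (b ≫ ofFB.map f.2) =
      sumHom d a b ≫ unW.map (UwbOrd.ofFB.map f) := by
  -- The degree-zero morphisms come second here, and adding `0` on the right is definitional, so no
  -- index is cast.
  refine Hom.ext' rfl ?_ fun e i => ?_
  · refine fibre_cases d (fun u => ?_) (fun u => ?_)
    · exact (sumEquiv_zero d _ _ u).trans
        (congrArg (fun z => Hom.bij (unW.map (UwbOrd.ofFB.map f)) (.inl z))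
          (sumEquiv_zero d (Hom.bij a) (Hom.bij b) u)).symm
    · exact (sumEquiv_one d _ _ u).trans
        (congrArg (fun z => Hom.bij (unW.map (UwbOrd.ofFB.map f)) (.inl z))
          (sumEquiv_one d (Hom.bij a) (Hom.bij b) u)).symm
  · refine Fin.addCases (fun i => ?_) (fun i => ?_) i
    · refine (sumEquiv_castAdd d _ _ e i).trans ?_
      refine Eq.trans ?_ (glue_castAdd (Hom.bij (sumHom d a b))
        (Hom.bij (unW.map (UwbOrd.ofFB.map f))) e (Fin.castAdd _ i)).symm
      refine Eq.trans ?_ (congrArg (fun z => Hom.bij (unW.map (UwbOrd.ofFB.map f)) (.inl z))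
        (sumEquiv_castAdd d (Hom.bij a) (Hom.bij b) e i)).symm
      exact congrArg Sum.inl (glue_castAdd (Hom.bij a) (Hom.bij (ofFB.map f.1)) e i)
    · refine (sumEquiv_natAdd d _ _ e i).trans ?_
      refine Eq.trans ?_ (glue_castAdd (Hom.bij (sumHom d a b))
        (Hom.bij (unW.map (UwbOrd.ofFB.map f))) e (Fin.natAdd _ i)).symm
      refine Eq.trans ?_ (congrArg (fun z => Hom.bij (unW.map (UwbOrd.ofFB.map f)) (.inl z))
        (sumEquiv_natAdd d (Hom.bij a) (Hom.bij b) e i)).symm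
      exact congrArg Sum.inr (glue_castAdd (Hom.bij b) (Hom.bij (ofFB.map f.2)) e i)

/-- Naturality of `sumHom` in the source. -/
lemma ofFB_comp_sumHom {U' U S T : FB} (g : U' ⟶ U) (d : U → Fin 2)
    (a : (⟨part U d 0⟩ : DubOrd) ⟶ ⟨S⟩) (b : (⟨part U d 1⟩ : DubOrd) ⟶ ⟨T⟩) :
    sumHom (d ∘ FB.equiv g) (ofFB.map (partMap g d 0) ≫ a) (ofFB.map (partMap g d 1) ≫ b) =
      ofFB.map g ≫ sumHom d a b := by
  refine Hom.ext' ?_ ?_ fun e i => ?_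
  · change 0 + Hom.deg a + (0 + Hom.deg b) = 0 + (Hom.deg a + Hom.deg b)
    omega
  · refine fibre_cases (d ∘ FB.equiv g) (fun u => ?_) (fun u => ?_)
    · exact (sumEquiv_zero (d ∘ FB.equiv g) _ _ u).trans
        (sumEquiv_zero d (Hom.bij a) (Hom.bij b) (FB.equiv (partMap g d 0) u)).symm
    · exact (sumEquiv_one (d ∘ FB.equiv g) _ _ u).trans
        (sumEquiv_one d (Hom.bij a) (Hom.bij b) (FB.equiv (partMap g d 1) u)).symm
  · refine Fin.addCases (fun i => ?_) (fun i => ?_) i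
    · refine (sumEquiv_castAdd (d ∘ FB.equiv g) _ _ e i).trans ?_
      refine Fin.addCases (fun i => i.elim0) (fun i => ?_) i
      -- On one side each summand starts with its own empty block of pairs, on the other a single
      -- empty block precedes the whole sum; the cast matches the two positions of the same pair.
      have : Fin.cast (by change 0 + Hom.deg a + (0 + Hom.deg b) = 0 + (Hom.deg a + Hom.deg b); omega)
          (Fin.castAdd (0 + Hom.deg b) (Fin.natAdd 0 i)) =
          Fin.natAdd 0 (Fin.castAdd (Hom.deg b) i) := by ext; simp
      refine Eq.trans ?_ (congrArg (fun z => Hom.bij (ofFB.map g ≫ sumHom d a b) (.inr (e, z)))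
        this).symm
      refine Eq.trans ?_ (glue_natAdd (Hom.bij (ofFB.map g)) (Hom.bij (sumHom d a b)) e
        (Fin.castAdd _ i)).symm
      refine Eq.trans ?_ (sumEquiv_castAdd d (Hom.bij a) (Hom.bij b) e i).symm
      exact congrArg Sum.inl (glue_natAdd (Hom.bij (ofFB.map (partMap g d 0))) (Hom.bij a) e i)
    · refine (sumEquiv_natAdd (d ∘ FB.equiv g) _ _ e i).trans ?_
      refine Fin.addCases (fun i => i.elim0) (fun i => ?_) i
      have : Fin.cast (by change 0 + Hom.deg a + (0 + Hom.deg b) = 0 + (Hom.deg a + Hom.deg b); omega)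
          (Fin.natAdd (0 + Hom.deg a) (Fin.natAdd 0 i)) =
          Fin.natAdd 0 (Fin.natAdd (Hom.deg a) i) := by ext; simp
      refine Eq.trans ?_ (congrArg (fun z => Hom.bij (ofFB.map g ≫ sumHom d a b) (.inr (e, z)))
        this).symm
      refine Eq.trans ?_ (glue_natAdd (Hom.bij (ofFB.map g)) (Hom.bij (sumHom d a b)) e
        (Fin.natAdd _ i)).symm
      refine Eq.trans ?_ (sumEquiv_natAdd d (Hom.bij a) (Hom.bij b) e i).symm
      exact congrArg Sum.inr (glue_natAdd (Hom.bij (ofFB.map (partMap g d 1))) (Hom.bij b) e i)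

end DubOrd

/-! ### Normal forms of morphisms to a disjoint union -/

/-- The set `A ⊔ {1,2} × {1,…,s}`. -/
def FB.addPairs (A : FB) (s : ℕ) : FB := ⟨A ⊕ (Fin 2 × Fin s)⟩

/-- The set `A ⊔ {1,…,n}`. -/
def FB.addPoints (A : FB) (n : ℕ) : FB := ⟨A ⊕ Fin n⟩

namespace DubOrd

/-- The universal morphism of degree `s` from `A`. -/
def addPairsHom (A : FB) (s : ℕ) : (⟨A⟩ : DubOrd) ⟶ ⟨A.addPairs s⟩ :=
  Hom.mk s (Equiv.refl _)

/-- A morphism of degree `s` is nothing but a bijection out of `A ⊔ {1,2} × {1,…,s}`. This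
factorization lets the bijection be moved across the tensor product later. -/
lemma addPairsHom_comp {A B : FB} {s : ℕ} (f : A.addPairs s ⟶ B) :
    addPairsHom A s ≫ ofFB.map f = Hom.mk s f :=
  Hom.ext' rfl (fun _ => rfl) fun e i =>
    (glue_castAdd (Hom.bij (addPairsHom A s)) (Hom.bij (ofFB.map f)) e i)

end DubOrd

/-- The morphism `(S, T) → (X, Y)` of degree `n` given by bijections. -/
def UwbOrd.mkHom {S T X Y : FB} {n : ℕ} (L : S.addPoints n ⟶ X) (R : T.addPoints n ⟶ Y) :
    (⟨S, T⟩ : UwbOrd) ⟶ ⟨X, Y⟩ :=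
  UwbOrd.Hom.mk n L R

namespace DubOrd

section NormalHom

variable {U X Y : FB} (d : U → Fin 2) {s t n : ℕ}
  (L : ((part U d 0).addPairs s).addPoints n ⟶ X) (R : ((part U d 1).addPairs t).addPoints n ⟶ Y)

/-- The morphism `U → X ⊔ Y` with `s` pairs in `X`, `t` pairs in `Y` and `n` pairs from `X` to `Y`,
in this order, given by bijections. -/
def normalHom : (⟨U⟩ : DubOrd) ⟶ ⟨X.sum Y⟩ :=
  sumHom d (addPairsHom (part U d 0) s) (addPairsHom (part U d 1) t) ≫
    unW.map (UwbOrd.mkHom L R)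

/-- The bijection underlying `normalHom`. -/
def normalEquiv : U ⊕ (Fin 2 × Fin (s + t + n)) ≃ X ⊕ Y :=
  Hom.bij (normalHom d L R)

/-- The six evaluations of `normalEquiv` determine it completely. An unmixed pair stays on one side
in either order, while a mixed pair always has member `0` on the left. -/
lemma normalEquiv_zero (u : {u // d u = 0}) :
    normalEquiv d L R (.inl u) = .inl (FB.equiv L (.inl (.inl u))) :=
  congrArg (fun z => Hom.bij (unW.map (UwbOrd.mkHom L R)) (.inl z))
    (sumEquiv_zero d _ _ u)

lemma normalEquiv_one (u : {u // d u = 1}) :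
    normalEquiv d L R (.inl u) = .inr (FB.equiv R (.inl (.inl u))) :=
  congrArg (fun z => Hom.bij (unW.map (UwbOrd.mkHom L R)) (.inl z))
    (sumEquiv_one d _ _ u)

lemma normalEquiv_left (e : Fin 2) (i : Fin s) :
    normalEquiv d L R (.inr (e, Fin.castAdd n (Fin.castAdd t i))) =
      .inl (FB.equiv L (.inl (.inr (e, i)))) :=
  (glue_castAdd _ _ e _).trans
    (congrArg (fun z => Hom.bij (unW.map (UwbOrd.mkHom L R)) (.inl z))
      (sumEquiv_castAdd d (Hom.bij (addPairsHom (part U d 0) s))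
        (Hom.bij (addPairsHom (part U d 1) t)) e i))

lemma normalEquiv_right (e : Fin 2) (i : Fin t) :
    normalEquiv d L R (.inr (e, Fin.castAdd n (Fin.natAdd s i))) =
      .inr (FB.equiv R (.inl (.inr (e, i)))) :=
  (glue_castAdd _ _ e _).trans
    (congrArg (fun z => Hom.bij (unW.map (UwbOrd.mkHom L R)) (.inl z))
      (sumEquiv_natAdd d (Hom.bij (addPairsHom (part U d 0) s))
        (Hom.bij (addPairsHom (part U d 1) t)) e i))

lemma normalEquiv_mixed_zero (i : Fin n) :
    normalEquiv d L R (.inr (0, Fin.natAdd (s + t) i)) = .inl (FB.equiv L (.inr i)) :=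
  glue_natAdd _ _ 0 i

lemma normalEquiv_mixed_one (i : Fin n) :
    normalEquiv d L R (.inr (1, Fin.natAdd (s + t) i)) = .inr (FB.equiv R (.inr i)) :=
  glue_natAdd _ _ 1 i

/-- A bijection which respects the decompositions of source and target is a normal form. -/
lemma exists_eq_normalEquiv (f : U ⊕ (Fin 2 × Fin (s + t + n)) ≃ X ⊕ Y)
    (h : ∀ x, (f x).isLeft = (normalEquiv (s := s) (t := t) (n := n) d (𝟙 _) (𝟙 _) x).isLeft) :
    ∃ L R, f = normalEquiv d (s := s) (t := t) (n := n) L R := by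
  -- Identity bijections give the universal normal form `c`. Since `f` and `c` put every element on
  -- the same side, `c⁻¹` followed by `f` splits as `L ⊔ R`.
  set c := normalEquiv (s := s) (t := t) (n := n) d (𝟙 _) (𝟙 _) with hc
  have h' : ∀ y, ((c.symm.trans f) y).isLeft = y.isLeft := fun y => by simp [h]
  obtain ⟨L, R, e⟩ := exists_eq_sumCongr (c.symm.trans f) (fun a => by rw [h']; rfl)
    (fun b => by rw [← Sum.not_isLeft, h']; simp)
  refine ⟨L, R, ?_⟩
  have e' : f = c.trans (L.sumCongr R) := by rw [← e]; ext; simp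
  rw [e']
  ext (u | ⟨x, i⟩)
  · revert u
    refine fibre_cases d (fun u => ?_) (fun u => ?_)
    · rw [normalEquiv_zero]
      exact congrArg (L.sumCongr R) (normalEquiv_zero d _ _ u)
    · rw [normalEquiv_one]
      exact congrArg (L.sumCongr R) (normalEquiv_one d _ _ u)
  · refine Fin.addCases (fun i => ?_) (fun i => ?_) i
    · refine Fin.addCases (fun i => ?_) (fun i => ?_) i
      · rw [normalEquiv_left]
        exact congrArg (L.sumCongr R) (normalEquiv_left d _ _ x i)
      · rw [normalEquiv_right]
        exact congrArg (L.sumCongr R) (normalEquiv_right d _ _ x i)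
    · fin_cases x
      · exact (congrArg (L.sumCongr R) (normalEquiv_mixed_zero d _ _ i)).trans
          (normalEquiv_mixed_zero d _ _ i).symm
      · exact (congrArg (L.sumCongr R) (normalEquiv_mixed_one d _ _ i)).trans
          (normalEquiv_mixed_one d _ _ i).symm

end NormalHom

/-! ### Invariants of normal forms, their existence and their uniqueness -/

/-- The number of pairs with both members in a given part. -/
def pairCount {A Z : Type} {m : ℕ} (p : Z → Bool) (f : A ⊕ (Fin 2 × Fin m) ≃ Z) : ℕ :=
  ∑ i : Fin m, if ∀ e : Fin 2, p (f (.inr (e, i))) then 1 else 0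

/-- Permuting the pairs reindexes the sum, and exchanging the members of a pair does not change
whether both lie in the part. -/
lemma pairCount_act {A Z : Type} {m : ℕ} (p : Z → Bool) (f : A ⊕ (Fin 2 × Fin m) ≃ Z)
    (ε : Fin m → Equiv.Perm (Fin 2)) (π : Equiv.Perm (Fin m)) :
    pairCount p (((Equiv.refl _).sumCongr (wreath ε π)).trans f) = pairCount p f := by
  refine (Finset.sum_congr rfl fun i _ => ?_).trans (Equiv.sum_comp π _)
  exact if_congr ((ε i).forall_congr (fun {e} => Iff.rfl)) rfl rfl

/-- Only the first block has both members on the left. With its counterpart on the right this makes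
`s` and `t` invariants of the orbit, and the total degree then gives `n`. -/
lemma pairCount_normalEquiv_left {U X Y : FB} (d : U → Fin 2) {s t n : ℕ}
    (L : ((part U d 0).addPairs s).addPoints n ⟶ X)
    (R : ((part U d 1).addPairs t).addPoints n ⟶ Y) :
    pairCount Sum.isLeft (normalEquiv d L R) = s := by
  simp only [pairCount, Fin.sum_univ_add, Fin.forall_fin_two, normalEquiv_left, normalEquiv_right,
    normalEquiv_mixed_zero, normalEquiv_mixed_one]
  simp

lemma pairCount_normalEquiv_right {U X Y : FB} (d : U → Fin 2) {s t n : ℕ}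
    (L : ((part U d 0).addPairs s).addPoints n ⟶ X)
    (R : ((part U d 1).addPairs t).addPoints n ⟶ Y) :
    pairCount Sum.isRight (normalEquiv d L R) = t := by
  simp only [pairCount, Fin.sum_univ_add, Fin.forall_fin_two, normalEquiv_left, normalEquiv_right,
    normalEquiv_mixed_zero, normalEquiv_mixed_one]
  simp

/-- A finite set with two disjoint subsets is the disjoint union of three blocks. -/
lemma exists_blocks {m : ℕ} (p q : Fin m → Prop) (hpq : ∀ i, p i → ¬ q i) :
    ∃ (s t n : ℕ) (ρ : Fin (s + t + n) ≃ Fin m),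
      (∀ i, p (ρ (Fin.castAdd n (Fin.castAdd t i)))) ∧
      (∀ i, q (ρ (Fin.castAdd n (Fin.natAdd s i)))) ∧
      (∀ i, ¬ p (ρ (Fin.natAdd (s + t) i)) ∧ ¬ q (ρ (Fin.natAdd (s + t) i))) := by
  classical
  let e1 := (Equiv.sumCompl (fun i => p i ∨ q i)).symm
  let e2 : {i // p i ∨ q i} ≃ {i // p i} ⊕ {i // q i} :=
    subtypeOrEquiv p q (Pi.disjoint_iff.2 fun i => by
      simpa [Prop.disjoint_iff] using hpq i)
  -- The three placeholders are the cardinalities of `p`, of `q` and of their common complement,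
  -- fixed by the numberings `Finite.equivFin`.
  refine ⟨_, _, _, (finSumFinEquiv.symm.trans
    ((finSumFinEquiv.symm.trans ((Finite.equivFin {i // p i}).symm.sumCongr
      (Finite.equivFin {i // q i}).symm)).sumCongr
        (Finite.equivFin {i // ¬ (p i ∨ q i)}).symm)).trans
      ((e2.symm.sumCongr (Equiv.refl _)).trans e1.symm), fun i => ?_, fun i => ?_, fun i => ?_⟩
  · simpa [e1, e2] using ((Finite.equivFin {i // p i}).symm i).2
  · simpa [e1, e2] using ((Finite.equivFin {i // q i}).symm i).2
  · simpa [e1, e2] using ((Finite.equivFin {i // ¬ (p i ∨ q i)}).symm i).2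

/-- Every morphism to a disjoint union has a normal form. -/
lemma exists_act_eq_normalHom {U X Y : FB} (f : (⟨U⟩ : DubOrd) ⟶ ⟨X.sum Y⟩) :
    ∃ (d : U → Fin 2) (s t n : ℕ) (L : ((part U d 0).addPairs s).addPoints n ⟶ X)
      (R : ((part U d 1).addPairs t).addPoints n ⟶ Y)
      (ε : Fin (Hom.deg f) → Equiv.Perm (Fin 2)) (π : Equiv.Perm (Fin (Hom.deg f))),
      Hom.act f ε π = normalHom d L R := by
  obtain ⟨m, f⟩ := f
  change U ⊕ (Fin 2 × Fin m) ≃ X ⊕ Y at f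
  -- The decomposition is forced: symmetries do not touch `U`, so `u` belongs to the part of the
  -- side where `f` puts it.
  let d : U → Fin 2 := fun u => if (f (.inl u)).isLeft then 0 else 1
  obtain ⟨s, t, n, ρ, hp, hq, hpq⟩ := exists_blocks
    (fun i : Fin m => ∀ e : Fin 2, (f (.inr (e, i))).isLeft = true)
    (fun i => ∀ e : Fin 2, (f (.inr (e, i))).isLeft = false)
    (fun i h h' => by simpa [h 0] using h' 0)
  -- Once the degrees are identified, the numbering by blocks `ρ` is a permutation, hence can serve
  -- as a component of a symmetry.
  obtain rfl : s + t + n = m := Fin.equiv_iff_eq.1 ⟨ρ⟩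
  -- Unmixed pairs need no exchange; a mixed pair is turned exactly if its member `0` lies on the
  -- right.
  let ε : Fin (s + t + n) → Equiv.Perm (Fin 2) := Fin.addCases (fun _ => 1)
    fun i => if (f (.inr (0, ρ (Fin.natAdd (s + t) i)))).isLeft then 1 else Equiv.swap 0 1
  obtain ⟨L, R, h⟩ := exists_eq_normalEquiv (s := s) (t := t) (n := n) d
    (((Equiv.refl _).sumCongr (wreath ε ρ)).trans f) (by
      rintro (u | ⟨e, i⟩)
      · change (f (.inl u)).isLeft = _
        revert u
        refine fibre_cases d (fun u => ?_) (fun u => ?_)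
        · rw [normalEquiv_zero]
          simpa [d] using u.2
        · rw [normalEquiv_one]
          simpa [d] using u.2
      · change (f (.inr (ε i e, ρ i))).isLeft = _
        refine Fin.addCases (fun i => ?_) (fun i => ?_) i
        · refine Fin.addCases (fun i => ?_) (fun i => ?_) i
          · rw [normalEquiv_left]
            exact hp i _
          · rw [normalEquiv_right]
            exact hq i _
        -- A pair that is neither entirely left nor entirely right has exactly one member on each
        -- side, so member `0` determines the side of member `1`.
        · have h1 := hpq i
          simp only [Fin.forall_fin_two] at h1
          simp only [ε, Fin.addCases_right]
          fin_cases e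
          · refine Eq.trans ?_ (congrArg Sum.isLeft (normalEquiv_mixed_zero d _ _ i)).symm
            split_ifs with h2
            · exact h2
            · simpa [h2] using h1
          · refine Eq.trans ?_ (congrArg Sum.isLeft (normalEquiv_mixed_one d _ _ i)).symm
            split_ifs with h2
            · simpa [h2] using h1
            · simpa using h2)
  exact ⟨d, s, t, n, L, R, ε, ρ, congrArg (Hom.mk _) h⟩

/-- Mixed pairs are never turned, so they contribute no `𝔖₂`-sign and only the `∓`-character of
their permutation remains. This is the twist of the walled category, and the reason why that
category does not involve `±`. -/
lemma wreathChar_append_one (pm mp : ℤˣ) {s t n : ℕ} (ε₁ : Fin s → Equiv.Perm (Fin 2))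
    (π₁ : Equiv.Perm (Fin s)) (ε₂ : Fin t → Equiv.Perm (Fin 2)) (π₂ : Equiv.Perm (Fin t))
    (π₃ : Equiv.Perm (Fin n)) :
    wreathChar pm mp (Fin.append (Fin.append ε₁ ε₂) 1) (blockPerm (blockPerm π₁ π₂) π₃) =
      wreathChar pm mp ε₁ π₁ * wreathChar pm mp ε₂ π₂ * signChar mp π₃ := by
  rw [wreathChar_append, wreathChar_append]
  simp [wreathChar, signChar_one]

section Uniqueness

variable {U X Y : FB} {d : U → Fin 2} {s t n : ℕ}
  {L L' : ((part U d 0).addPairs s).addPoints n ⟶ X}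
  {R R' : ((part U d 1).addPairs t).addPoints n ⟶ Y}
  {ε : Fin (s + t + n) → Equiv.Perm (Fin 2)} {π : Equiv.Perm (Fin (s + t + n))}

/-- The decomposition can be read off from the restriction to `U`, on which the symmetries act
trivially; so it too is an invariant of the orbit. -/
lemma normalEquiv_isLeft (d : U → Fin 2) (L : ((part U d 0).addPairs s).addPoints n ⟶ X)
    (R : ((part U d 1).addPairs t).addPoints n ⟶ Y) (u : U) :
    (normalEquiv d L R (.inl u)).isLeft = true ↔ d u = 0 := by
  revert u
  refine fibre_cases d (fun u => ?_) (fun u => ?_)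
  · rw [normalEquiv_zero]; simp [u.2]
  · rw [normalEquiv_one]; simp [u.2]

/-- The symmetries relating normal forms preserve the blocks. -/
lemma exists_eq_blockPerm_of_normalEquiv (h : ∀ e i, normalEquiv d L' R' (.inr (e, i)) =
      normalEquiv d L R (.inr (ε i e, π i))) :
    ∃ (ε₁ : Fin s → Equiv.Perm (Fin 2)) (π₁ : Equiv.Perm (Fin s))
      (ε₂ : Fin t → Equiv.Perm (Fin 2)) (π₂ : Equiv.Perm (Fin t)) (π₃ : Equiv.Perm (Fin n)),
      ε = Fin.append (Fin.append ε₁ ε₂) 1 ∧ π = blockPerm (blockPerm π₁ π₂) π₃ := by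
  obtain ⟨π₀, π₃, rfl⟩ := exists_eq_blockPerm π fun i => by
    generalize hj : π (Fin.castAdd n i) = j
    revert hj
    refine Fin.addCases (fun j _ => ⟨j, rfl⟩) (fun j hj => ?_) j
    -- If the unmixed pair `i` went to a mixed pair, the two preimages under `ε` would hit members
    -- on opposite sides, whereas both members of pair `i` lie on the same side.
    have h0 := h ((ε (Fin.castAdd n i)).symm 0) (Fin.castAdd n i)
    have h1 := h ((ε (Fin.castAdd n i)).symm 1) (Fin.castAdd n i)
    rw [Equiv.apply_symm_apply, hj, normalEquiv_mixed_zero] at h0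
    rw [Equiv.apply_symm_apply, hj, normalEquiv_mixed_one] at h1
    clear hj
    revert h0 h1
    refine Fin.addCases (fun i => ?_) (fun i => ?_) i
    · simp only [normalEquiv_left]; simp
    · simp only [normalEquiv_right]; simp
  obtain ⟨π₁, π₂, rfl⟩ := exists_eq_blockPerm π₀ fun i => by
    generalize hj : π₀ (Fin.castAdd t i) = j
    revert hj
    refine Fin.addCases (fun j _ => ⟨j, rfl⟩) (fun j hj => ?_) j
    -- For unmixed pairs a single member already separates the left block from the right one.
    have h0 := h 0 (Fin.castAdd n (Fin.castAdd t i))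
    rw [blockPerm_castAdd, hj, normalEquiv_left, normalEquiv_right] at h0
    simp at h0
  refine ⟨fun i => ε (Fin.castAdd n (Fin.castAdd t i)), π₁,
    fun i => ε (Fin.castAdd n (Fin.natAdd s i)), π₂, π₃, ?_, rfl⟩
  funext i
  refine Fin.addCases (fun i => ?_) (fun i => ?_) i
  · rw [Fin.append_left]
    refine Fin.addCases (fun i => ?_) (fun i => ?_) i
    · rw [Fin.append_left]
    · rw [Fin.append_right]
  · rw [Fin.append_right]
    -- Member `0` of a mixed pair is on the left in both normal forms, so `ε` must fix `0`, and by
    -- injectivity also `1`.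
    have h0 := h 0 (Fin.natAdd (s + t) i)
    rw [blockPerm_natAdd, normalEquiv_mixed_zero] at h0
    have h1 : ε (Fin.natAdd (s + t) i) 0 = 0 := by
      by_contra h2
      have h3 : ε (Fin.natAdd (s + t) i) 0 = 1 := by omega
      rw [h3, normalEquiv_mixed_one] at h0
      simp at h0
    have h2 : ε (Fin.natAdd (s + t) i) 1 = 1 := by
      by_contra h2
      have h3 : ε (Fin.natAdd (s + t) i) 1 = 0 := by omega
      exact absurd ((ε (Fin.natAdd (s + t) i)).injective (h3.trans h1.symm)) (by decide)
    ext e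
    fin_cases e
    · exact congrArg Fin.val h1
    · exact congrArg Fin.val h2

end Uniqueness

/-- Two normal forms in the same orbit have the same blocks, and they are related by the symmetries
of the blocks. -/
lemma normalHom_induction (pm mp : ℤˣ) {U X Y : FB} {d d' : U → Fin 2} {s t n s' t' n' : ℕ}
    {L : ((part U d 0).addPairs s).addPoints n ⟶ X}
    {R : ((part U d 1).addPairs t).addPoints n ⟶ Y}
    {L' : ((part U d' 0).addPairs s').addPoints n' ⟶ X}
    {R' : ((part U d' 1).addPairs t').addPoints n' ⟶ Y}
    {ε : Fin (s + t + n) → Equiv.Perm (Fin 2)} {π : Equiv.Perm (Fin (s + t + n))}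
    (h : normalHom d' L' R' = Hom.act (normalHom d L R) ε π)
    {P : ∀ (d : U → Fin 2) (s t n : ℕ) (_ : ((part U d 0).addPairs s).addPoints n ⟶ X)
      (_ : ((part U d 1).addPairs t).addPoints n ⟶ Y) (_ : ℤˣ), Prop}
    (hP : ∀ (ε₁ : Fin s → Equiv.Perm (Fin 2)) (π₁ : Equiv.Perm (Fin s))
      (ε₂ : Fin t → Equiv.Perm (Fin 2)) (π₂ : Equiv.Perm (Fin t)) (π₃ : Equiv.Perm (Fin n)),
      P d s t n
        ((((Equiv.refl _).sumCongr (wreath ε₁ π₁)).sumCongr π₃).trans (FB.equiv L))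
        ((((Equiv.refl _).sumCongr (wreath ε₂ π₂)).sumCongr π₃).trans (FB.equiv R))
        (wreathChar pm mp ε₁ π₁ * wreathChar pm mp ε₂ π₂ * signChar mp π₃)) :
    P d' s' t' n' L' R' (wreathChar pm mp ε π) := by
  -- The block sizes and the decomposition agree only propositionally, and the types of `L'` and
  -- `R'` depend on them. The motive `P` is therefore quantified over all these data, and the
  -- equalities are substituted one after the other.
  have hdeg : s' + t' + n' = s + t + n := congrArg Hom.deg h
  have hs : s' = s := by
    rw [← pairCount_normalEquiv_left d' L' R']
    refine (congrArg (fun f : (⟨U⟩ : DubOrd) ⟶ ⟨X.sum Y⟩ =>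
      pairCount (Z := X ⊕ Y) Sum.isLeft (Hom.bij f)) h).trans ?_
    exact (pairCount_act _ _ _ _).trans (pairCount_normalEquiv_left d L R)
  have ht : t' = t := by
    rw [← pairCount_normalEquiv_right d' L' R']
    refine (congrArg (fun f : (⟨U⟩ : DubOrd) ⟶ ⟨X.sum Y⟩ =>
      pairCount (Z := X ⊕ Y) Sum.isRight (Hom.bij f)) h).trans ?_
    exact (pairCount_act _ _ _ _).trans (pairCount_normalEquiv_right d L R)
  obtain rfl : n' = n := by omega
  subst hs ht
  have key : normalEquiv d' L' R' =
      ((Equiv.refl _).sumCongr (wreath ε π)).trans (normalEquiv d L R) :=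
    eq_of_heq (DubOrd.Hom.mk.inj h).2
  have hu (u : U) : normalEquiv d' L' R' (.inl u) = normalEquiv d L R (.inl u) :=
    Equiv.congr_fun key (.inl u)
  have hi (e : Fin 2) (i) : normalEquiv d' L' R' (.inr (e, i)) =
      normalEquiv d L R (.inr (ε i e, π i)) := Equiv.congr_fun key (.inr (e, i))
  obtain rfl : d' = d := by
    funext u
    have := normalEquiv_isLeft d L R u
    rw [← hu, normalEquiv_isLeft] at this
    omega
  obtain ⟨ε₁, π₁, ε₂, π₂, π₃, rfl, rfl⟩ := exists_eq_blockPerm_of_normalEquiv hi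
  rw [wreathChar_append_one]
  refine Eq.mpr (congrArg₂ (fun l r => P d' s' t' n' l r _) ?_ ?_) (hP ε₁ π₁ ε₂ π₂ π₃)
  -- `L'` is read off from the left values of the normal form: on the part `U_0`, on the left block,
  -- and on member `0` of the mixed pairs. For `R'` the right values and member `1` play these
  -- roles.
  · refine Equiv.ext ?_
    rintro ((u | ⟨e, i⟩) | i)
    · have := hu u.1
      rw [normalEquiv_zero _ _ _ u, normalEquiv_zero _ _ _ u] at this
      exact Sum.inl_injective this
    · have := hi e (Fin.castAdd _ (Fin.castAdd _ i))
      rw [normalEquiv_left, blockPerm_castAdd, blockPerm_castAdd, normalEquiv_left,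
        Fin.append_left, Fin.append_left] at this
      exact Sum.inl_injective this
    · have := hi 0 (Fin.natAdd _ i)
      rw [Fin.append_right, blockPerm_natAdd, normalEquiv_mixed_zero, Pi.one_apply,
        Equiv.Perm.one_apply, normalEquiv_mixed_zero] at this
      exact Sum.inl_injective this
  · refine Equiv.ext ?_
    rintro ((u | ⟨e, i⟩) | i)
    · have := hu u.1
      rw [normalEquiv_one _ _ _ u, normalEquiv_one _ _ _ u] at this
      exact Sum.inr_injective this
    · have := hi e (Fin.castAdd _ (Fin.natAdd _ i))
      rw [normalEquiv_right, blockPerm_castAdd, blockPerm_natAdd, normalEquiv_right,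
        Fin.append_left, Fin.append_right] at this
      exact Sum.inr_injective this
    · have := hi 1 (Fin.natAdd _ i)
      rw [Fin.append_right, blockPerm_natAdd, normalEquiv_mixed_one, Pi.one_apply,
        Equiv.Perm.one_apply, normalEquiv_mixed_one] at this
      exact Sum.inr_injective this

end DubOrd

/-! ### The orbits of the wreath products -/

lemma signChar_mul (s : ℤˣ) {n : ℕ} (π ρ : Equiv.Perm (Fin n)) :
    signChar s (π * ρ) = signChar s π * signChar s ρ := by
  unfold signChar
  split_ifs <;> simp

lemma signChar_inv (s : ℤˣ) {n : ℕ} (π : Equiv.Perm (Fin n)) :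
    signChar s π⁻¹ = signChar s π := by
  unfold signChar
  split_ifs <;> simp

namespace DubOrd

/-- The argument on the left is `w⁻¹ w'` in the wreath product, for `w = (ε; π)` and `w' = (ε';
π')`. The product over the `ε`-signs is insensitive to the reindexing by `π⁻¹ π'`, and a sign is its
own inverse. -/
lemma wreathChar_inv_mul (pm mp : ℤˣ) {t : ℕ} (ε ε' : Fin t → Equiv.Perm (Fin 2))
    (π π' : Equiv.Perm (Fin t)) :
    wreathChar pm mp (fun i => (ε ((π⁻¹ * π') i))⁻¹ * ε' i) (π⁻¹ * π') =
      wreathChar pm mp ε π * wreathChar pm mp ε' π' := by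
  simp only [wreathChar, signChar_mul, signChar_inv, Finset.prod_mul_distrib]
  rw [Equiv.prod_comp (π⁻¹ * π') (fun i => signChar pm (ε i))]
  exact mul_mul_mul_comm _ _ _ _

/-- Change of base point in an orbit: `f · w' = g · (w⁻¹ w')` for `g = f · w`. With `g` a normal
form this compares two normal forms of `f`; with `g` arbitrary in the orbit it gives the
equivariance of the inverse map. -/
lemma exists_act_eq_act (pm mp : ℤˣ) {A B : DubOrd} {f g : A ⟶ B}
    {ε : Fin (Hom.deg f) → Equiv.Perm (Fin 2)} {π : Equiv.Perm (Fin (Hom.deg f))}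
    (h : Hom.act f ε π = g) (ε' : Fin (Hom.deg f) → Equiv.Perm (Fin 2))
    (π' : Equiv.Perm (Fin (Hom.deg f))) :
    ∃ (η : Fin (Hom.deg g) → Equiv.Perm (Fin 2)) (ρ : Equiv.Perm (Fin (Hom.deg g))),
      Hom.act f ε' π' = Hom.act g η ρ ∧
        wreathChar pm mp η ρ = wreathChar pm mp ε π * wreathChar pm mp ε' π' := by
  subst h
  refine ⟨fun i => (ε ((π⁻¹ * π') i))⁻¹ * ε' i, π⁻¹ * π', ?_, ?_⟩
  · refine Hom.ext' rfl (fun _ => rfl) fun e i => ?_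
    change Hom.bij f (.inr (ε' i e, π' i)) = Hom.bij f (.inr (ε ((π⁻¹ * π') i)
      (((ε ((π⁻¹ * π') i))⁻¹ * ε' i) e), π ((π⁻¹ * π') i)))
    exact congrArg (fun z => Hom.bij f (.inr z)) (Prod.ext
      (Equiv.apply_symm_apply (ε ((π⁻¹ * π') i)) _).symm (Equiv.apply_symm_apply π _).symm)
  · exact wreathChar_inv_mul pm mp ε ε' π π'

end DubOrd

/-! ### Morphisms of the twisted Brauer categories -/

section Classes

variable {k : Type u} [CommRing k]

lemma signIn_mul (a b : ℤˣ) : signIn k (a * b) = signIn k a * signIn k b := by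
  simp [signIn]

lemma signIn_mul_self (a : ℤˣ) : signIn k a * signIn k a = 1 := by
  rw [← signIn_mul, Int.units_mul_self, signIn_one]

variable (k) in
/-- The class of a morphism of the ordered directed upward Brauer category. -/
def ubMk (pm mp : ℤˣ) {A B : DubOrd} (f : A ⟶ B) :
    (⟨Free.of k A⟩ : Ub k pm mp) ⟶ ⟨Free.of k B⟩ :=
  (LinQuot.proj (ubIdeal k pm mp)).func.map (basis k f)

variable (k) in
/-- The class of a morphism of the ordered upward walled Brauer category. -/
def uwbMk (mp : ℤˣ) {P Q : UwbOrd} (f : P ⟶ Q) :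
    (⟨Free.of k P⟩ : Uwb k mp) ⟶ ⟨Free.of k Q⟩ :=
  (LinQuot.proj (uwbIdeal k mp)).func.map (basis k f)

lemma ubMk_act (pm mp : ℤˣ) {A B : DubOrd} (f : A ⟶ B)
    (ε : Fin (DubOrd.Hom.deg f) → Equiv.Perm (Fin 2)) (π : Equiv.Perm (Fin (DubOrd.Hom.deg f))) :
    ubMk k pm mp (DubOrd.Hom.act f ε π) =
      signIn k (DubOrd.wreathChar pm mp ε π) • ubMk k pm mp f :=
  (Submodule.Quotient.eq _).2 (Submodule.subset_span ⟨f, ε, π, rfl⟩)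

lemma uwbMk_act (mp : ℤˣ) {P Q : UwbOrd} (f : P ⟶ Q) (π : Equiv.Perm (Fin (UwbOrd.Hom.deg f))) :
    uwbMk k mp (UwbOrd.Hom.act f π) = signIn k (signChar mp π) • uwbMk k mp f :=
  (Submodule.Quotient.eq _).2 (Submodule.subset_span ⟨f, π, rfl⟩)

lemma ubMk_comp (pm mp : ℤˣ) {A B C : DubOrd} (f : A ⟶ B) (g : B ⟶ C) :
    ubMk k pm mp (f ≫ g) = ubMk k pm mp f ≫ ubMk k pm mp g :=
  congrArg (LinQuot.proj (ubIdeal k pm mp)).func.map (basis_comp (k := k) f g)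

lemma uwbMk_comp (mp : ℤˣ) {A B C : UwbOrd} (f : A ⟶ B) (g : B ⟶ C) :
    uwbMk k mp (f ≫ g) = uwbMk k mp f ≫ uwbMk k mp g :=
  congrArg (LinQuot.proj (uwbIdeal k mp)).func.map (basis_comp (k := k) f g)

lemma ub_ext {pm mp : ℤˣ} {A B : DubOrd} {V : Type*} [AddCommGroup V] [Module k V]
    {F G : ((⟨Free.of k A⟩ : Ub k pm mp) ⟶ ⟨Free.of k B⟩) →ₗ[k] V}
    (h : ∀ f : A ⟶ B, F (ubMk k pm mp f) = G (ubMk k pm mp f)) : F = G :=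
  Submodule.linearMap_qext ((ubIdeal k pm mp).rel (Free.of k A) (Free.of k B))
    (free_ext (C := DubOrd) (X := A) (Y := B) h)

lemma uwb_ext {mp : ℤˣ} {P Q : UwbOrd} {V : Type*} [AddCommGroup V] [Module k V]
    {F G : ((⟨Free.of k P⟩ : Uwb k mp) ⟶ ⟨Free.of k Q⟩) →ₗ[k] V}
    (h : ∀ f : P ⟶ Q, F (uwbMk k mp f) = G (uwbMk k mp f)) : F = G :=
  Submodule.linearMap_qext ((uwbIdeal k mp).rel (Free.of k P) (Free.of k Q))
    (free_ext (C := UwbOrd) (X := P) (Y := Q) h)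

/-- The linear map on a morphism space of `(k ub)_(±;∓)` with given values on classes of
morphisms. -/
def ubLift {pm mp : ℤˣ} {A B : DubOrd} {V : Type*} [AddCommGroup V] [Module k V] (φ : (A ⟶ B) → V)
    (h : ∀ f ε π, φ (DubOrd.Hom.act f ε π) = signIn k (DubOrd.wreathChar pm mp ε π) • φ f) :
    ((⟨Free.of k A⟩ : Ub k pm mp) ⟶ ⟨Free.of k B⟩) →ₗ[k] V :=
  Submodule.liftQ ((ubIdeal k pm mp).rel (Free.of k A) (Free.of k B))
    (freeLift₀ (C := DubOrd) A B φ) ((Submodule.span_le (s := ubGen k pm mp A B)).2 (by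
    rintro _ ⟨f, ε, π, rfl⟩
    rw [SetLike.mem_coe, LinearMap.mem_ker, map_sub, map_smul, freeLift₀_basis, freeLift₀_basis,
      h, sub_self]))

lemma ubLift_mk {pm mp : ℤˣ} {A B : DubOrd} {V : Type*} [AddCommGroup V] [Module k V]
    (φ : (A ⟶ B) → V)
    (h : ∀ f ε π, φ (DubOrd.Hom.act f ε π) = signIn k (DubOrd.wreathChar pm mp ε π) • φ f)
    (f : A ⟶ B) : ubLift φ h (ubMk k pm mp f) = φ f :=
  freeLift₀_basis (k := k) (C := DubOrd) A B φ f

lemma inclUb_map_basis (pm mp : ℤˣ) {A B : FB} (f : A ⟶ B) :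
    (inclUb k pm mp).func.map (basis k f) = ubMk k pm mp (DubOrd.ofFB.map f) :=
  congrArg (LinQuot.proj (ubIdeal k pm mp)).func.map
    (freeMap_basis (k := k) (DubOrd.ofFB ⋙ Free.embedding k DubOrd) f)

lemma inclUwb_map_basis (mp : ℤˣ) {A B : FB × FB} (f : A ⟶ B) :
    (inclUwb k mp).func.map (basis k f) = uwbMk k mp (UwbOrd.ofFB.map f) :=
  congrArg (LinQuot.proj (uwbIdeal k mp)).func.map
    (freeMap_basis (k := k) (UwbOrd.ofFB ⋙ Free.embedding k UwbOrd) f)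

lemma upsilon_map_uwbMk (pm mp : ℤˣ) {P Q : UwbOrd} (f : P ⟶ Q) :
    (upsilon k pm mp).func.map (uwbMk k mp f) = ubMk k pm mp (unW.map f) :=
  congrArg (LinQuot.proj (ubIdeal k pm mp)).func.map
    (freeMap_basis (k := k) (unW ⋙ Free.embedding k DubOrd) f)

/-- The linear extension of `sumHom`. -/
def ubSum (pm mp : ℤˣ) {U S T : FB} (d : U → Fin 2) :
    ((⟨Free.of k ⟨part U d 0⟩⟩ : Ub k pm mp) ⟶ ⟨Free.of k ⟨S⟩⟩) →ₗ[k]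
      ((⟨Free.of k ⟨part U d 1⟩⟩ : Ub k pm mp) ⟶ ⟨Free.of k ⟨T⟩⟩) →ₗ[k]
        ((⟨Free.of k ⟨U⟩⟩ : Ub k pm mp) ⟶ ⟨Free.of k ⟨S.sum T⟩⟩) :=
  ubLift
    (fun a => ubLift (fun b => ubMk k pm mp (DubOrd.sumHom d a b)) fun b η ρ => by
      -- Equivariance in `b` alone is the case of the trivial symmetry of `a`, whose character value
      -- is `1`.
      have h := DubOrd.sumHom_act d a b 1 1 η ρ
      rw [DubOrd.Hom.act_one] at h
      rw [h]
      refine (ubMk_act pm mp (DubOrd.sumHom d a b) _ _).trans ?_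
      refine congrArg (fun c => signIn k c • _) ?_
      exact (DubOrd.wreathChar_append pm mp _ _ _ _).trans (by
        rw [DubOrd.wreathChar_one, one_mul]))
    fun a ε π => ub_ext fun b => by
      have h := DubOrd.sumHom_act d a b ε π 1 1
      rw [DubOrd.Hom.act_one] at h
      rw [LinearMap.smul_apply, ubLift_mk, ubLift_mk, h]
      refine (ubMk_act pm mp (DubOrd.sumHom d a b) _ _).trans ?_
      refine congrArg (fun c => signIn k c • _) ?_
      exact (DubOrd.wreathChar_append pm mp _ _ _ _).trans (by
        rw [DubOrd.wreathChar_one, mul_one])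

lemma ubSum_mk (pm mp : ℤˣ) {U S T : FB} (d : U → Fin 2)
    (a : (⟨part U d 0⟩ : DubOrd) ⟶ ⟨S⟩) (b : (⟨part U d 1⟩ : DubOrd) ⟶ ⟨T⟩) :
    ubSum pm mp d (ubMk k pm mp a) (ubMk k pm mp b) = ubMk k pm mp (DubOrd.sumHom d a b) := by
  rw [ubSum, ubLift_mk, ubLift_mk]

end Classes

/-! ### Modules over tensor products and tensor products over categories -/

section Modules

variable {k : Type u} [CommRing k]
variable {𝒜 ℬ 𝒞 : Type*} [Category.{u} 𝒜] [Preadditive 𝒜] [Linear k 𝒜]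
  [Category.{u} ℬ] [Preadditive ℬ] [Linear k ℬ] [Category.{u} 𝒞] [Preadditive 𝒞] [Linear k 𝒞]

lemma homBimodule_actL {X X' : 𝒜ᵒᵖ} (Y : 𝒜) (f : X ⟶ X') (h : X.unop ⟶ Y) :
    actL (homBimodule k 𝒜) X X' Y f h = f.unop ≫ h :=
  congrArg (f.unop ≫ ·) (Category.comp_id h)

lemma homBimodule_actR (X : 𝒜ᵒᵖ) {Y Y' : 𝒜} (g : Y ⟶ Y') (h : X.unop ⟶ Y) :
    actR (homBimodule k 𝒜) X Y Y' g h = h ≫ g :=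
  Category.id_comp _

section Balanced

variable (E : Representatives 𝒜) (M : LMod k (TensorCat k 𝒜ᵒᵖ ℬ)) (N : LMod k (TensorCat k 𝒞 𝒜))
  {C : 𝒞} {B : ℬ}

lemma balancedMk_balanced {i j : E.ι} (f : E.obj i ⟶ E.obj j)
    (x : M.obj.obj ⟨op (E.obj j), B⟩) (y : N.obj.obj ⟨C, E.obj i⟩) :
    balancedMk E M N i (actL M _ _ B f.op x) y = balancedMk E M N j x (actR N C _ _ f y) :=
  (Submodule.Quotient.eq _).2 (Submodule.subset_span ⟨i, j, f, x, y, rfl⟩)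

/-- The linear map out of a tensor product over `𝒜` given by balanced bilinear maps. -/
def balancedLift {V : Type*} [AddCommGroup V] [Module k V]
    (β : ∀ i, M.obj.obj ⟨op (E.obj i), B⟩ →ₗ[k] N.obj.obj ⟨C, E.obj i⟩ →ₗ[k] V)
    (h : ∀ {i j} (f : E.obj i ⟶ E.obj j) x y,
      β i (actL M _ _ B f.op x) y = β j x (actR N C _ _ f y)) :
    (_ ⧸ balancedRel E M N C B) →ₗ[k] V :=
  Submodule.liftQ _ (DirectSum.toModule k E.ι V fun i => TensorProduct.lift (β i))
    (Submodule.span_le.2 (by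
      rintro _ ⟨i, j, f, x, y, rfl⟩
      rw [SetLike.mem_coe, LinearMap.mem_ker, map_sub, DirectSum.toModule_lof,
        DirectSum.toModule_lof, TensorProduct.lift.tmul, TensorProduct.lift.tmul, h, sub_self]))

lemma balancedLift_mk {V : Type*} [AddCommGroup V] [Module k V]
    (β : ∀ i, M.obj.obj ⟨op (E.obj i), B⟩ →ₗ[k] N.obj.obj ⟨C, E.obj i⟩ →ₗ[k] V)
    (h : ∀ {i j} (f : E.obj i ⟶ E.obj j) x y,
      β i (actL M _ _ B f.op x) y = β j x (actR N C _ _ f y)) (i : E.ι)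
    (x : M.obj.obj ⟨op (E.obj i), B⟩) (y : N.obj.obj ⟨C, E.obj i⟩) :
    balancedLift E M N β h (balancedMk E M N i x y) = β i x y := by
  refine (DirectSum.toModule_lof k (φ := fun i => TensorProduct.lift (β i)) i (x ⊗ₜ[k] y)).trans ?_
  rw [TensorProduct.lift.tmul]

lemma balancedMk_smul (i : E.ι) (c c' : k) (x : M.obj.obj ⟨op (E.obj i), B⟩)
    (y : N.obj.obj ⟨C, E.obj i⟩) :
    balancedMk E M N i (c • x) (c' • y) = (c * c') • balancedMk E M N i x y := by
  rw [balancedMk, TensorProduct.smul_tmul_smul, map_smul]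
  rfl

/-- The index of a representative of an object. -/
def Representatives.index {E : Representatives 𝒜} (A : 𝒜) : E.ι := (E.exists_iso A).choose

/-- The isomorphism from an object to its representative. -/
def Representatives.iso {E : Representatives 𝒜} (A : 𝒜) : A ≅ E.obj (E.index A) :=
  (E.exists_iso A).choose_spec.some

/-- The class of `x ⊗ y` in `M ⊗_𝒜 N`, for `x` and `y` at an arbitrary object of `𝒜`. -/
def balancedMkObj {A : 𝒜} (x : M.obj.obj ⟨op A, B⟩) (y : N.obj.obj ⟨C, A⟩) :
    _ ⧸ balancedRel E M N C B :=
  balancedMk E M N (E.index A) (actL M _ _ B (E.iso A).inv.op x) (actR N C _ _ (E.iso A).hom y)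

/-- The isomorphism chosen for a representative need not be the identity, but it is a morphism
between representatives, so the defining relation moves it across the tensor sign, where it meets
its inverse. -/
lemma balancedMkObj_obj (i : E.ι) (x : M.obj.obj ⟨op (E.obj i), B⟩) (y : N.obj.obj ⟨C, E.obj i⟩) :
    balancedMkObj E M N x y = balancedMk E M N i x y := by
  rw [balancedMkObj, ← balancedMk_balanced]
  congr 1
  have := LinearMap.congr_fun (actL_comp M B (E.iso (E.obj i)).inv.op (E.iso (E.obj i)).hom.op) x
  rw [LinearMap.comp_apply] at this
  rw [← this, ← op_comp, Iso.hom_inv_id]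
  exact LinearMap.congr_fun (actL_id M _ _) x

/-- Conjugating `f` by the chosen isomorphisms gives a morphism between representatives, to which
the defining relation applies. -/
lemma balancedMkObj_balanced {A A' : 𝒜} (f : A ⟶ A') (x : M.obj.obj ⟨op A', B⟩)
    (y : N.obj.obj ⟨C, A⟩) :
    balancedMkObj E M N (actL M _ _ B f.op x) y = balancedMkObj E M N x (actR N C _ _ f y) := by
  have h1 : actL M _ _ B (E.iso A).inv.op (actL M _ _ B f.op x) =
      actL M _ _ B ((E.iso A).inv ≫ f ≫ (E.iso A').hom).op
        (actL M _ _ B (E.iso A').inv.op x) := by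
    simp only [← LinearMap.comp_apply, ← actL_comp, ← op_comp]
    simp
  have h2 : actR N C _ _ (E.iso A').hom (actR N C _ _ f y) =
      actR N C _ _ ((E.iso A).inv ≫ f ≫ (E.iso A').hom) (actR N C _ _ (E.iso A).hom y) := by
    simp only [← LinearMap.comp_apply, ← actR_comp]
    simp
  rw [balancedMkObj, balancedMkObj, h1, h2, balancedMk_balanced]

lemma balancedMkObj_smul {A : 𝒜} (c c' : k) (x : M.obj.obj ⟨op A, B⟩) (y : N.obj.obj ⟨C, A⟩) :
    balancedMkObj E M N (c • x) (c' • y) = (c * c') • balancedMkObj E M N x y := by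
  rw [balancedMkObj, map_smul, map_smul, balancedMk_smul, balancedMkObj]

end Balanced

/-- In `moduleOfActs` the morphism `f ⊗ 𝟙` acts by `l f ∘ r 𝟙`, and the second factor is the
identity. -/
lemma moduleOfActs_actL {V : 𝒜 → ℬ → ModuleCat.{u} k}
    {l : ∀ A A' B, (A ⟶ A') →ₗ[k] (V A B →ₗ[k] V A' B)}
    {r : ∀ A B B', (B ⟶ B') →ₗ[k] (V A B →ₗ[k] V A B')} {l_id l_comp r_id r_comp comm}
    {A A' : 𝒜} (B : ℬ) (f : A ⟶ A') :
    actL (TensorCat.moduleOfActs V l r l_id l_comp r_id r_comp comm) A A' B f = l A A' B f := by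
  change l A A' B f ∘ₗ r A B B (𝟙 B) = _
  rw [r_id, LinearMap.comp_id]

lemma moduleOfActs_actR {V : 𝒜 → ℬ → ModuleCat.{u} k}
    {l : ∀ A A' B, (A ⟶ A') →ₗ[k] (V A B →ₗ[k] V A' B)}
    {r : ∀ A B B', (B ⟶ B') →ₗ[k] (V A B →ₗ[k] V A B')} {l_id l_comp r_id r_comp comm}
    (A : 𝒜) {B B' : ℬ} (g : B ⟶ B') :
    actR (TensorCat.moduleOfActs V l r l_id l_comp r_id r_comp comm) A B B' g = r A B B' g := by
  change l A A B' (𝟙 A) ∘ₗ r A B B' g = _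
  rw [l_id, LinearMap.id_comp]

lemma tensorOver_actL (E : Representatives 𝒜) (M : LMod k (TensorCat k 𝒜ᵒᵖ ℬ))
    (N : LMod k (TensorCat k 𝒞 𝒜)) {C C' : 𝒞} (B : ℬ) (γ : C ⟶ C') :
    actL (tensorOver E M N) C C' B γ = balancedQ E M N γ (𝟙 B) :=
  moduleOfActs_actL B γ

lemma tensorOver_actR (E : Representatives 𝒜) (M : LMod k (TensorCat k 𝒜ᵒᵖ ℬ))
    (N : LMod k (TensorCat k 𝒞 𝒜)) (C : 𝒞) {B B' : ℬ} (β : B ⟶ B') :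
    actR (tensorOver E M N) C B B' β = balancedQ E M N (𝟙 C) β :=
  moduleOfActs_actR C β

/-- An isomorphism of modules over `𝒜 ⊗ ℬ` from isomorphisms which commute with both actions. -/
def tensorCatIso {M N : LMod k (TensorCat k 𝒜 ℬ)}
    (e : ∀ A B, M.obj.obj ⟨A, B⟩ ≃ₗ[k] N.obj.obj ⟨A, B⟩)
    (hl : ∀ {A A'} (B) (f : A ⟶ A') x, e A' B (actL M A A' B f x) = actL N A A' B f (e A B x))
    (hr : ∀ (A) {B B'} (g : B ⟶ B') x, e A B' (actR M A B B' g x) = actR N A B B' g (e A B x)) :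
    M ≅ N :=
  ObjectProperty.isoMk _ (NatIso.ofComponents (fun P => (e P.fst P.snd).toModuleIso) (by
    intro P Q z
    have h : (e Q.fst Q.snd).toLinearMap ∘ₗ M.act P Q z =
        N.act P Q z ∘ₗ (e P.fst P.snd).toLinearMap := by
      refine TensorProduct.induction_on (motive := fun z : P ⟶ Q =>
        (e Q.fst Q.snd).toLinearMap ∘ₗ M.act P Q z =
          N.act P Q z ∘ₗ (e P.fst P.snd).toLinearMap) z ?_ ?_ ?_
      · exact ((congrArg _ (map_zero (M.act P Q))).trans (LinearMap.comp_zero _)).trans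
          ((congrArg (· ∘ₗ _) (map_zero (N.act P Q))).trans (LinearMap.zero_comp _)).symm
      · intro f g
        -- A pure tensor is a morphism of the second category followed by one of the first;
        -- naturality for each action separately thus gives naturality for `f ⊗ g`.
        have hf : (TensorCat.tmul f g : P ⟶ Q) =
            TensorCat.tmul (𝟙 P.fst) g ≫ TensorCat.tmul f (𝟙 Q.snd) := by
          rw [TensorCat.tmul_comp, Category.id_comp, Category.comp_id]
        change (e Q.fst Q.snd).toLinearMap ∘ₗ M.act P Q (TensorCat.tmul f g) =
          N.act P Q (TensorCat.tmul f g) ∘ₗ (e P.fst P.snd).toLinearMap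
        rw [hf]
        ext x
        have hM := LinearMap.congr_fun
          (M.act_comp (TensorCat.tmul (𝟙 P.fst) g) (TensorCat.tmul f (𝟙 Q.snd))) x
        have hN := LinearMap.congr_fun
          (N.act_comp (TensorCat.tmul (𝟙 P.fst) g) (TensorCat.tmul f (𝟙 Q.snd)))
            (e P.fst P.snd x)
        exact (congrArg (e Q.fst Q.snd) hM).trans (((hl _ f _).trans
          (congrArg _ (hr _ g x))).trans hN.symm)
      · intro z z' h h'
        exact ((congrArg _ (map_add (M.act P Q) z z')).trans (LinearMap.comp_add _ _ _)).trans
          ((congrArg₂ (· + ·) h h').trans ((congrArg (· ∘ₗ _)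
            (map_add (N.act P Q) z z')).trans (LinearMap.add_comp _ _ _)).symm)
    ext x
    exact LinearMap.congr_fun h x))

end Modules

/-! ### Actions on modules restricted along a tensor product of functors -/

section Restriction

variable {k : Type u} [CommRing k]
variable {𝒜 ℬ 𝒞 𝒟 : Type*} [Category.{u} 𝒜] [Preadditive 𝒜] [Linear k 𝒜]
  [Category.{u} ℬ] [Preadditive ℬ] [Linear k ℬ] [Category.{u} 𝒞] [Preadditive 𝒞] [Linear k 𝒞]
  [Category.{u} 𝒟] [Preadditive 𝒟] [Linear k 𝒟]

lemma restrict_map_actL (F : LFunctor k 𝒜 𝒞) (G : LFunctor k ℬ 𝒟)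
    (M : LMod k (TensorCat k 𝒞 𝒟)) {A A' : 𝒜} (B : ℬ) (f : A ⟶ A') :
    actL (M.restrict (TensorCat.map F G)) A A' B f =
      actL M (F.func.obj A) (F.func.obj A') (G.func.obj B) (F.func.map f) := by
  change M.act _ _ (TensorCat.tmul (F.func.map f) (G.func.map (𝟙 B))) = _
  rw [G.func.map_id]
  rfl

lemma restrict_map_actR (F : LFunctor k 𝒜 𝒞) (G : LFunctor k ℬ 𝒟)
    (M : LMod k (TensorCat k 𝒞 𝒟)) (A : 𝒜) {B B' : ℬ} (g : B ⟶ B') :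
    actR (M.restrict (TensorCat.map F G)) A B B' g =
      actR M (F.func.obj A) (G.func.obj B) (G.func.obj B') (G.func.map g) := by
  change M.act _ _ (TensorCat.tmul (F.func.map (𝟙 A)) (G.func.map g)) = _
  rw [F.func.map_id]
  rfl

end Restriction

/-! ### Actions on generators, and the balanced bilinear map -/

section Comparison

variable {k : Type u} [CommRing k] {pm mp : ℤˣ}

lemma upsilonPullback_actL {U U' : (Free k FB)ᵒᵖ} (P : Uwb k mp) (f : U ⟶ U')
    (h : (inclUb k pm mp).func.obj U.unop ⟶ (upsilon k pm mp).func.obj P) :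
    actL (upsilonPullback k pm mp) U U' P f h = (inclUb k pm mp).func.map f.unop ≫ h :=
  (LinearMap.congr_fun (restrict_map_actL (inclUb k pm mp).op (upsilon k pm mp)
    (homBimodule k (Ub k pm mp)) P f) h).trans (homBimodule_actL _ _ _)

lemma upsilonPullback_actR (U : (Free k FB)ᵒᵖ) {P P' : Uwb k mp} (f : P ⟶ P')
    (h : (inclUb k pm mp).func.obj U.unop ⟶ (upsilon k pm mp).func.obj P) :
    actR (upsilonPullback k pm mp) U P P' f h = h ≫ (upsilon k pm mp).func.map f :=
  (LinearMap.congr_fun (restrict_map_actR (inclUb k pm mp).op (upsilon k pm mp)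
    (homBimodule k (Ub k pm mp)) U f) h).trans (homBimodule_actR _ _ _)

lemma kuwbBimodule_actL {A A' : (Free k (FB × FB))ᵒᵖ} (P : Uwb k mp) (f : A ⟶ A')
    (h : (inclUwb k mp).func.obj A.unop ⟶ P) :
    actL (kuwbBimodule k mp) A A' P f h = (inclUwb k mp).func.map f.unop ≫ h :=
  (LinearMap.congr_fun (restrict_map_actL (inclUwb k mp).op LFunctor.id
    (homBimodule k (Uwb k mp)) P f) h).trans (homBimodule_actL _ _ _)

lemma kuwbBimodule_actR (A : (Free k (FB × FB))ᵒᵖ) {P P' : Uwb k mp} (f : P ⟶ P')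
    (h : (inclUwb k mp).func.obj A.unop ⟶ P) :
    actR (kuwbBimodule k mp) A P P' f h = h ≫ f :=
  (LinearMap.congr_fun (restrict_map_actR (inclUwb k mp).op LFunctor.id
    (homBimodule k (Uwb k mp)) A f) h).trans (homBimodule_actR _ _ _)

/-- The element `x ⊗ y` of `(k ub)(A, S) ⊗ (k ub)(B, T)`. -/
def kubMk {A B S T : FB} (x : (⟨Free.of k ⟨A⟩⟩ : Ub k pm mp) ⟶ ⟨Free.of k ⟨S⟩⟩)
    (y : (⟨Free.of k ⟨B⟩⟩ : Ub k pm mp) ⟶ ⟨Free.of k ⟨T⟩⟩) :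
    (kubTensorSq k pm mp).obj.obj ⟨op (Free.of k (A, B)), Free.of k (S, T)⟩ :=
  x ⊗ₜ[k] y

lemma freeLift_map_basis {C 𝒜 : Type*} [Category.{0} C] [Category.{u} 𝒜] [Preadditive 𝒜]
    [Linear k 𝒜] (F : C ⥤ 𝒜) {X Y : C} (f : X ⟶ Y) :
    (freeLift (k := k) F).func.map (basis k f) = F.map f :=
  freeMap_basis F f

lemma inclUb₂_map {A B : FB × FB} (f : A ⟶ B) :
    (inclUb₂ k pm mp).map f = TensorCat.tmul (ubMk k pm mp (DubOrd.ofFB.map f.1))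
      (ubMk k pm mp (DubOrd.ofFB.map f.2)) :=
  congrArg₂ TensorCat.tmul (inclUb_map_basis pm mp f.1) (inclUb_map_basis pm mp f.2)

lemma kubTensorSq_actL {A B A' B' S T : FB} (f : (A', B') ⟶ (A, B))
    (a : (⟨A⟩ : DubOrd) ⟶ ⟨S⟩) (b : (⟨B⟩ : DubOrd) ⟶ ⟨T⟩) :
    actL (kubTensorSq k pm mp) (op (Free.of k (A, B))) (op (Free.of k (A', B')))
      (Free.of k (S, T)) (basis k f).op (kubMk (ubMk k pm mp a) (ubMk k pm mp b)) =
      kubMk (ubMk k pm mp (DubOrd.ofFB.map f.1 ≫ a)) (ubMk k pm mp (DubOrd.ofFB.map f.2 ≫ b)) := by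
  refine (LinearMap.congr_fun (restrict_map_actL (freeLift (inclUb₂ k pm mp)).op
    (freeLift (inclUb₂ k pm mp)) (homBimodule k (TensorCat k (Ub k pm mp) (Ub k pm mp)))
    (Free.of k (S, T)) (basis k f).op) _).trans ?_
  refine (homBimodule_actL _ _ _).trans ?_
  exact (congrArg (fun z => z ≫ TensorCat.tmul (ubMk k pm mp a) (ubMk k pm mp b))
    ((freeLift_map_basis _ f).trans (inclUb₂_map f))).trans
      (congrArg₂ kubMk (ubMk_comp pm mp _ a) (ubMk_comp pm mp _ b)).symm

lemma kubTensorSq_actR {A B S T S' T' : FB} (f : (S, T) ⟶ (S', T'))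
    (a : (⟨A⟩ : DubOrd) ⟶ ⟨S⟩) (b : (⟨B⟩ : DubOrd) ⟶ ⟨T⟩) :
    actR (kubTensorSq k pm mp) (op (Free.of k (A, B))) (Free.of k (S, T))
      (Free.of k (S', T')) (basis k f) (kubMk (ubMk k pm mp a) (ubMk k pm mp b)) =
      kubMk (ubMk k pm mp (a ≫ DubOrd.ofFB.map f.1)) (ubMk k pm mp (b ≫ DubOrd.ofFB.map f.2)) := by
  refine (LinearMap.congr_fun (restrict_map_actR (freeLift (inclUb₂ k pm mp)).op
    (freeLift (inclUb₂ k pm mp)) (homBimodule k (TensorCat k (Ub k pm mp) (Ub k pm mp)))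
    (op (Free.of k (A, B))) (basis k f)) _).trans ?_
  refine (homBimodule_actR _ _ _).trans ?_
  exact (congrArg (fun z => TensorCat.tmul (ubMk k pm mp a) (ubMk k pm mp b) ≫ z)
    ((freeLift_map_basis _ f).trans (inclUb₂_map f))).trans
      (congrArg₂ kubMk (ubMk_comp pm mp a _) (ubMk_comp pm mp b _)).symm

/-- The element of `⨁_{U = U_1 ⊔ U_2} (k ub)(U_1, S) ⊗ (k ub)(U_2, T)` given by a decomposition
and morphisms. -/
def amalgUbMk {U S T : FB} (d : U → Fin 2) (x : (⟨Free.of k ⟨part U d 0⟩⟩ : Ub k pm mp) ⟶ ⟨Free.of k ⟨S⟩⟩)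
    (y : (⟨Free.of k ⟨part U d 1⟩⟩ : Ub k pm mp) ⟶ ⟨Free.of k ⟨T⟩⟩) :
    (amalgOp (kubTensorSq k pm mp)).obj.obj ⟨op (Free.of k U), Free.of k (S, T)⟩ :=
  amalgMk (kubTensorSq k pm mp) U (Free.of k (S, T)) d (kubMk x y)

lemma amalgUbMk_smul {U S T : FB} (d : U → Fin 2) (c c' : k)
    (x : (⟨Free.of k ⟨part U d 0⟩⟩ : Ub k pm mp) ⟶ ⟨Free.of k ⟨S⟩⟩)
    (y : (⟨Free.of k ⟨part U d 1⟩⟩ : Ub k pm mp) ⟶ ⟨Free.of k ⟨T⟩⟩) :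
    amalgUbMk d (c • x) (c' • y) = (c * c') • amalgUbMk d x y :=
  (congrArg (amalgMk (kubTensorSq k pm mp) U (Free.of k (S, T)) d)
    (TensorProduct.smul_tmul_smul c c' x y)).trans (map_smul _ _ _)

lemma amalgOp_ext {U S T : FB} {V : Type*} [AddCommGroup V] [Module k V]
    {F G : (amalgOp (kubTensorSq k pm mp)).obj.obj ⟨op (Free.of k U), Free.of k (S, T)⟩ →ₗ[k] V}
    (h : ∀ d a b, F (amalgUbMk d (ubMk k pm mp a) (ubMk k pm mp b)) =
      G (amalgUbMk d (ubMk k pm mp a) (ubMk k pm mp b))) : F = G := by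
  refine amalg_ext (kubTensorSq k pm mp) (U := U) (D := Free.of k (S, T)) fun d => ?_
  refine LinearMap.congr_fun (f := F ∘ₗ amalgMk (kubTensorSq k pm mp) U (Free.of k (S, T)) d)
    (g := G ∘ₗ amalgMk (kubTensorSq k pm mp) U (Free.of k (S, T)) d) ?_
  exact TensorProduct.ext (ub_ext fun a => ub_ext fun b => h d a b)

lemma amalgOp_actL {U U' S T : FB} (g : U' ⟶ U) (d : U → Fin 2)
    (a : (⟨part U d 0⟩ : DubOrd) ⟶ ⟨S⟩) (b : (⟨part U d 1⟩ : DubOrd) ⟶ ⟨T⟩) :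
    actL (amalgOp (kubTensorSq k pm mp)) (op (Free.of k U)) (op (Free.of k U')) (Free.of k (S, T))
      (basis k g).op (amalgUbMk d (ubMk k pm mp a) (ubMk k pm mp b)) =
      amalgUbMk (d ∘ FB.equiv g) (ubMk k pm mp (DubOrd.ofFB.map (partMap g d 0) ≫ a))
        (ubMk k pm mp (DubOrd.ofFB.map (partMap g d 1) ≫ b)) := by
  refine (LinearMap.congr_fun (moduleOfActs_actL _ _) _).trans ?_
  refine (LinearMap.congr_fun (freeLift₀_basis U' U
    (fun g => amalgL (kubTensorSq k pm mp) g (Free.of k (S, T))) g) _).trans ?_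
  refine (amalgL_mk _ _ _ _ _).trans ?_
  exact congrArg (amalgMk (kubTensorSq k pm mp) U' (Free.of k (S, T)) (d ∘ FB.equiv g))
    (kubTensorSq_actL (A := part U d 0) (B := part U d 1) (A' := part U' (d ∘ FB.equiv g) 0)
      (B' := part U' (d ∘ FB.equiv g) 1) (partMap g d 0, partMap g d 1) a b)

lemma amalgOp_actR {U S T S' T' : FB} (f : (S, T) ⟶ (S', T')) (d : U → Fin 2)
    (a : (⟨part U d 0⟩ : DubOrd) ⟶ ⟨S⟩) (b : (⟨part U d 1⟩ : DubOrd) ⟶ ⟨T⟩) :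
    actR (amalgOp (kubTensorSq k pm mp)) (op (Free.of k U)) (Free.of k (S, T)) (Free.of k (S', T'))
      (basis k f) (amalgUbMk d (ubMk k pm mp a) (ubMk k pm mp b)) =
      amalgUbMk d (ubMk k pm mp (a ≫ DubOrd.ofFB.map f.1))
        (ubMk k pm mp (b ≫ DubOrd.ofFB.map f.2)) := by
  refine (LinearMap.congr_fun (moduleOfActs_actR _ _) _).trans ?_
  refine (amalgR_mk _ _ _ _ _).trans ?_
  exact congrArg (amalgMk (kubTensorSq k pm mp) U (Free.of k (S', T')) d)
    (kubTensorSq_actR f a b)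

/-- The linear map out of `⨿_*^op M` given by linear maps on the summands. -/
def amalgLift {𝒟 : Type*} [Category.{u} 𝒟] [Preadditive 𝒟] [Linear k 𝒟]
    (M : LMod k (TensorCat k (Free k (FB × FB))ᵒᵖ 𝒟)) (U : FB) (D : 𝒟)
    {V : Type*} [AddCommGroup V] [Module k V]
    (φ : ∀ d, M.obj.obj ⟨op (parts k U d), D⟩ →ₗ[k] V) : Amalg M U D →ₗ[k] V := by
  classical exact DirectSum.toModule k (U → Fin 2) _ φ

lemma amalgLift_mk {𝒟 : Type*} [Category.{u} 𝒟] [Preadditive 𝒟] [Linear k 𝒟]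
    (M : LMod k (TensorCat k (Free k (FB × FB))ᵒᵖ 𝒟)) (U : FB) (D : 𝒟)
    {V : Type*} [AddCommGroup V] [Module k V]
    (φ : ∀ d, M.obj.obj ⟨op (parts k U d), D⟩ →ₗ[k] V) (d : U → Fin 2)
    (x : M.obj.obj ⟨op (parts k U d), D⟩) :
    amalgLift M U D φ (amalgMk M U D d x) = φ d x := by
  simp [amalgLift, amalgMk]

/-- The linear map `(k ub)(U_1, S) ⊗ (k ub)(U_2, T) → (k ub)(U, S ⊔ T)` given by disjoint unions of
morphisms. -/
def kubSum (U S T : FB) (d : U → Fin 2) :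
    (kubTensorSq k pm mp).obj.obj ⟨op (parts k U d), Free.of k (S, T)⟩ →ₗ[k]
      ((⟨Free.of k ⟨U⟩⟩ : Ub k pm mp) ⟶ ⟨Free.of k ⟨S.sum T⟩⟩) :=
  TensorProduct.lift (ubSum pm mp d)

lemma kubSum_mk {U S T : FB} (d : U → Fin 2)
    (a : (⟨part U d 0⟩ : DubOrd) ⟶ ⟨S⟩) (b : (⟨part U d 1⟩ : DubOrd) ⟶ ⟨T⟩) :
    kubSum U S T d (kubMk (ubMk k pm mp a) (ubMk k pm mp b)) =
      ubMk k pm mp (DubOrd.sumHom d a b) :=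
  ubSum_mk pm mp d a b

/-- The linear map `⨁_{U = U_1 ⊔ U_2} (k ub)(U_1, S) ⊗ (k ub)(U_2, T) → (k ub)(U, S ⊔ T)` given by
disjoint unions of morphisms. -/
def amalgSum (U S T : FB) :
    (amalgOp (kubTensorSq k pm mp)).obj.obj ⟨op (Free.of k U), Free.of k (S, T)⟩ →ₗ[k]
      ((⟨Free.of k ⟨U⟩⟩ : Ub k pm mp) ⟶ ⟨Free.of k ⟨S.sum T⟩⟩) :=
  amalgLift (kubTensorSq k pm mp) U (Free.of k (S, T)) (kubSum U S T)

lemma amalgSum_amalgMk {U S T : FB} (d : U → Fin 2)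
    (x : (kubTensorSq k pm mp).obj.obj ⟨op (parts k U d), Free.of k (S, T)⟩) :
    amalgSum U S T (amalgMk (kubTensorSq k pm mp) U (Free.of k (S, T)) d x) = kubSum U S T d x := by
  exact amalgLift_mk (kubTensorSq k pm mp) U (Free.of k (S, T)) (kubSum U S T) d x

lemma amalgSum_mk {U S T : FB} (d : U → Fin 2)
    (a : (⟨part U d 0⟩ : DubOrd) ⟶ ⟨S⟩) (b : (⟨part U d 1⟩ : DubOrd) ⟶ ⟨T⟩) :
    amalgSum U S T (amalgUbMk d (ubMk k pm mp a) (ubMk k pm mp b)) =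
      ubMk k pm mp (DubOrd.sumHom d a b) := by
  have h := amalgSum_amalgMk d (kubMk (S := S) (T := T) (ubMk k pm mp a) (ubMk k pm mp b))
  have h2 := kubSum_mk (k := k) (pm := pm) (mp := mp) d a b
  exact h.trans h2

/-- Both sides are linear in `g` and in `y`; on basis elements this is the naturality
`ofFB_comp_sumHom` of disjoint unions in the source. -/
lemma amalgSum_actL {U U' S T : FB} (g : Free.of k U' ⟶ Free.of k U)
    (y : (amalgOp (kubTensorSq k pm mp)).obj.obj ⟨op (Free.of k U), Free.of k (S, T)⟩) :
    amalgSum U' S T (actL _ _ _ _ g.op y) = (inclUb k pm mp).func.map g ≫ amalgSum U S T y := by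
  let F : (Free.of k U' ⟶ Free.of k U) →ₗ[k]
      ((amalgOp (kubTensorSq k pm mp)).obj.obj ⟨op (Free.of k U), Free.of k (S, T)⟩ →ₗ[k]
        ((⟨Free.of k ⟨U'⟩⟩ : Ub k pm mp) ⟶ ⟨Free.of k ⟨S.sum T⟩⟩)) :=
    { toFun := fun g => amalgSum U' S T ∘ₗ actL _ _ _ _ g.op
      map_add' := fun g g' => by rw [op_add, map_add, LinearMap.comp_add]
      map_smul' := fun c g => by
        have : (c • g).op = c • g.op := rfl
        rw [this, map_smul, LinearMap.comp_smul, RingHom.id_apply] }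
  let G : (Free.of k U' ⟶ Free.of k U) →ₗ[k]
      ((amalgOp (kubTensorSq k pm mp)).obj.obj ⟨op (Free.of k U), Free.of k (S, T)⟩ →ₗ[k]
        ((⟨Free.of k ⟨U'⟩⟩ : Ub k pm mp) ⟶ ⟨Free.of k ⟨S.sum T⟩⟩)) :=
    (Linear.comp ((inclUb k pm mp).func.obj (Free.of k U'))
      ((inclUb k pm mp).func.obj (Free.of k U)) ⟨Free.of k ⟨S.sum T⟩⟩).compl₁₂
      ((inclUb k pm mp).mapₗ (Free.of k U') (Free.of k U)) (amalgSum U S T)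
  have h : F = G := free_ext fun g => amalgOp_ext fun d a b => by
    refine (congrArg (amalgSum U' S T) (amalgOp_actL g d a b)).trans ?_
    refine (amalgSum_mk _ _ _).trans ?_
    refine Eq.trans ?_ (congrArg₂ (fun x y => x ≫ y) (inclUb_map_basis pm mp g)
      (amalgSum_mk d a b)).symm
    rw [DubOrd.ofFB_comp_sumHom]
    exact ubMk_comp pm mp _ _
  exact LinearMap.congr_fun (LinearMap.congr_fun h g) y

/-- The action on morphisms of the composite of `υ_(±;∓)` and the inclusion of `k (FB × FB)`. -/
def upsilonIncl (S T S' T' : FB) : (Free.of k (S, T) ⟶ Free.of k (S', T')) →ₗ[k]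
    ((⟨Free.of k ⟨S.sum T⟩⟩ : Ub k pm mp) ⟶ ⟨Free.of k ⟨S'.sum T'⟩⟩) :=
  ((upsilon k pm mp).mapₗ ⟨Free.of k ⟨S, T⟩⟩ ⟨Free.of k ⟨S', T'⟩⟩) ∘ₗ
    ((inclUwb k mp).mapₗ (Free.of k (S, T)) (Free.of k (S', T')))

lemma upsilonIncl_basis {S T S' T' : FB} (f : (S, T) ⟶ (S', T')) :
    upsilonIncl S T S' T' (basis k f) = ubMk k pm mp (unW.map (UwbOrd.ofFB.map f)) :=
  (congrArg ((upsilon k pm mp).mapₗ ⟨Free.of k ⟨S, T⟩⟩ ⟨Free.of k ⟨S', T'⟩⟩)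
    (inclUwb_map_basis mp f)).trans (upsilon_map_uwbMk pm mp (UwbOrd.ofFB.map f))

lemma amalgSum_actR_basis {U S T S' T' : FB} (f : (S, T) ⟶ (S', T'))
    (y : (amalgOp (kubTensorSq k pm mp)).obj.obj ⟨op (Free.of k U), Free.of k (S, T)⟩) :
    amalgSum U S' T' (actR _ _ _ _ (basis k f) y) =
      amalgSum U S T y ≫ upsilonIncl S T S' T' (basis k f) := by
  have h : amalgSum U S' T' ∘ₗ actR (amalgOp (kubTensorSq k pm mp)) _ _ _ (basis k f) =
      Linear.rightComp k _ (upsilonIncl S T S' T' (basis k f)) ∘ₗ amalgSum U S T := by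
    refine amalgOp_ext fun d a b => ?_
    rw [LinearMap.comp_apply, LinearMap.comp_apply, amalgOp_actR, amalgSum_mk, amalgSum_mk,
      DubOrd.sumHom_comp_ofFB, upsilonIncl_basis]
    exact ubMk_comp pm mp _ _
  exact LinearMap.congr_fun h y

/-- Linear extension of the naturality of disjoint unions in the targets; it is what allows a
morphism of `k (FB × FB)` to cross the tensor sign. -/
lemma amalgSum_actR {U S T S' T' : FB} (f : Free.of k (S, T) ⟶ Free.of k (S', T'))
    (y : (amalgOp (kubTensorSq k pm mp)).obj.obj ⟨op (Free.of k U), Free.of k (S, T)⟩) :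
    amalgSum U S' T' (actR _ _ _ _ f y) = amalgSum U S T y ≫ upsilonIncl S T S' T' f := by
  induction f using free_induction with
  | h0 => rw [map_zero, map_zero, LinearMap.zero_apply, map_zero, Limits.comp_zero]
  | hadd f f' h h' =>
    rw [map_add, map_add, LinearMap.add_apply, map_add, h, h', Preadditive.comp_add]
  | hb c f =>
    rw [map_smul, map_smul, LinearMap.smul_apply, map_smul, amalgSum_actR_basis,
      Linear.comp_smul]

/-- The bilinear map `(x, y) ↦ y ≫ υ x`. -/
def comparisonBilin (U S T : FB) (P : UwbOrd) :
    (kuwbBimodule k mp).obj.obj ⟨op (Free.of k (S, T)), ⟨Free.of k P⟩⟩ →ₗ[k]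
      (amalgOp (kubTensorSq k pm mp)).obj.obj ⟨op (Free.of k U), Free.of k (S, T)⟩ →ₗ[k]
        ((⟨Free.of k ⟨U⟩⟩ : Ub k pm mp) ⟶ ⟨Free.of k (unW.obj P)⟩) :=
  ((Linear.comp (⟨Free.of k ⟨U⟩⟩ : Ub k pm mp) ⟨Free.of k ⟨S.sum T⟩⟩
    ⟨Free.of k (unW.obj P)⟩).compl₁₂ (amalgSum U S T)
      ((upsilon k pm mp).mapₗ ⟨Free.of k ⟨S, T⟩⟩ ⟨Free.of k P⟩)).flip

lemma comparisonBilin_mk {U S T : FB} {P : UwbOrd} (w : (⟨S, T⟩ : UwbOrd) ⟶ P) (d : U → Fin 2)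
    (a : (⟨part U d 0⟩ : DubOrd) ⟶ ⟨S⟩) (b : (⟨part U d 1⟩ : DubOrd) ⟶ ⟨T⟩) :
    comparisonBilin U S T P (uwbMk k mp w) (amalgUbMk d (ubMk k pm mp a) (ubMk k pm mp b)) =
      ubMk k pm mp (DubOrd.sumHom d a b ≫ unW.map w) :=
  (congrArg₂ (fun x y => x ≫ y) (amalgSum_mk d a b) (upsilon_map_uwbMk pm mp w)).trans
    (ubMk_comp pm mp _ _).symm

/-- Both sides are bracketings of the composite of `y`, the image of `f` and `υ x`. -/
lemma comparisonBilin_balanced {U S T S' T' : FB} {P : UwbOrd}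
    (f : Free.of k (S, T) ⟶ Free.of k (S', T'))
    (x : (kuwbBimodule k mp).obj.obj ⟨op (Free.of k (S', T')), ⟨Free.of k P⟩⟩)
    (y : (amalgOp (kubTensorSq k pm mp)).obj.obj ⟨op (Free.of k U), Free.of k (S, T)⟩) :
    comparisonBilin U S T P (actL _ _ _ _ f.op x) y =
      comparisonBilin U S' T' P x (actR _ _ _ _ f y) := by
  have h1 : comparisonBilin U S T P (actL _ _ _ _ f.op x) y =
      amalgSum U S T y ≫ (upsilonIncl S T S' T' f ≫
        (upsilon k pm mp).mapₗ ⟨Free.of k ⟨S', T'⟩⟩ ⟨Free.of k P⟩ x) := by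
    refine congrArg (fun z => amalgSum U S T y ≫ z) ?_
    exact (congrArg ((upsilon k pm mp).mapₗ ⟨Free.of k ⟨S, T⟩⟩ ⟨Free.of k P⟩)
      (kuwbBimodule_actL ⟨Free.of k P⟩ f.op x)).trans ((upsilon k pm mp).func.map_comp _ _)
  have h2 : comparisonBilin U S' T' P x (actR _ _ _ _ f y) =
      (amalgSum U S T y ≫ upsilonIncl S T S' T' f) ≫
        (upsilon k pm mp).mapₗ ⟨Free.of k ⟨S', T'⟩⟩ ⟨Free.of k P⟩ x :=
    congrArg (fun z => z ≫ (upsilon k pm mp).mapₗ ⟨Free.of k ⟨S', T'⟩⟩ ⟨Free.of k P⟩ x)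
      (amalgSum_actR f y)
  exact h1.trans ((Category.assoc _ _ _).symm.trans h2.symm)

/-! ### The comparison map on the tensor product -/

variable (k pm mp) in
/-- The space `((k uwb)_∓ ⊗_{k (FB × FB)} ⨿_*^op ((k ub)_(±;∓)^{⊗ 2}))(U, P)`. -/
abbrev ComparisonSource (U : FB) (P : UwbOrd) : Type u :=
  (⨁ i : (fbReps k).ι,
    ((kuwbBimodule k mp).obj.obj ⟨op ((fbReps k).obj i), ⟨Free.of k P⟩⟩ ⊗[k]
      (amalgOp (kubTensorSq k pm mp)).obj.obj ⟨op (Free.of k U), (fbReps k).obj i⟩)) ⧸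
    balancedRel (fbReps k) (kuwbBimodule k mp) (amalgOp (kubTensorSq k pm mp))
      (op (Free.of k U)) ⟨Free.of k P⟩

/-- The class of a morphism, as an element of the bimodule `(k uwb)_∓`. -/
def kuwbMk {S T : FB} {P : UwbOrd} (w : (⟨S, T⟩ : UwbOrd) ⟶ P) :
    (kuwbBimodule k mp).obj.obj ⟨op (Free.of k (S, T)), ⟨Free.of k P⟩⟩ :=
  uwbMk k mp w

lemma kuwbMk_act {S T : FB} {P : UwbOrd} (w : (⟨S, T⟩ : UwbOrd) ⟶ P)
    (π : Equiv.Perm (Fin (UwbOrd.Hom.deg w))) :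
    kuwbMk (k := k) (mp := mp) (UwbOrd.Hom.act w π) = signIn k (signChar mp π) • kuwbMk w :=
  uwbMk_act mp w π

lemma kuwbBimodule_actL_basis {S T S' T' : FB} {P : UwbOrd} (f : (S, T) ⟶ (S', T'))
    (w : (⟨S', T'⟩ : UwbOrd) ⟶ P) :
    actL (kuwbBimodule k mp) (op (Free.of k (S', T'))) (op (Free.of k (S, T))) ⟨Free.of k P⟩
      (basis k f).op (kuwbMk w) = kuwbMk (UwbOrd.ofFB.map f ≫ w) :=
  (kuwbBimodule_actL _ _ _).trans ((congrArg (fun z => z ≫ uwbMk k mp w)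
    (inclUwb_map_basis mp f)).trans (uwbMk_comp mp _ _).symm)

/-- The class of `x ⊗ y`. -/
def comparisonMk {U S T : FB} {P : UwbOrd}
    (x : (kuwbBimodule k mp).obj.obj ⟨op (Free.of k (S, T)), ⟨Free.of k P⟩⟩)
    (y : (amalgOp (kubTensorSq k pm mp)).obj.obj ⟨op (Free.of k U), Free.of k (S, T)⟩) :
    ComparisonSource k pm mp U P :=
  balancedMkObj (fbReps k) (kuwbBimodule k mp) (amalgOp (kubTensorSq k pm mp))
    (A := Free.of k (S, T)) x y

/-- The comparison map, `x ⊗ y ↦ y ≫ υ x`. -/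
def comparison (U : FB) (P : UwbOrd) : ComparisonSource k pm mp U P →ₗ[k]
    ((⟨Free.of k ⟨U⟩⟩ : Ub k pm mp) ⟶ ⟨Free.of k (unW.obj P)⟩) :=
  balancedLift (fbReps k) (kuwbBimodule k mp) (amalgOp (kubTensorSq k pm mp))
    (fun i : ℕ × ℕ => comparisonBilin U ⟨Fin i.1⟩ ⟨Fin i.2⟩ P)
    (fun f x y => comparisonBilin_balanced f x y)

lemma comparison_balancedMk {U : FB} {P : UwbOrd} (i : ℕ × ℕ)
    (x : (kuwbBimodule k mp).obj.obj
      ⟨op (Free.of k ((⟨Fin i.1⟩ : FB), (⟨Fin i.2⟩ : FB))), ⟨Free.of k P⟩⟩)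
    (y : (amalgOp (kubTensorSq k pm mp)).obj.obj
      ⟨op (Free.of k U), Free.of k ((⟨Fin i.1⟩ : FB), (⟨Fin i.2⟩ : FB))⟩) :
    comparison U P (balancedMk (fbReps k) (kuwbBimodule k mp) (amalgOp (kubTensorSq k pm mp))
      i x y) = comparisonBilin U ⟨Fin i.1⟩ ⟨Fin i.2⟩ P x y :=
  balancedLift_mk (fbReps k) (kuwbBimodule k mp) (amalgOp (kubTensorSq k pm mp))
    (fun i : ℕ × ℕ => comparisonBilin U ⟨Fin i.1⟩ ⟨Fin i.2⟩ P)
    (fun f x y => comparisonBilin_balanced f x y) i x y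

/-- By balancedness `φ` and its inverse meet on the walled factor and cancel. So the comparison map
has the same formula at every object, not only at the representatives. -/
lemma comparisonBilin_iso {U S T S' T' : FB} {P : UwbOrd}
    (φ : Free.of k (S, T) ≅ Free.of k (S', T'))
    (x : (kuwbBimodule k mp).obj.obj ⟨op (Free.of k (S, T)), ⟨Free.of k P⟩⟩)
    (y : (amalgOp (kubTensorSq k pm mp)).obj.obj ⟨op (Free.of k U), Free.of k (S, T)⟩) :
    comparisonBilin U S' T' P (actL _ _ _ _ φ.inv.op x) (actR _ _ _ _ φ.hom y) =
      comparisonBilin U S T P x y := by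
  rw [← comparisonBilin_balanced]
  have h := LinearMap.congr_fun (actL_comp (kuwbBimodule k mp) ⟨Free.of k P⟩ φ.inv.op φ.hom.op) x
  rw [LinearMap.comp_apply, ← op_comp, Iso.hom_inv_id] at h
  rw [← h]
  exact congrArg (fun z => comparisonBilin U S T P z y) (LinearMap.congr_fun (actL_id _ _ _) x)

lemma comparison_mk {U S T : FB} {P : UwbOrd}
    (x : (kuwbBimodule k mp).obj.obj ⟨op (Free.of k (S, T)), ⟨Free.of k P⟩⟩)
    (y : (amalgOp (kubTensorSq k pm mp)).obj.obj ⟨op (Free.of k U), Free.of k (S, T)⟩) :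
    comparison U P (comparisonMk x y) = comparisonBilin U S T P x y :=
  (comparison_balancedMk _ _ _).trans (comparisonBilin_iso _ x y)

lemma comparisonMk_balanced {U S T S' T' : FB} {P : UwbOrd}
    (f : Free.of k (S, T) ⟶ Free.of k (S', T'))
    (x : (kuwbBimodule k mp).obj.obj ⟨op (Free.of k (S', T')), ⟨Free.of k P⟩⟩)
    (y : (amalgOp (kubTensorSq k pm mp)).obj.obj ⟨op (Free.of k U), Free.of k (S, T)⟩) :
    comparisonMk (actL (kuwbBimodule k mp) (op (Free.of k (S', T'))) (op (Free.of k (S, T)))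
        ⟨Free.of k P⟩ f.op x) y =
      comparisonMk x (actR (amalgOp (kubTensorSq k pm mp)) (op (Free.of k U)) (Free.of k (S, T))
        (Free.of k (S', T')) f y) :=
  balancedMkObj_balanced (fbReps k) (kuwbBimodule k mp) (amalgOp (kubTensorSq k pm mp)) f x y

lemma comparisonMk_smul {U S T : FB} {P : UwbOrd} (c c' : k)
    (x : (kuwbBimodule k mp).obj.obj ⟨op (Free.of k (S, T)), ⟨Free.of k P⟩⟩)
    (y : (amalgOp (kubTensorSq k pm mp)).obj.obj ⟨op (Free.of k U), Free.of k (S, T)⟩) :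
    comparisonMk (c • x) (c' • y) = (c * c') • comparisonMk x y :=
  balancedMkObj_smul (fbReps k) (kuwbBimodule k mp) (amalgOp (kubTensorSq k pm mp)) c c' x y

/-- Read from right to left, this strips the Brauer factors of the bijections that follow them, at
the cost of changing the walled factor. -/
lemma comparisonMk_ofFB_comp {U S T S' T' : FB} {P : UwbOrd} (f : (S, T) ⟶ (S', T'))
    (w : (⟨S', T'⟩ : UwbOrd) ⟶ P) (d : U → Fin 2) (a : (⟨part U d 0⟩ : DubOrd) ⟶ ⟨S⟩)
    (b : (⟨part U d 1⟩ : DubOrd) ⟶ ⟨T⟩) :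
    comparisonMk (kuwbMk (UwbOrd.ofFB.map f ≫ w))
        (amalgUbMk d (ubMk k pm mp a) (ubMk k pm mp b)) =
      comparisonMk (kuwbMk w)
        (amalgUbMk d (ubMk k pm mp (a ≫ DubOrd.ofFB.map f.1))
          (ubMk k pm mp (b ≫ DubOrd.ofFB.map f.2))) := by
  rw [← kuwbBimodule_actL_basis, comparisonMk_balanced, amalgOp_actR]

/-! ### Normal forms in the tensor product -/

/-- The element of the tensor product given by the data of a normal form. -/
def normalElt {U X Y : FB} (d : U → Fin 2) {s t n : ℕ}
    (L : ((part U d 0).addPairs s).addPoints n ⟶ X)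
    (R : ((part U d 1).addPairs t).addPoints n ⟶ Y) : ComparisonSource k pm mp U ⟨X, Y⟩ :=
  comparisonMk (kuwbMk (UwbOrd.mkHom L R))
    (amalgUbMk d (ubMk k pm mp (DubOrd.addPairsHom (part U d 0) s))
      (ubMk k pm mp (DubOrd.addPairsHom (part U d 1) t)))

lemma comparison_normalElt {U X Y : FB} (d : U → Fin 2) {s t n : ℕ}
    (L : ((part U d 0).addPairs s).addPoints n ⟶ X)
    (R : ((part U d 1).addPairs t).addPoints n ⟶ Y) :
    comparison U ⟨X, Y⟩ (normalElt d L R) = ubMk k pm mp (DubOrd.normalHom d L R) :=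
  (comparison_mk _ _).trans (comparisonBilin_mk _ _ _ _)

/-- The added points are not affected by `f`; the composite has degree `0 + n`, so their indices
have to be shifted past an empty block. -/
lemma UwbOrd.ofFB_comp_mkHom {S T S' T' X Y : FB} {n : ℕ} (f : (S, T) ⟶ (S', T'))
    (L : S'.addPoints n ⟶ X) (R : T'.addPoints n ⟶ Y) :
    (UwbOrd.ofFB.map f ≫ UwbOrd.mkHom L R : (⟨S, T⟩ : UwbOrd) ⟶ ⟨X, Y⟩) =
      UwbOrd.mkHom (S := S) (T := T) (n := n)
        ((((FB.equiv f.1).sumCongr (Equiv.refl (Fin n))).trans (FB.equiv L) :) )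
        ((((FB.equiv f.2).sumCongr (Equiv.refl (Fin n))).trans (FB.equiv R) :) ) := by
  refine UwbOrd.Hom.ext' (Nat.zero_add n) (fun _ => rfl) (fun i => ?_) (fun _ => rfl) (fun i => ?_)
  · refine Fin.addCases (fun i => i.elim0) (fun i => ?_) i
    refine (UwbOrd.glue_natAdd _ _ i).trans (congrArg (fun j => FB.equiv L (.inr j)) ?_)
    exact Fin.ext (Nat.zero_add i.1).symm
  · refine Fin.addCases (fun i => i.elim0) (fun i => ?_) i
    refine (UwbOrd.glue_natAdd _ _ i).trans (congrArg (fun j => FB.equiv R (.inr j)) ?_)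
    exact Fin.ext (Nat.zero_add i.1).symm

/-- Every generator of the tensor product is given by the data of a normal form. -/
lemma exists_comparisonMk_eq_normalElt {U S T : FB} {P : UwbOrd} (w : (⟨S, T⟩ : UwbOrd) ⟶ P)
    (d : U → Fin 2) (a : (⟨part U d 0⟩ : DubOrd) ⟶ ⟨S⟩) (b : (⟨part U d 1⟩ : DubOrd) ⟶ ⟨T⟩) :
    ∃ (s t n : ℕ) (L : ((part U d 0).addPairs s).addPoints n ⟶ P.fst)
      (R : ((part U d 1).addPairs t).addPoints n ⟶ P.snd),
      comparisonMk (kuwbMk w) (amalgUbMk d (ubMk k pm mp a) (ubMk k pm mp b)) =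
        normalElt d L R := by
  obtain ⟨s, a⟩ := a
  obtain ⟨t, b⟩ := b
  obtain ⟨n, L, R⟩ := w
  -- The bijections underlying `a` and `b` form a morphism of `FB × FB` out of the universal
  -- targets; moved to the walled factor, it leaves only `addPairsHom` in the Brauer factors.
  let f : ((part U d 0).addPairs s, (part U d 1).addPairs t) ⟶ (S, T) := (a, b)
  refine ⟨s, t, n, ((FB.equiv f.1).sumCongr (Equiv.refl (Fin n))).trans L,
    ((FB.equiv f.2).sumCongr (Equiv.refl (Fin n))).trans R, ?_⟩
  have ha : DubOrd.addPairsHom (part U d 0) s ≫ DubOrd.ofFB.map f.1 = DubOrd.Hom.mk s a :=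
    DubOrd.addPairsHom_comp _
  have hb : DubOrd.addPairsHom (part U d 1) t ≫ DubOrd.ofFB.map f.2 = DubOrd.Hom.mk t b :=
    DubOrd.addPairsHom_comp _
  refine (congrArg₂ (fun x y => comparisonMk (kuwbMk (UwbOrd.mkHom L R))
    (amalgUbMk d (ubMk k pm mp x) (ubMk k pm mp y))) ha hb).symm.trans ?_
  refine (comparisonMk_ofFB_comp f (UwbOrd.mkHom L R) d _ _).symm.trans ?_
  exact congrArg (fun z => comparisonMk (kuwbMk z) _) (UwbOrd.ofFB_comp_mkHom f L R)

/-- Each factor is twisted by its own character, and the tensor product multiplies the three signs.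
-/
lemma comparisonMk_act {U S T : FB} {P : UwbOrd} (w : (⟨S, T⟩ : UwbOrd) ⟶ P)
    (d : U → Fin 2) (a : (⟨part U d 0⟩ : DubOrd) ⟶ ⟨S⟩) (b : (⟨part U d 1⟩ : DubOrd) ⟶ ⟨T⟩)
    (ε₁ : Fin (DubOrd.Hom.deg a) → Equiv.Perm (Fin 2)) (π₁ : Equiv.Perm (Fin (DubOrd.Hom.deg a)))
    (ε₂ : Fin (DubOrd.Hom.deg b) → Equiv.Perm (Fin 2)) (π₂ : Equiv.Perm (Fin (DubOrd.Hom.deg b)))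
    (π₃ : Equiv.Perm (Fin (UwbOrd.Hom.deg w))) :
    comparisonMk (kuwbMk (UwbOrd.Hom.act w π₃))
        (amalgUbMk d (ubMk k pm mp (DubOrd.Hom.act a ε₁ π₁))
          (ubMk k pm mp (DubOrd.Hom.act b ε₂ π₂))) =
      signIn k (DubOrd.wreathChar pm mp ε₁ π₁ * DubOrd.wreathChar pm mp ε₂ π₂ *
        signChar mp π₃) •
        comparisonMk (kuwbMk w) (amalgUbMk d (ubMk k pm mp a) (ubMk k pm mp b)) := by
  rw [ubMk_act, ubMk_act, kuwbMk_act, amalgUbMk_smul, comparisonMk_smul, signIn_mul, signIn_mul,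
    mul_comm _ (signIn k (signChar mp π₃))]

/-- The symmetries of the unmixed pairs are moved from `L` and `R` back to the universal morphisms,
where they act by their characters, while `π₃` acts on the walled factor. By `wreathChar_append_one`
the resulting sign is that of the block symmetry in `(k ub)`. -/
lemma normalElt_act {U X Y : FB} (d : U → Fin 2) {s t n : ℕ}
    (L : ((part U d 0).addPairs s).addPoints n ⟶ X)
    (R : ((part U d 1).addPairs t).addPoints n ⟶ Y)
    (ε₁ : Fin s → Equiv.Perm (Fin 2)) (π₁ : Equiv.Perm (Fin s))
    (ε₂ : Fin t → Equiv.Perm (Fin 2)) (π₂ : Equiv.Perm (Fin t)) (π₃ : Equiv.Perm (Fin n)) :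
    normalElt (k := k) (pm := pm) (mp := mp) (X := X) (Y := Y) d (s := s) (t := t) (n := n)
        ((((Equiv.refl _).sumCongr (DubOrd.wreath ε₁ π₁)).sumCongr π₃).trans (FB.equiv L))
        ((((Equiv.refl _).sumCongr (DubOrd.wreath ε₂ π₂)).sumCongr π₃).trans (FB.equiv R)) =
      signIn k (DubOrd.wreathChar pm mp ε₁ π₁ * DubOrd.wreathChar pm mp ε₂ π₂ *
        signChar mp π₃) • normalElt d L R := by
  let f : ((part U d 0).addPairs s, (part U d 1).addPairs t) ⟶
      ((part U d 0).addPairs s, (part U d 1).addPairs t) :=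
    ((Equiv.refl _).sumCongr (DubOrd.wreath ε₁ π₁), (Equiv.refl _).sumCongr (DubOrd.wreath ε₂ π₂))
  have ha : DubOrd.addPairsHom (part U d 0) s ≫ DubOrd.ofFB.map f.1 =
    DubOrd.Hom.act (DubOrd.addPairsHom (part U d 0) s) ε₁ π₁ := DubOrd.addPairsHom_comp _
  have hb : DubOrd.addPairsHom (part U d 1) t ≫ DubOrd.ofFB.map f.2 =
    DubOrd.Hom.act (DubOrd.addPairsHom (part U d 1) t) ε₂ π₂ := DubOrd.addPairsHom_comp _
  have hw : UwbOrd.mkHom (X := X) (Y := Y)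
      (S := (part U d 0).addPairs s) (T := (part U d 1).addPairs t) (n := n)
        ((((Equiv.refl _).sumCongr (DubOrd.wreath ε₁ π₁)).sumCongr π₃).trans (FB.equiv L))
        ((((Equiv.refl _).sumCongr (DubOrd.wreath ε₂ π₂)).sumCongr π₃).trans (FB.equiv R)) =
      UwbOrd.ofFB.map f ≫ UwbOrd.Hom.act (UwbOrd.mkHom L R) π₃ := by
    refine Eq.trans ?_ (UwbOrd.ofFB_comp_mkHom (X := X) (Y := Y) (n := n) f
      (((Equiv.refl _).sumCongr π₃).trans (FB.equiv L))
      (((Equiv.refl _).sumCongr π₃).trans (FB.equiv R))).symm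
    exact UwbOrd.Hom.ext' rfl (by rintro (_ | _) <;> rfl) (fun _ => rfl)
      (by rintro (_ | _) <;> rfl) (fun _ => rfl)
  have h0 := congrArg (fun z => comparisonMk (kuwbMk z)
    (amalgUbMk d (ubMk k pm mp (DubOrd.addPairsHom (part U d 0) s))
      (ubMk k pm mp (DubOrd.addPairsHom (part U d 1) t)))) hw
  have h1 := comparisonMk_ofFB_comp (k := k) (pm := pm) (mp := mp) f
    (UwbOrd.Hom.act (UwbOrd.mkHom L R) π₃) d (DubOrd.addPairsHom (part U d 0) s)
    (DubOrd.addPairsHom (part U d 1) t)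
  have h2 := congrArg₂ (fun x y => comparisonMk (kuwbMk (UwbOrd.Hom.act (UwbOrd.mkHom L R) π₃))
    (amalgUbMk d (ubMk k pm mp x) (ubMk k pm mp y))) ha hb
  have h3 := comparisonMk_act (k := k) (pm := pm) (mp := mp) (UwbOrd.mkHom L R) d
    (DubOrd.addPairsHom (part U d 0) s) (DubOrd.addPairsHom (part U d 1) t) ε₁ π₁ ε₂ π₂ π₃
  exact h0.trans (h1.trans (h2.trans h3))

/-- The relations between normal forms in `(k ub)` already hold in the tensor product, with the same
sign: by `normalHom_induction` only block symmetries occur. This is what makes the inverse well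
defined. -/
lemma normalElt_eq_of_act {U X Y : FB} {d d' : U → Fin 2} {s t n s' t' n' : ℕ}
    {L : ((part U d 0).addPairs s).addPoints n ⟶ X}
    {R : ((part U d 1).addPairs t).addPoints n ⟶ Y}
    {L' : ((part U d' 0).addPairs s').addPoints n' ⟶ X}
    {R' : ((part U d' 1).addPairs t').addPoints n' ⟶ Y}
    {ε : Fin (s + t + n) → Equiv.Perm (Fin 2)} {π : Equiv.Perm (Fin (s + t + n))}
    (h : DubOrd.normalHom d' L' R' = DubOrd.Hom.act (DubOrd.normalHom d L R) ε π) :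
    normalElt (k := k) (pm := pm) (mp := mp) d' L' R' =
      signIn k (DubOrd.wreathChar pm mp ε π) • normalElt d L R :=
  DubOrd.normalHom_induction pm mp h
    (P := fun d' _ _ _ L' R' c => normalElt (k := k) (pm := pm) (mp := mp) d' L' R' =
      signIn k c • normalElt d L R)
    fun ε₁ π₁ ε₂ π₂ π₃ => normalElt_act d L R ε₁ π₁ ε₂ π₂ π₃

/-! ### The inverse of the comparison map -/

/-- Since the formula is asserted for every normal form of `f` at once, later arguments may use
whichever normal form is convenient. -/
lemma exists_comparisonInv {U X Y : FB} (f : (⟨U⟩ : DubOrd) ⟶ ⟨X.sum Y⟩) :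
    ∃ z : ComparisonSource k pm mp U ⟨X, Y⟩, ∀ (d : U → Fin 2) (s t n : ℕ)
      (L : ((part U d 0).addPairs s).addPoints n ⟶ X)
      (R : ((part U d 1).addPairs t).addPoints n ⟶ Y)
      (ε : Fin (DubOrd.Hom.deg f) → Equiv.Perm (Fin 2))
      (π : Equiv.Perm (Fin (DubOrd.Hom.deg f))),
      DubOrd.Hom.act f ε π = DubOrd.normalHom d L R →
        z = signIn k (DubOrd.wreathChar pm mp ε π) • normalElt d L R := by
  obtain ⟨d, s, t, n, L, R, ε, π, h⟩ := DubOrd.exists_act_eq_normalHom f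
  refine ⟨signIn k (DubOrd.wreathChar pm mp ε π) • normalElt d L R, ?_⟩
  intro d' s' t' n' L' R' ε' π' h'
  obtain ⟨η, ρ, h1, h2⟩ := DubOrd.exists_act_eq_act pm mp h ε' π'
  have h3 := normalElt_eq_of_act (k := k) (pm := pm) (mp := mp) (h'.symm.trans h1)
  rw [h3, smul_smul]
  refine congrArg (· • normalElt d L R) ?_
  refine Eq.trans ?_ (congrArg (fun c => _ * signIn k c) h2).symm
  -- With `w`, `w'` the two symmetries: `χ(w') · (χ(w) χ(w')) = χ(w)`.
  rw [signIn_mul, mul_left_comm, signIn_mul_self, mul_one]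

/-- The inverse of the comparison map, on morphisms of the ordered category. -/
def comparisonInvFun {U X Y : FB} (f : (⟨U⟩ : DubOrd) ⟶ ⟨X.sum Y⟩) :
    ComparisonSource k pm mp U ⟨X, Y⟩ :=
  (exists_comparisonInv f).choose

lemma comparisonInvFun_eq {U X Y : FB} {f : (⟨U⟩ : DubOrd) ⟶ ⟨X.sum Y⟩} {d : U → Fin 2}
    {s t n : ℕ} {L : ((part U d 0).addPairs s).addPoints n ⟶ X}
    {R : ((part U d 1).addPairs t).addPoints n ⟶ Y}
    {ε : Fin (DubOrd.Hom.deg f) → Equiv.Perm (Fin 2)}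
    {π : Equiv.Perm (Fin (DubOrd.Hom.deg f))}
    (h : DubOrd.Hom.act f ε π = DubOrd.normalHom d L R) :
    comparisonInvFun (k := k) (pm := pm) (mp := mp) f =
      signIn k (DubOrd.wreathChar pm mp ε π) • normalElt d L R :=
  (exists_comparisonInv f).choose_spec d s t n L R ε π h

/-- A normal form reached from `f` by `w'` is reached from `f · w` by `w⁻¹ w'`, so the two values
differ by the sign `χ(w)`. -/
lemma comparisonInvFun_act {U X Y : FB} (f : (⟨U⟩ : DubOrd) ⟶ ⟨X.sum Y⟩)
    (ε : Fin (DubOrd.Hom.deg f) → Equiv.Perm (Fin 2))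
    (π : Equiv.Perm (Fin (DubOrd.Hom.deg f))) :
    comparisonInvFun (k := k) (pm := pm) (mp := mp) (DubOrd.Hom.act f ε π) =
      signIn k (DubOrd.wreathChar pm mp ε π) • comparisonInvFun f := by
  obtain ⟨d, s, t, n, L, R, ε', π', h⟩ := DubOrd.exists_act_eq_normalHom f
  obtain ⟨η, ρ, h1, h2⟩ := DubOrd.exists_act_eq_act pm mp (f := f) (ε := ε) (π := π) rfl ε' π'
  rw [comparisonInvFun_eq h, comparisonInvFun_eq (h1.symm.trans h), h2, signIn_mul, mul_smul]

/-- The inverse of the comparison map. -/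
def comparisonInv (U X Y : FB) : ((⟨Free.of k ⟨U⟩⟩ : Ub k pm mp) ⟶ ⟨Free.of k ⟨X.sum Y⟩⟩) →ₗ[k]
    ComparisonSource k pm mp U ⟨X, Y⟩ :=
  ubLift comparisonInvFun comparisonInvFun_act

/-- A normal form is its own normal form, by the trivial symmetry. -/
lemma comparisonInv_normalHom {U X Y : FB} (d : U → Fin 2) {s t n : ℕ}
    (L : ((part U d 0).addPairs s).addPoints n ⟶ X)
    (R : ((part U d 1).addPairs t).addPoints n ⟶ Y) :
    comparisonInv U X Y (ubMk k pm mp (DubOrd.normalHom d L R)) = normalElt d L R := by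
  refine (ubLift_mk _ _ _).trans ?_
  rw [comparisonInvFun_eq (DubOrd.Hom.act_one _)]
  refine (congrArg (fun c => signIn k c • normalElt d L R)
    (DubOrd.wreathChar_one pm mp _)).trans ?_
  rw [signIn_one, one_smul]

lemma comparison_comparisonInv {U X Y : FB} :
    comparison U ⟨X, Y⟩ ∘ₗ comparisonInv U X Y =
      (LinearMap.id : ((⟨Free.of k ⟨U⟩⟩ : Ub k pm mp) ⟶ ⟨Free.of k ⟨X.sum Y⟩⟩) →ₗ[k] _) := by
  refine ub_ext fun f => ?_
  obtain ⟨d, s, t, n, L, R, ε, π, h⟩ := DubOrd.exists_act_eq_normalHom f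
  have h1 : comparisonInv U X Y (ubMk k pm mp f) =
      signIn k (DubOrd.wreathChar pm mp ε π) • normalElt d L R :=
    (ubLift_mk _ _ _).trans (comparisonInvFun_eq h)
  have h2 : ubMk k pm mp (DubOrd.normalHom d L R) =
      signIn k (DubOrd.wreathChar pm mp ε π) • ubMk k pm mp f := by
    rw [← h, ubMk_act]
  refine (congrArg (comparison U ⟨X, Y⟩) h1).trans ((map_smul _ _ _).trans ?_)
  refine (congrArg (signIn k (DubOrd.wreathChar pm mp ε π) • ·)
    ((comparison_normalElt d L R).trans h2)).trans ?_
  -- The sign occurs twice, once in the definition of the inverse and once in passing from the class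
  -- of the normal form back to that of `f`.
  exact (smul_smul _ _ _).trans ((congrArg (fun c : k => c • ubMk k pm mp f)
    (signIn_mul_self _)).trans (one_smul _ _))

lemma comparison_ext {U : FB} {P : UwbOrd} {V : Type*} [AddCommGroup V] [Module k V]
    {F G : ComparisonSource k pm mp U P →ₗ[k] V}
    (h : ∀ {S T : FB} (w : (⟨S, T⟩ : UwbOrd) ⟶ P) (d : U → Fin 2)
      (a : (⟨part U d 0⟩ : DubOrd) ⟶ ⟨S⟩) (b : (⟨part U d 1⟩ : DubOrd) ⟶ ⟨T⟩),
      F (comparisonMk (kuwbMk w) (amalgUbMk d (ubMk k pm mp a) (ubMk k pm mp b))) =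
        G (comparisonMk (kuwbMk w) (amalgUbMk d (ubMk k pm mp a) (ubMk k pm mp b)))) : F = G := by
  refine Submodule.linearMap_qext _ (DirectSum.linearMap_ext _ fun i : ℕ × ℕ =>
    TensorProduct.ext (uwb_ext fun w => amalgOp_ext fun d a b => ?_))
  have h1 := h (S := ⟨Fin i.1⟩) (T := ⟨Fin i.2⟩) w d a b
  have h2 := balancedMkObj_obj (fbReps k) (kuwbBimodule k mp) (amalgOp (kubTensorSq k pm mp)) i
    (kuwbMk (S := ⟨Fin i.1⟩) (T := ⟨Fin i.2⟩) w)
    (amalgUbMk (S := ⟨Fin i.1⟩) (T := ⟨Fin i.2⟩) d (ubMk k pm mp a) (ubMk k pm mp b))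
  exact (congrArg F h2).symm.trans (h1.trans (congrArg G h2))

/-- Generators are normal form elements, and both maps carry the data of a normal form to the same
data. -/
lemma comparisonInv_comparison {U X Y : FB} :
    comparisonInv U X Y ∘ₗ comparison U ⟨X, Y⟩ =
      (LinearMap.id : ComparisonSource k pm mp U ⟨X, Y⟩ →ₗ[k] _) := by
  refine comparison_ext fun w d a b => ?_
  obtain ⟨s, t, n, L, R, h⟩ := exists_comparisonMk_eq_normalElt (k := k) (pm := pm) (mp := mp)
    w d a b
  rw [h]
  exact (congrArg (comparisonInv U X Y) (comparison_normalElt d L R)).trans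
    (comparisonInv_normalHom d L R)

/-- The comparison isomorphism. -/
def comparisonEquiv (U : FB) (P : UwbOrd) : ComparisonSource k pm mp U P ≃ₗ[k]
    ((⟨Free.of k ⟨U⟩⟩ : Ub k pm mp) ⟶ ⟨Free.of k (unW.obj P)⟩) :=
  LinearEquiv.ofLinearMap (comparison U P) (comparisonInv U P.fst P.snd) comparison_comparisonInv
    comparisonInv_comparison

end Comparison

/-! ### Equivariance of maps out of a tensor product over a category -/

section Modules

variable {k : Type u} [CommRing k]
variable {𝒜 ℬ 𝒞 : Type*} [Category.{u} 𝒜] [Preadditive 𝒜] [Linear k 𝒜]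
  [Category.{u} ℬ] [Preadditive ℬ] [Linear k ℬ] [Category.{u} 𝒞] [Preadditive 𝒞] [Linear k 𝒞]

lemma balancedLift_balancedQ (E : Representatives 𝒜) (M : LMod k (TensorCat k 𝒜ᵒᵖ ℬ))
    (N : LMod k (TensorCat k 𝒞 𝒜)) {C C' : 𝒞} {B B' : ℬ} (γ : C ⟶ C') (β : B ⟶ B')
    {V V' : Type*} [AddCommGroup V] [Module k V] [AddCommGroup V'] [Module k V']
    (b : ∀ i, M.obj.obj ⟨op (E.obj i), B⟩ →ₗ[k] N.obj.obj ⟨C, E.obj i⟩ →ₗ[k] V) (hb)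
    (b' : ∀ i, M.obj.obj ⟨op (E.obj i), B'⟩ →ₗ[k] N.obj.obj ⟨C', E.obj i⟩ →ₗ[k] V') (hb')
    (φ : V →ₗ[k] V')
    (h : ∀ i x y, b' i (actR M _ _ _ β x) (actL N _ _ _ γ y) = φ (b i x y)) (z) :
    balancedLift E M N b' hb' (balancedQ E M N γ β z) = φ (balancedLift E M N b hb z) := by
  have h' : balancedLift E M N b' hb' ∘ₗ balancedQ E M N γ β = φ ∘ₗ balancedLift E M N b hb := by
    refine balanced_ext E M N fun i x y => ?_
    rw [LinearMap.comp_apply, LinearMap.comp_apply, balancedQ_mk, balancedLift_mk, balancedLift_mk,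
      h]
  exact LinearMap.congr_fun h' z

end Modules

/-! ### Equivariance of the comparison map -/

section Comparison

variable {k : Type u} [CommRing k] {pm mp : ℤˣ}

lemma comparisonBilin_apply {U S T : FB} {P : UwbOrd}
    (x : (kuwbBimodule k mp).obj.obj ⟨op (Free.of k (S, T)), ⟨Free.of k P⟩⟩)
    (y : (amalgOp (kubTensorSq k pm mp)).obj.obj ⟨op (Free.of k U), Free.of k (S, T)⟩) :
    comparisonBilin U S T P x y =
      amalgSum U S T y ≫ (upsilon k pm mp).mapₗ ⟨Free.of k ⟨S, T⟩⟩ ⟨Free.of k P⟩ x := (rfl)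

/-- Precomposition with `g` concerns `y` only. The identity acts on `x` because `balancedQ` acts on
both factors simultaneously. -/
lemma comparisonBilin_left {U U' S T : FB} {P : UwbOrd} (g : Free.of k U' ⟶ Free.of k U)
    (x : (kuwbBimodule k mp).obj.obj ⟨op (Free.of k (S, T)), ⟨Free.of k P⟩⟩)
    (y : (amalgOp (kubTensorSq k pm mp)).obj.obj ⟨op (Free.of k U), Free.of k (S, T)⟩) :
    comparisonBilin U' S T P
      (actR (kuwbBimodule k mp) (op (Free.of k (S, T))) ⟨Free.of k P⟩ ⟨Free.of k P⟩ (𝟙 _) x)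
      (actL (amalgOp (kubTensorSq k pm mp)) (op (Free.of k U)) (op (Free.of k U'))
        (Free.of k (S, T)) g.op y) =
      (inclUb k pm mp).func.map g ≫ comparisonBilin U S T P x y := by
  have hx : actR (kuwbBimodule k mp) (op (Free.of k (S, T))) ⟨Free.of k P⟩ ⟨Free.of k P⟩ (𝟙 _) x
    = x := LinearMap.congr_fun (actR_id _ _ _) x
  rw [hx, comparisonBilin_apply, comparisonBilin_apply, amalgSum_actL]
  exact Category.assoc _ _ _

/-- Functoriality of `υ` and associativity: `f` is composed after `x` only. -/
lemma comparisonBilin_right {U S T : FB} {P P' : UwbOrd}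
    (f : (⟨Free.of k P⟩ : Uwb k mp) ⟶ ⟨Free.of k P'⟩)
    (x : (kuwbBimodule k mp).obj.obj ⟨op (Free.of k (S, T)), ⟨Free.of k P⟩⟩)
    (y : (amalgOp (kubTensorSq k pm mp)).obj.obj ⟨op (Free.of k U), Free.of k (S, T)⟩) :
    comparisonBilin U S T P'
      (actR (kuwbBimodule k mp) (op (Free.of k (S, T))) ⟨Free.of k P⟩ ⟨Free.of k P'⟩ f x)
      (actL (amalgOp (kubTensorSq k pm mp)) (op (Free.of k U)) (op (Free.of k U))
        (Free.of k (S, T)) (𝟙 _) y) =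
      comparisonBilin U S T P x y ≫ (upsilon k pm mp).func.map f := by
  have hy : actL (amalgOp (kubTensorSq k pm mp)) (op (Free.of k U)) (op (Free.of k U))
        (Free.of k (S, T)) (𝟙 _) y = y := LinearMap.congr_fun (actL_id _ _ _) y
  rw [hy, comparisonBilin_apply, comparisonBilin_apply]
  have hx : (upsilon k pm mp).mapₗ ⟨Free.of k ⟨S, T⟩⟩ ⟨Free.of k P'⟩
      (actR (kuwbBimodule k mp) (op (Free.of k (S, T))) ⟨Free.of k P⟩ ⟨Free.of k P'⟩ f x) =
      (upsilon k pm mp).mapₗ ⟨Free.of k ⟨S, T⟩⟩ ⟨Free.of k P⟩ x ≫ (upsilon k pm mp).func.map f :=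
    (congrArg ((upsilon k pm mp).mapₗ _ _) (kuwbBimodule_actR _ f x)).trans
      ((upsilon k pm mp).func.map_comp _ _)
  rw [hx]
  exact (Category.assoc _ _ _).symm

lemma comparison_balancedQ_left {U U' : FB} (P : UwbOrd) (g : Free.of k U' ⟶ Free.of k U)
    (z : ComparisonSource k pm mp U P) :
    comparison U' P (balancedQ (fbReps k) (kuwbBimodule k mp) (amalgOp (kubTensorSq k pm mp))
      g.op (𝟙 (⟨Free.of k P⟩ : Uwb k mp)) z) =
      (inclUb k pm mp).func.map g ≫ comparison U P z :=
  balancedLift_balancedQ (fbReps k) (kuwbBimodule k mp) (amalgOp (kubTensorSq k pm mp))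
    g.op (𝟙 (⟨Free.of k P⟩ : Uwb k mp))
    (fun i : ℕ × ℕ => comparisonBilin U ⟨Fin i.1⟩ ⟨Fin i.2⟩ P)
    (fun f x y => comparisonBilin_balanced f x y)
    (fun i : ℕ × ℕ => comparisonBilin U' ⟨Fin i.1⟩ ⟨Fin i.2⟩ P)
    (fun f x y => comparisonBilin_balanced f x y)
    (Linear.leftComp k (⟨Free.of k (unW.obj P)⟩ : Ub k pm mp) ((inclUb k pm mp).func.map g))
    (fun _ x y => comparisonBilin_left g x y) z

lemma comparison_balancedQ_right (U : FB) {P P' : UwbOrd}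
    (f : (⟨Free.of k P⟩ : Uwb k mp) ⟶ ⟨Free.of k P'⟩) (z : ComparisonSource k pm mp U P) :
    comparison U P' (balancedQ (fbReps k) (kuwbBimodule k mp) (amalgOp (kubTensorSq k pm mp))
      (𝟙 (op (Free.of k U))) f z) =
      comparison U P z ≫ (upsilon k pm mp).func.map f :=
  balancedLift_balancedQ (fbReps k) (kuwbBimodule k mp) (amalgOp (kubTensorSq k pm mp))
    (𝟙 (op (Free.of k U))) f
    (fun i : ℕ × ℕ => comparisonBilin U ⟨Fin i.1⟩ ⟨Fin i.2⟩ P)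
    (fun f x y => comparisonBilin_balanced f x y)
    (fun i : ℕ × ℕ => comparisonBilin U ⟨Fin i.1⟩ ⟨Fin i.2⟩ P')
    (fun f x y => comparisonBilin_balanced f x y)
    (Linear.rightComp k (⟨Free.of k ⟨U⟩⟩ : Ub k pm mp) ((upsilon k pm mp).func.map f))
    (fun _ x y => comparisonBilin_right f x y) z

end Comparison

/-! ### Isomorphisms from a tensor product over a category -/

section Modules

variable {k : Type u} [CommRing k]
variable {𝒜 ℬ 𝒞 : Type*} [Category.{u} 𝒜] [Preadditive 𝒜] [Linear k 𝒜]
  [Category.{u} ℬ] [Preadditive ℬ] [Linear k ℬ] [Category.{u} 𝒞] [Preadditive 𝒞] [Linear k 𝒞]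

/-- An isomorphism from a tensor product over `𝒜` to a module over `𝒞 ⊗ ℬ`, given by isomorphisms
which commute with both actions. -/
def tensorOverIso (E : Representatives 𝒜) (M : LMod k (TensorCat k 𝒜ᵒᵖ ℬ))
    (N : LMod k (TensorCat k 𝒞 𝒜)) (K : LMod k (TensorCat k 𝒞 ℬ))
    (e : ∀ C B, (_ ⧸ balancedRel E M N C B) ≃ₗ[k] K.obj.obj ⟨C, B⟩)
    (hl : ∀ {C C'} (B) (γ : C ⟶ C') z,
      e C' B (balancedQ E M N γ (𝟙 B) z) = actL K C C' B γ (e C B z))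
    (hr : ∀ (C) {B B'} (β : B ⟶ B') z,
      e C B' (balancedQ E M N (𝟙 C) β z) = actR K C B B' β (e C B z)) :
    tensorOver E M N ≅ K :=
  tensorCatIso (M := tensorOver E M N) e
    (fun B γ z => (congrArg (e _ B) (LinearMap.congr_fun (tensorOver_actL E M N B γ) z)).trans
      (hl B γ z))
    (fun C _ _ β z => (congrArg (e C _) (LinearMap.congr_fun (tensorOver_actR E M N C β) z)).trans
      (hr C β z))

end Modules

/-! ### Assembling the isomorphism of modules -/

section Comparison

variable {k : Type u} [CommRing k] {pm mp : ℤˣ}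

variable (k pm mp) in
/-- The comparison isomorphism, with values in the restricted bimodule. -/
def comparisonAt (U : (Free k FB)ᵒᵖ) (P : Uwb k mp) :
    (_ ⧸ balancedRel (fbReps k) (kuwbBimodule k mp) (amalgOp (kubTensorSq k pm mp)) U P) ≃ₗ[k]
      (upsilonPullback k pm mp).obj.obj ⟨U, P⟩ :=
  comparisonEquiv (k := k) (pm := pm) (mp := mp) (unop U) P.as

lemma comparisonAt_apply {U : FB} {P : UwbOrd} (z : ComparisonSource k pm mp U P) :
    comparisonAt k pm mp (op (Free.of k U)) ⟨Free.of k P⟩ z = comparison U P z := (rfl)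

lemma comparisonAt_balancedQ_left {U U' : (Free k FB)ᵒᵖ} (P : Uwb k mp) (f : U ⟶ U') (z) :
    comparisonAt k pm mp U' P (balancedQ (fbReps k) (kuwbBimodule k mp)
      (amalgOp (kubTensorSq k pm mp)) f (𝟙 P) z) =
      actL (upsilonPullback k pm mp) U U' P f (comparisonAt k pm mp U P z) := by
  -- Every object of these opposite, linearized or quotient categories is definitionally a wrapped
  -- finite set or pair; unwrapping it brings the goal to the form of the lemmas on `comparison`.
  obtain ⟨U, rfl⟩ : ∃ X, op (Free.of k X) = U := ⟨U.unop, rfl⟩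
  obtain ⟨U', rfl⟩ : ∃ X, op (Free.of k X) = U' := ⟨U'.unop, rfl⟩
  obtain ⟨P, rfl⟩ : ∃ Q, (⟨Free.of k Q⟩ : Uwb k mp) = P := ⟨P.as, rfl⟩
  obtain ⟨g, rfl⟩ : ∃ g, Quiver.Hom.op g = f := ⟨f.unop, rfl⟩
  refine (comparisonAt_apply _).trans ?_
  refine Eq.trans ?_ (congrArg (actL (upsilonPullback k pm mp) (op (Free.of k U))
    (op (Free.of k U')) ⟨Free.of k P⟩ g.op) (comparisonAt_apply z).symm)
  refine Eq.trans ?_ (upsilonPullback_actL ⟨Free.of k P⟩ g.op (comparison U P z)).symm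
  exact comparison_balancedQ_left P g z

lemma comparisonAt_balancedQ_right (U : (Free k FB)ᵒᵖ) {P P' : Uwb k mp} (f : P ⟶ P') (z) :
    comparisonAt k pm mp U P' (balancedQ (fbReps k) (kuwbBimodule k mp)
      (amalgOp (kubTensorSq k pm mp)) (𝟙 U) f z) =
      actR (upsilonPullback k pm mp) U P P' f (comparisonAt k pm mp U P z) := by
  obtain ⟨U, rfl⟩ : ∃ X, op (Free.of k X) = U := ⟨U.unop, rfl⟩
  obtain ⟨P, rfl⟩ : ∃ Q, (⟨Free.of k Q⟩ : Uwb k mp) = P := ⟨P.as, rfl⟩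
  obtain ⟨P', rfl⟩ : ∃ Q, (⟨Free.of k Q⟩ : Uwb k mp) = P' := ⟨P'.as, rfl⟩
  refine (comparisonAt_apply _).trans ?_
  refine Eq.trans ?_ (congrArg (actR (upsilonPullback k pm mp) (op (Free.of k U))
    ⟨Free.of k P⟩ ⟨Free.of k P'⟩ f) (comparisonAt_apply z).symm)
  refine Eq.trans ?_ (upsilonPullback_actR (op (Free.of k U)) f (comparison U P z)).symm
  exact comparison_balancedQ_right U f z

variable (k pm mp) in
/-- The isomorphism of modules given by the comparison maps. -/
def comparisonIso : tensorOver (fbReps k) (kuwbBimodule k mp) (amalgOp (kubTensorSq k pm mp)) ≅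
    upsilonPullback k pm mp :=
  tensorOverIso (fbReps k) (kuwbBimodule k mp) (amalgOp (kubTensorSq k pm mp))
    (upsilonPullback k pm mp) (comparisonAt k pm mp) comparisonAt_balancedQ_left
    comparisonAt_balancedQ_right

end Comparison

end TwistedBrauer

theorem mainTheorem8 {k : Type u} [Field k] [CharZero k] (pm mp : ℤˣ) :
    Nonempty (TwistedBrauer.upsilonPullback k pm mp ≅
      TwistedBrauer.tensorOver (TwistedBrauer.fbReps k)
        (TwistedBrauer.kuwbBimodule k mp)
        (TwistedBrauer.amalgOp (TwistedBrauer.kubTensorSq k pm mp))) :=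
  ⟨(TwistedBrauer.comparisonIso k pm mp).symm⟩
end
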